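/- Let $G=(V,E)$ be a connected undirected graph with $n$ vertices, $m$ edges and maximum degree $\Delta$. A 2-spanner of $G$ is a subgraph $H$ of $G$ such that the endpoints of every edge of $G$ are joined by a path of length at most $2$ in $H$; the minimum 2-spanner problem asks for a 2-spanner with the fewest edges. In the LOCAL model the input is the communication graph $G$ itself: the vertices have distinct identifiers, each vertex initially knows only its own identifier, those of its neighbors, and an upper bound $N\ge n$; computation proceeds in synchronous rounds, in each of which every vertex may flip private coins and exchange messages of unbounded size with its neighbors; when it halts, each vertex outputs a subset of its edges, and the solution is the union of the outputs. There is a randomized distributed algorithm in the LOCAL model for the minimum 2-spanner problem such that, for every connected graph $G$: (1) in each round every vertex performs only polynomial local computation, i.e. computation in time polynomial in $n$ and in the bit lengths of the identifiers and of $N$; (2) in every execution (for all outcomes of the coin flips) all vertices eventually halt, and the output is a 2-spanner of $G$ whose number of edges is at most $O\bigl(\log(2+\frac{m}{n})\bigr)$ times the minimum number of edges of a 2-spanner of $G$; (3) for every constant $c\ge 1$, with probability at least $1-\frac1{n^c}$ all vertices have halted after $O\bigl(\log (n+2)\cdot\log(\Delta+2)\bigr)$ rounds, where the constant in $O(\cdot)$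 depends only on $c$. -/

import Mathlib

/-! ### Spanners -/

/-- `H` is a `k`-spanner of `G`: a subgraph of `G` such that the endpoints of every edge of `G` are
joined by a path of length at most `k` in `H`. -/
def IsSpanner {V : Type*} (k : ℕ) (G H : SimpleGraph V) : Prop :=
  H ≤ G ∧ ∀ u v : V, G.Adj u v → ∃ p : H.Walk u v, p.length ≤ k

/-! ### Local computation: a first-order language with an explicit cost -/

/-- The types of the data that vertices store, compute and send. -/
inductive Ty : Type where
  | nat : Ty
  | bool : Ty
  | prod : Ty → Ty → Ty
  | list : Ty → Ty

/-- The values of a type. -/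
@[reducible] def Ty.denote : Ty → Type
  | .nat => ℕ
  | .bool => Bool
  | .prod a b => a.denote × b.denote
  | .list a => List a.denote

/-- The length of (a fixed standard encoding of) a value; numbers are written in binary. -/
def Ty.size : (a : Ty) → a.denote → ℕ
  | .nat, n => 1 + Nat.size n
  | .bool, _ => 1
  | .prod a b, x => 1 + a.size x.1 + b.size x.2
  | .list a, l => 1 + (l.map fun x => 1 + a.size x).sum

/-- Programs with an input and an output type. The primitives are elementary operations on numbers
(binary arithmetic, comparison, bit length), pairs and lists; the control structures are
composition, branching on a Boolean, case distinction on a list, and a loop over the entries of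
a list (with a loop variable of type `s` and a context of type `c` that stays fixed). -/
inductive Prog : Ty → Ty → Type where
  | id {a : Ty} : Prog a a
  | comp {a b c : Ty} (g : Prog b c) (f : Prog a b) : Prog a c
  | pair {a b c : Ty} (f : Prog c a) (g : Prog c b) : Prog c (.prod a b)
  | fst {a b : Ty} : Prog (.prod a b) a
  | snd {a b : Ty} : Prog (.prod a b) b
  | tt {a : Ty} : Prog a .bool
  | ff {a : Ty} : Prog a .bool
  | ite {a b : Ty} (t : Prog a .bool) (f g : Prog a b) : Prog a b
  | const {a : Ty} (n : ℕ) : Prog a .nat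
  | add : Prog (.prod .nat .nat) .nat
  | sub : Prog (.prod .nat .nat) .nat
  | mul : Prog (.prod .nat .nat) .nat
  | div : Prog (.prod .nat .nat) .nat
  | eq : Prog (.prod .nat .nat) .bool
  | lt : Prog (.prod .nat .nat) .bool
  | bitLength : Prog .nat .nat
  | range : Prog .nat (.list .nat)
  | nil {a b : Ty} : Prog a (.list b)
  | cons {a : Ty} : Prog (.prod a (.list a)) (.list a)
  | cases {a b c : Ty} (f : Prog c b) (g : Prog (.prod c (.prod a (.list a))) b) :
      Prog (.prod c (.list a)) b
  | fold {a s c : Ty} (f : Prog (.prod c (.prod s a)) s) : Prog (.prod c (.prod s (.list a))) s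

/-- The value that a program computes on an input. -/
def Prog.eval : {a b : Ty} → Prog a b → a.denote → b.denote
  | _, _, .id, x => x
  | _, _, .comp g f, x => g.eval (f.eval x)
  | _, _, .pair f g, x => (f.eval x, g.eval x)
  | _, _, .fst, x => x.1
  | _, _, .snd, x => x.2
  | _, _, .tt, _ => true
  | _, _, .ff, _ => false
  | _, _, .ite t f g, x => if t.eval x = true then f.eval x else g.eval x
  | _, _, .const n, _ => n
  | _, _, .add, x => x.1 + x.2
  | _, _, .sub, x => x.1 - x.2
  | _, _, .mul, x => x.1 * x.2
  | _, _, .div, x => x.1 / x.2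
  | _, _, .eq, x => decide (x.1 = x.2)
  | _, _, .lt, x => decide (x.1 < x.2)
  | _, _, .bitLength, x => Nat.size x
  | _, _, .range, x => List.range x
  | _, _, .nil, _ => []
  | _, _, .cons, x => x.1 :: x.2
  | _, _, .cases f g, x =>
      match x.2 with
      | [] => f.eval x.1
      | y :: l => g.eval (x.1, (y, l))
  | _, _, .fold f, x => x.2.2.foldl (fun r y => f.eval (x.1, (r, y))) x.2.1

/-- The total cost of a loop over a list, for a loop body with value `ev` and cost `co`. -/
def loopCost {α σ : Type} (ev : σ → α → σ) (co : σ → α → ℕ) : σ → List α → ℕ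
  | _, [] => 0
  | r, y :: l => co r y + loopCost ev co (ev r y) l

/-- The running time of a program on an input. Every executed instruction is charged `1` plus the
length of its result (the result of a composition or of a branch is charged where it arises), so that the time bounds the length of everything that is computed, and
every instruction can be carried out by a Turing machine within a time that is polynomial in
what has been charged (and in the length of the input). -/
def Prog.cost : {a b : Ty} → Prog a b → a.denote → ℕ
  | a, _, .id, x => 1 + a.size x
  | _, _, .comp g f, x => 1 + f.cost x + g.cost (f.eval x)
  | _, _, .pair (a := a) (b := b) f g, x =>
      1 + Ty.size (.prod a b) (f.eval x, g.eval x) + f.cost x + g.cost x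
  | _, a, .fst, x => 1 + a.size x.1
  | _, b, .snd, x => 1 + b.size x.2
  | _, _, .tt, _ => 1 + Ty.size .bool true
  | _, _, .ff, _ => 1 + Ty.size .bool false
  | _, _, .ite t f g, x => 1 + t.cost x + (if t.eval x = true then f.cost x else g.cost x)
  | _, _, .const n, _ => 1 + Ty.size .nat n
  | _, _, .add, x => 1 + Ty.size .nat (Prog.add.eval x)
  | _, _, .sub, x => 1 + Ty.size .nat (Prog.sub.eval x)
  | _, _, .mul, x => 1 + Ty.size .nat (Prog.mul.eval x)
  | _, _, .div, x => 1 + Ty.size .nat (Prog.div.eval x)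
  | _, _, .eq, x => 1 + Ty.size .bool (Prog.eq.eval x)
  | _, _, .lt, x => 1 + Ty.size .bool (Prog.lt.eval x)
  | _, _, .bitLength, x => 1 + Ty.size .nat (Prog.bitLength.eval x)
  | _, _, .range, x => 1 + Ty.size (.list .nat) (Prog.range.eval x)
  | _, _, .nil (b := b), _ => 1 + Ty.size (.list b) []
  | _, _, .cons (a := a), x => 1 + Ty.size (.list a) (x.1 :: x.2)
  | _, _, .cases f g, x =>
      1 + match x.2 with
        | [] => f.cost x.1
        | y :: l => g.cost (x.1, (y, l))
  | _, b, .fold f, x =>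
      1 + b.size ((Prog.fold f).eval x) +
        loopCost (fun r y => f.eval (x.1, (r, y))) (fun r y => f.cost (x.1, (r, y))) x.2.1 x.2.2

/-! ### The LOCAL model

The network is a graph whose vertices are their own identifiers: the vertex set is a finite set of
natural numbers. Computation proceeds in synchronous rounds. In every round every vertex that has
not halted sends a message, of unbounded length, to each of its neighbours, receives the messages
of its neighbours, flips private fair coins, and updates its state. A vertex that has halted does
nothing any more: it sends no messages and keeps its state. -/

/-- A randomized distributed algorithm: the programs that every vertex executes. -/
structure LocalAlgorithm where
  /-- the type of the local states -/
  State : Ty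
  /-- the type of the messages -/
  Msg : Ty
  /-- the first state, computed from the identifier of the vertex, the known upper bound on the
  number of vertices, and the list of the identifiers of the neighbours -/
  init : Prog (.prod .nat (.prod .nat (.list .nat))) State
  /-- the message for the neighbour with the given identifier -/
  send : Prog (.prod State .nat) Msg
  /-- the number of fair coins to be flipped in this round -/
  coins : Prog State .nat
  /-- the new state, computed from the old state, the outcome of the coin flips (read as a binary
  number), and the list of the received messages with the identifiers of their senders -/
  update : Prog (.prod State (.prod .nat (.list (.prod .nat Msg)))) State
  /-- whether the vertex has halted -/
  halted : Prog State .bool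
  /-- the output of a halted vertex: a list of identifiers of neighbours -/
  output : Prog State (.list .nat)

namespace LocalAlgorithm

variable (A : LocalAlgorithm) {V : Finset ℕ} (G : SimpleGraph V) [DecidableRel G.Adj]

/-- The neighbours of a vertex, in the order of their identifiers. -/
def neighborList (v : V) : List V := (G.neighborFinset v).sort (· ≤ ·)

/-- A global configuration: the local states of all vertices. -/
abbrev Config (V : Finset ℕ) : Type := V → A.State.denote

/-- What the vertex `v` knows at the start: its identifier, the upper bound `N` on the number of
vertices, and the identifiers of its neighbours. -/
def initInput (N : ℕ) (v : V) : (Ty.prod .nat (.prod .nat (.list .nat))).denote :=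
  ((v : ℕ), (N, (neighborList G v).map fun (u : V) => (u : ℕ)))

/-- The configuration before the first round. -/
def initConfig (N : ℕ) : A.Config V := fun v => A.init.eval (initInput G N v)

/-- The vertex `v` has halted. -/
def HasHalted (c : A.Config V) (v : V) : Prop := A.halted.eval (c v) = true

instance (c : A.Config V) (v : V) : Decidable (A.HasHalted c v) :=
  inferInstanceAs (Decidable (_ = true))

/-- All vertices have halted. -/
def AllHalted (c : A.Config V) : Prop := ∀ v : V, A.HasHalted c v

/-- The messages that `v` receives: one from each neighbour that has not halted. -/
def inbox (c : A.Config V) (v : V) : (Ty.list (.prod .nat A.Msg)).denote :=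
  ((neighborList G v).filter fun u => ¬ A.HasHalted c u).map
    fun (u : V) => ((u : ℕ), A.send.eval (c u, (v : ℕ)))

/-- The possible outcomes of the coin flips of all vertices in a round: `v` flips as many coins as
its state demands, and the outcome is read as a binary number. -/
abbrev Flips (c : A.Config V) : Type := (v : V) → Fin (2 ^ (A.coins.eval (c v) : ℕ))

instance (c : A.Config V) : Nonempty (A.Flips c) := ⟨fun _ => ⟨0, Nat.two_pow_pos _⟩⟩

/-- The input of the state update of the vertex `v`. -/
def updateInput (c : A.Config V) (r : A.Flips c) (v : V) :
    (Ty.prod A.State (.prod .nat (.list (.prod .nat A.Msg)))).denote :=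
  (c v, ((r v : ℕ), A.inbox G c v))

/-- The configuration after a round with the coin flips `r`. -/
def next (c : A.Config V) (r : A.Flips c) : A.Config V := fun v =>
  if A.HasHalted c v then c v else A.update.eval (A.updateInput G c r v)

/-- The distribution of the configuration after `t` rounds, when `N` is the upper bound on the
number of vertices that is known to the vertices. All coin flips are fair and independent. -/
noncomputable def run (N : ℕ) : ℕ → PMF (A.Config V)
  | 0 => PMF.pure (A.initConfig G N)
  | t + 1 => (run N t).bind fun c => (PMF.uniformOfFintype (A.Flips c)).map (A.next G c)

/-- The time that the vertex `v` spends on local computation in a round: the halting test, then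
the output if it has halted, and otherwise the coin flips, the messages to all neighbours,
and reading and processing the received messages. -/
def localTime (c : A.Config V) (r : A.Flips c) (v : V) : ℕ :=
  A.halted.cost (c v) +
    if A.HasHalted c v then A.output.cost (c v)
    else
      A.coins.cost (c v) + A.coins.eval (c v) +
      ((neighborList G v).map fun (u : V) => A.send.cost (c v, (u : ℕ))).sum +
      Ty.size _ (A.updateInput G c r v) + A.update.cost (A.updateInput G c r v)

/-- The length of the description of a network: the number of vertices, plus the bit lengths of
the known upper bound `N` and of the longest identifier. -/
def inputLength (V : Finset ℕ) (N : ℕ) : ℕ := V.card + Nat.size N + V.sup Nat.size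

/-- On connected networks of which an upper bound on the number of vertices is known, every vertex
spends in every round, and before the first round, for all outcomes of the coin flips, only
time polynomial in the number of vertices and in the bit lengths of the identifiers and of
the known bound. -/
def HasPolynomialLocalTime : Prop :=
  ∃ p : Polynomial ℕ, ∀ (V : Finset ℕ) (G : SimpleGraph V) [DecidableRel G.Adj] (N : ℕ),
    G.Connected → V.card ≤ N → ∀ v : V,
      Ty.size _ (initInput G N v) + A.init.cost (initInput G N v) ≤ p.eval (inputLength V N) ∧
      ∀ t : ℕ, ∀ c ∈ (A.run G N t).support, ∀ r : A.Flips c,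
        A.localTime G c r v ≤ p.eval (inputLength V N)

/-- Every vertex outputs a list of neighbours, i.e. a subset of its edges. -/
def OutputsEdges (c : A.Config V) : Prop :=
  ∀ v : V, ∀ x ∈ A.output.eval (c v), ∃ u : V, G.Adj v u ∧ (u : ℕ) = x

/-- The union of all outputs, as a graph. -/
def outputGraph (c : A.Config V) : SimpleGraph V :=
  SimpleGraph.fromRel fun u v => (v : ℕ) ∈ A.output.eval (c u)

end LocalAlgorithm

/-! The algorithm is a distributed greedy covering. A set of neighbours of `v`, taken as a star
centred at `v`, covers all edges of `G` inside that set. Let `U` be the graph of edges not yet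
covered. Each vertex picks a nearly densest star: the nonempty `2 ^ j`-core of `U` on its neighbours
with `j` as large as possible. The power `2 ^ j` is its level. In such a core each vertex has at
least `2 ^ j` partners, while emptiness of the next core bounds the density of every star at `v`
(`StarData.card_dartsIn_le`), so the choice is optimal up to a factor 4. An iteration takes four
rounds. The vertices compute stars and draw random ranks. Each uncovered edge then votes for the
star of smallest rank among the stars of its maximal level that contain it. A star with votes from
an eighth of its darts (ordered edges) is added. Finally edges covered by added stars are deleted
from `U`, and edges in no triangle are added to the spanner directly.

Size. Let `H` be any 2-spanner, and assign every edge outside `H` to the midpoint of a path of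
length 2 in `H`. For a vertex `w` with `s` neighbours in `H` and `k` uncovered darts assigned to it,
keep a budget proportional to `s * log (1 + k / s)`. A dart that votes releases about `s / (s + k)`
of it. The density bound gives `k ≤ 4 * lev w * s`, and `lev w` is at most the level of the star
voted for, so the votes of an accepted star pay for all its edges (`card_added_le_budget`). This
happens in every execution. Concavity of the logarithm bounds the initial budget by `O(log (2 + m /
n))` times the size of `H` (`budget_le`).

Termination. Among the stars of highest level, the one that is first by rank and identifier receives
the votes of all its darts, so every iteration with `U ≠ ⊥` covers something
(`StarData.card_darts_nextU_lt`).

Speed. Consider the stars of the highest level. Conditioned on `v` winning a dart `d`, a dart with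
no more rivals than `d` also votes for `v` with probability nearly one half; hence stars are
accepted often enough that a 3/32 fraction of the pairs (star, dart) of that level is covered in
expectation (`StarData.sum_card_uncovered_le`). The potential `psi` weights the levels by powers of
`n ^ 3 + 1`, so that the top level dominates, and it shrinks in expectation by the factor 31/32
(`psi_step`). It starts below `n ^ O(log Δ)` and is an integer, so `O(log n * log Δ)` iterations
make it vanish with high probability.

The remaining work is to show that the message-passing programs carry out this abstract iteration
(`StartConfig.iteration`) and run in polynomial time, by closure properties of `PolyFn` and size
bounds on the states. -/

/-! ### Functions computable by polynomial-time programs -/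

theorem polynomial_eval_mono (p : Polynomial ℕ) {m n : ℕ} (h : m ≤ n) : p.eval m ≤ p.eval n := by
  rw [Polynomial.eval_eq_sum, Polynomial.eval_eq_sum]
  exact Finset.sum_le_sum fun i _ => Nat.mul_le_mul_left _ (Nat.pow_le_pow_left h i)

/-- Results are charged where they arise, so a time bound is also a bound on the output length; this
is what lets polynomial bounds be composed. -/
theorem Prog.size_eval_le_cost {a b : Ty} (p : Prog a b) (x : a.denote) :
    b.size (p.eval x) ≤ p.cost x := by
  induction p with
  | id => simp [Prog.eval, Prog.cost]
  | comp g f hg hf =>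
    have := hg (f.eval x)
    simp only [Prog.eval, Prog.cost]; omega
  | pair f g hf hg => simp only [Prog.eval, Prog.cost]; omega
  | ite t f g ht hf hg =>
    have h1 := hf x
    have h2 := hg x
    simp only [Prog.eval, Prog.cost]; split <;> omega
  | cases f g hf hg =>
    obtain ⟨y, l⟩ := x
    cases l with
    | nil => have := hf y; simp only [Prog.eval, Prog.cost]; omega
    | cons z l => have := hg (y, (z, l)); simp only [Prog.eval, Prog.cost]; omega
  | fold f hf => simp only [Prog.cost]; omega
  | _ => simp only [Prog.eval, Prog.cost]; omega

/-- The functions that are computed by a program within polynomial time. -/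
def PolyFn (a b : Ty) (f : a.denote → b.denote) : Prop :=
  ∃ (p : Prog a b) (q : Polynomial ℕ), ∀ x, p.eval x = f x ∧ p.cost x ≤ q.eval (a.size x)

namespace PolyFn

variable {a b c s : Ty}

theorem size_le {f : a.denote → b.denote} (h : PolyFn a b f) :
    ∃ q : Polynomial ℕ, ∀ x, b.size (f x) ≤ q.eval (a.size x) := by
  obtain ⟨p, q, h⟩ := h
  exact ⟨q, fun x => by rw [← (h x).1]; exact (p.size_eval_le_cost x).trans (h x).2⟩

theorem id : PolyFn a a fun x => x :=
  ⟨.id, 1 + .X, fun x => ⟨rfl, by simp [Prog.cost]⟩⟩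

theorem comp {g : b.denote → c.denote} {f : a.denote → b.denote} (hg : PolyFn b c g)
    (hf : PolyFn a b f) : PolyFn a c fun x => g (f x) := by
  obtain ⟨p, q, h⟩ := hf
  obtain ⟨p', q', h'⟩ := hg
  refine ⟨.comp p' p, 1 + q + q'.comp q, fun x => ⟨?_, ?_⟩⟩
  · simp only [Prog.eval, (h x).1, (h' _).1]
  · simp only [Prog.cost, Polynomial.eval_add, Polynomial.eval_comp, Polynomial.eval_one]
    have h1 := (h' (p.eval x)).2
    have h2 := polynomial_eval_mono q' ((p.size_eval_le_cost x).trans (h x).2)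
    have := (h x).2
    omega

theorem pair {f : c.denote → a.denote} {g : c.denote → b.denote} (hf : PolyFn c a f)
    (hg : PolyFn c b g) : PolyFn c (.prod a b) fun x => (f x, g x) := by
  obtain ⟨p, q, h⟩ := hf
  obtain ⟨p', q', h'⟩ := hg
  refine ⟨.pair p p', 2 + 2 * q + 2 * q', fun x => ⟨?_, ?_⟩⟩
  · simp only [Prog.eval, (h x).1, (h' x).1]
  · simp only [Prog.cost, Ty.size, Polynomial.eval_add, Polynomial.eval_mul,
      Polynomial.eval_ofNat]
    have h1 := (p.size_eval_le_cost x).trans (h x).2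
    have h2 := (p'.size_eval_le_cost x).trans (h' x).2
    have h3 := (h x).2
    have h4 := (h' x).2
    omega

theorem fst {f : c.denote → (Ty.prod a b).denote} (hf : PolyFn c (.prod a b) f) :
    PolyFn c a fun x => (f x).1 :=
  comp (g := fun x : (Ty.prod a b).denote => x.1)
    ⟨.fst, 1 + .X, fun x => ⟨rfl, by simp [Prog.cost, Ty.size]; omega⟩⟩ hf

theorem snd {f : c.denote → (Ty.prod a b).denote} (hf : PolyFn c (.prod a b) f) :
    PolyFn c b fun x => (f x).2 :=
  comp (g := fun x : (Ty.prod a b).denote => x.2)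
    ⟨.snd, 1 + .X, fun x => ⟨rfl, by simp [Prog.cost, Ty.size]⟩⟩ hf

theorem true : PolyFn a .bool fun _ => Bool.true :=
  ⟨.tt, 2, fun x => ⟨rfl, by simp [Prog.cost, Ty.size]⟩⟩

theorem false : PolyFn a .bool fun _ => Bool.false :=
  ⟨.ff, 2, fun x => ⟨rfl, by simp [Prog.cost, Ty.size]⟩⟩

theorem const (n : ℕ) : PolyFn a .nat fun _ => n :=
  ⟨.const n, Polynomial.C (2 + Nat.size n), fun x => ⟨rfl, by
    rw [Polynomial.eval_C]; simp only [Prog.cost, Ty.size]; omega⟩⟩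

theorem cond {t : a.denote → Bool} {f g : a.denote → b.denote} (ht : PolyFn a .bool t)
    (hf : PolyFn a b f) (hg : PolyFn a b g) :
    PolyFn a b fun x => if t x = Bool.true then f x else g x := by
  obtain ⟨p, q, h⟩ := hf
  obtain ⟨p', q', h'⟩ := hg
  obtain ⟨p'', q'', h''⟩ := ht
  refine ⟨.ite p'' p p', 1 + q + q' + q'', fun x => ⟨?_, ?_⟩⟩
  · simp only [Prog.eval, (h x).1, (h' x).1, (h'' x).1]
  · simp only [Prog.cost, Polynomial.eval_add, Polynomial.eval_one]
    have h1 := (h x).2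
    have h2 := (h' x).2
    have h3 := (h'' x).2
    split <;> omega

theorem not {t : a.denote → Bool} (ht : PolyFn a .bool t) : PolyFn a .bool fun x => !(t x) := by
  convert cond ht false true using 2 with x
  cases t x <;> rfl

theorem and {t u : a.denote → Bool} (ht : PolyFn a .bool t) (hu : PolyFn a .bool u) :
    PolyFn a .bool fun x => t x && u x := by
  convert cond ht hu false using 2 with x
  cases t x <;> rfl

theorem or {t u : a.denote → Bool} (ht : PolyFn a .bool t) (hu : PolyFn a .bool u) :
    PolyFn a .bool fun x => t x || u x := by
  convert cond ht true hu using 2 with x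
  cases t x <;> rfl

theorem nat_size_add_le (m n : ℕ) : Nat.size (m + n) ≤ Nat.size m + Nat.size n + 1 := by
  rw [Nat.size_le, pow_succ, pow_add]
  have h1 := Nat.lt_size_self m
  have h2 := Nat.lt_size_self n
  nlinarith [Nat.one_le_two_pow (n := m.size), Nat.one_le_two_pow (n := n.size)]

theorem nat_size_mul_le (m n : ℕ) : Nat.size (m * n) ≤ Nat.size m + Nat.size n := by
  rw [Nat.size_le, pow_add]
  have h1 := Nat.lt_size_self m
  have h2 := Nat.lt_size_self n
  exact Nat.mul_lt_mul'' h1 h2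

theorem add {f g : a.denote → ℕ} (hf : PolyFn a .nat f) (hg : PolyFn a .nat g) :
    PolyFn a .nat fun x => f x + g x :=
  comp (g := fun x : (Ty.prod .nat .nat).denote => x.1 + x.2)
    ⟨.add, 2 + .X, fun x => ⟨rfl, by
      have := nat_size_add_le x.1 x.2
      simp [Prog.cost, Ty.size, Prog.eval]; omega⟩⟩ (pair hf hg)

theorem mul {f g : a.denote → ℕ} (hf : PolyFn a .nat f) (hg : PolyFn a .nat g) :
    PolyFn a .nat fun x => f x * g x :=
  comp (g := fun x : (Ty.prod .nat .nat).denote => x.1 * x.2)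
    ⟨.mul, 2 + .X, fun x => ⟨rfl, by
      have := nat_size_mul_le x.1 x.2
      simp [Prog.cost, Ty.size, Prog.eval]; omega⟩⟩ (pair hf hg)

theorem eq {f g : a.denote → ℕ} (hf : PolyFn a .nat f) (hg : PolyFn a .nat g) :
    PolyFn a .bool fun x => decide (f x = g x) :=
  comp (g := fun x : (Ty.prod .nat .nat).denote => decide (x.1 = x.2))
    ⟨.eq, 2, fun x => ⟨rfl, by simp [Prog.cost, Ty.size]⟩⟩ (pair hf hg)

theorem lt {f g : a.denote → ℕ} (hf : PolyFn a .nat f) (hg : PolyFn a .nat g) :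
    PolyFn a .bool fun x => decide (f x < g x) :=
  comp (g := fun x : (Ty.prod .nat .nat).denote => decide (x.1 < x.2))
    ⟨.lt, 2, fun x => ⟨rfl, by simp [Prog.cost, Ty.size]⟩⟩ (pair hf hg)

theorem le {f g : a.denote → ℕ} (hf : PolyFn a .nat f) (hg : PolyFn a .nat g) :
    PolyFn a .bool fun x => decide (f x ≤ g x) := by
  convert (lt hg hf).not using 2 with x
  rw [Bool.eq_iff_iff]
  simp

theorem natSize {f : a.denote → ℕ} (hf : PolyFn a .nat f) :
    PolyFn a .nat fun x => Nat.size (f x) :=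
  comp (g := fun x : Ty.nat.denote => Nat.size x)
    ⟨.bitLength, 2 + .X, fun x => ⟨rfl, by
      have : Nat.size (Nat.size x) ≤ Nat.size x := by
        rw [Nat.size_le]; exact Nat.lt_two_pow_self
      simp [Prog.cost, Ty.size, Prog.eval]; omega⟩⟩ hf

theorem nil : PolyFn a (.list b) fun _ => [] :=
  ⟨.nil, 2, fun x => ⟨rfl, by simp [Prog.cost, Ty.size]⟩⟩

theorem cons {f : a.denote → b.denote} {g : a.denote → List b.denote} (hf : PolyFn a b f)
    (hg : PolyFn a (.list b) g) : PolyFn a (.list b) fun x => f x :: g x :=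
  comp (g := fun x : (Ty.prod b (.list b)).denote => x.1 :: x.2)
    ⟨.cons, 2 + .X, fun x => ⟨rfl, by simp [Prog.cost, Ty.size]; omega⟩⟩ (pair hf hg)

theorem isEmpty {f : a.denote → List b.denote} (hf : PolyFn a (.list b) f) :
    PolyFn a .bool fun x => (f x).isEmpty :=
  comp (g := fun x : (Ty.prod .nat (.list b)).denote => x.2.isEmpty)
    ⟨.cases .tt .ff, 3, fun x => by
      obtain ⟨n, _ | ⟨y, l⟩⟩ := x <;> exact ⟨rfl, by simp [Prog.cost, Ty.size]⟩⟩
    (pair (const 0) hf)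

/-- An accumulator that gains at most `A` per step stays below `B` throughout, so a cost bound `D`
for accumulators of size at most `B` applies to every step. -/
theorem loopCost_le {α σ : Type} (ev : σ → α → σ) (co : σ → α → ℕ) (sz : σ → ℕ) (A B : ℕ)
    (l : List α) : ∀ r : σ, sz r + A * l.length ≤ B →
    (∀ r, ∀ y ∈ l, sz (ev r y) ≤ sz r + A) → ∀ D, (∀ r, ∀ y ∈ l, sz r ≤ B → co r y ≤ D) →
    loopCost ev co r l ≤ D * l.length ∧ sz (l.foldl ev r) ≤ B := by
  induction l with
  | nil => intro r h _ D _; simpa [loopCost] using h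
  | cons y l ih =>
    intro r h hev D hco
    have h1 := hev r y (by simp)
    simp only [List.length_cons, Nat.mul_add, Nat.mul_one] at h ⊢
    obtain ⟨h2, h3⟩ := ih (ev r y) (by omega) (fun r z hz => hev r z (by simp [hz])) D
      (fun r z hz => hco r z (by simp [hz]))
    refine ⟨?_, h3⟩
    have := hco r y (by simp) (by omega)
    simp only [loopCost]; omega

theorem size_mem_le {l : List b.denote} {y : b.denote} (h : y ∈ l) :
    b.size y ≤ (Ty.list b).size l := by
  have : 1 + b.size y ≤ (l.map fun x => 1 + b.size x).sum := by
    induction l with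
    | nil => simp at h
    | cons z l ih =>
      rw [List.map_cons, List.sum_cons]
      rcases List.mem_cons.1 h with rfl | h
      · omega
      · have := ih h; omega
  simp only [Ty.size]; omega

theorem length_le_size (l : List b.denote) : l.length ≤ (Ty.list b).size l := by
  have : l.length • 1 ≤ (l.map fun x => 1 + b.size x).sum := by
    induction l with
    | nil => simp
    | cons z l ih => simp only [List.length_cons, List.map_cons, List.sum_cons, smul_eq_mul] at *; omega
  simp only [Ty.size, smul_eq_mul] at *; omega

/-- The growth bound `q` does not see the accumulator: a body that is merely polynomial in it could
square it in every step and blow up exponentially. -/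
theorem foldl {f : a.denote → s.denote → b.denote → s.denote} {l : a.denote → List b.denote}
    {i : a.denote → s.denote}
    (hf : PolyFn (.prod a (.prod s b)) s fun p => f p.1 p.2.1 p.2.2)
    (hl : PolyFn a (.list b) l) (hi : PolyFn a s i) (q : Polynomial ℕ)
    (hq : ∀ x r y, s.size (f x r y) ≤ s.size r + q.eval (a.size x + b.size y)) :
    PolyFn a s fun x => (l x).foldl (f x) (i x) := by
  refine comp (g := fun x : (Ty.prod a (.prod s (.list b))).denote =>
    x.2.2.foldl (f x.1) x.2.1) ?_ (pair id (pair hi hl))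
  obtain ⟨p, u, h⟩ := hf
  have hev : ∀ x r y, p.eval (x, (r, y)) = f x r y := fun x r y => (h (x, (r, y))).1
  -- For input size `n`: initial accumulator at most `n`, at most `n` steps, growth at most `q n` in
  -- each.
  let B : Polynomial ℕ := .X + q * .X
  refine ⟨.fold p, 1 + B + u.comp (2 + .X + B) * .X, fun x => ?_⟩
  obtain ⟨x, r, l⟩ := x
  have key : (Ty.prod a (.prod s (.list b))).size (x, (r, l)) =
    1 + a.size x + (1 + s.size r + (Ty.list b).size l) := rfl
  set n := (Ty.prod a (.prod s (.list b))).size (x, (r, l)) with hn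
  have hlen : l.length ≤ n := (length_le_size l).trans (by omega)
  have hB : B.eval n = n + q.eval n * n := by simp [B]
  have main := loopCost_le (f x) (fun r y => p.cost (x, (r, y))) s.size (q.eval n) (B.eval n) l r
    (by rw [hB]; exact add_le_add (by omega) (Nat.mul_le_mul_left _ hlen))
    (fun r y hy => (hq x r y).trans (Nat.add_le_add_left (polynomial_eval_mono q (by
      have := size_mem_le hy; omega)) _)) (u.eval (2 + n + B.eval n))
    (fun r' y hy hr => (h (x, (r', y))).2.trans (polynomial_eval_mono u (by
      have h1 := size_mem_le hy
      change 1 + a.size x + (1 + s.size r' + b.size y) ≤ _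
      omega)))
  refine ⟨?_, ?_⟩
  · simp only [Prog.eval, hev]
  · simp only [Prog.cost, Prog.eval, hev]
    have h1 := Nat.mul_le_mul_left (u.eval (2 + n + B.eval n)) hlen
    simp only [Polynomial.eval_add, Polynomial.eval_mul, Polynomial.eval_comp, Polynomial.eval_one,
      Polynomial.eval_X, Polynomial.eval_ofNat]
    have h2 := main.1
    have h3 := main.2
    rw [show (fun r y => f x r y) = f x from rfl]
    omega

theorem reverse {l : a.denote → List b.denote} (hl : PolyFn a (.list b) l) :
    PolyFn a (.list b) fun x => (l x).reverse := by
  have := foldl (s := .list b) (f := fun _ r y => y :: r) (i := fun _ => [])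
    (cons (snd (snd id)) (fst (snd id))) hl nil (.X + 1) (fun x (r : List b.denote) y => by
      simp [Ty.size]; omega)
  convert this using 2 with x
  have : ∀ (l : List b.denote) r, l.foldl (fun r y => y :: r) r = l.reverse ++ r := by
    intro l; induction l <;> simp_all
  simp [this]

theorem map {f : a.denote → b.denote → c.denote} {l : a.denote → List b.denote}
    (hl : PolyFn a (.list b) l) (hf : PolyFn (.prod a b) c fun p => f p.1 p.2) :
    PolyFn a (.list c) fun x => (l x).map (f x) := by
  obtain ⟨q, hq⟩ := hf.size_le
  have hf' : PolyFn (.prod a (.prod (.list c) b)) c (fun p => f p.1 p.2.2) :=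
    comp (g := fun p : (Ty.prod a b).denote => f p.1 p.2) hf (pair (fst id) (snd (snd id)))
  have := (foldl (f := fun x r y => f x y :: r) (i := fun _ => [])
    (cons hf' (fst (snd id))) hl nil (q.comp (1 + .X) + 1) (fun x r y => by
      have := hq (x, y)
      have h2 := polynomial_eval_mono q (show (Ty.prod a b).size (x, y) ≤ 1 + (a.size x + b.size y) by
        simp only [Ty.size]; omega)
      simp only [Ty.size, List.map_cons, List.sum_cons, Polynomial.eval_add, Polynomial.eval_comp,
        Polynomial.eval_one, Polynomial.eval_X] at this h2 ⊢
      omega)).reverse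
  convert this using 2 with x
  have : ∀ (l : List b.denote) r, l.foldl (fun r y => f x y :: r) r = (l.map (f x)).reverse ++ r := by
    intro l; induction l <;> simp_all
  simp [this]

theorem filter {f : a.denote → b.denote → Bool} {l : a.denote → List b.denote}
    (hl : PolyFn a (.list b) l) (hf : PolyFn (.prod a b) .bool fun p => f p.1 p.2) :
    PolyFn a (.list b) fun x => (l x).filter (f x) := by
  have hf' : PolyFn (.prod a (.prod (.list b) b)) .bool (fun p => f p.1 p.2.2) :=
    comp (g := fun p : (Ty.prod a b).denote => f p.1 p.2) (c := .bool) hf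
      (pair (fst id) (snd (snd id)))
  have := (foldl (f := fun x r y => if f x y = Bool.true then y :: r else r) (i := fun _ => [])
    (cond hf' (cons (snd (snd id)) (fst (snd id))) (fst (snd id))) hl nil (1 + .X)
    (fun x r y => by split <;> simp [Ty.size]; omega)).reverse
  convert this using 2 with x
  have : ∀ (l : List b.denote) r, l.foldl (fun r y => if f x y = Bool.true then y :: r else r) r =
      (l.filter (f x)).reverse ++ r := by
    intro l; induction l with
    | nil => simp
    | cons y l ih => intro r; by_cases h : f x y = Bool.true <;> simp [ih, h]
  simp [this]

theorem any {f : a.denote → b.denote → Bool} {l : a.denote → List b.denote}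
    (hl : PolyFn a (.list b) l) (hf : PolyFn (.prod a b) .bool fun p => f p.1 p.2) :
    PolyFn a .bool fun x => (l x).any (f x) := by
  convert (filter hl hf).isEmpty.not using 2 with x
  rw [Bool.eq_iff_iff]
  simp

theorem sum {l : a.denote → List ℕ} (hl : PolyFn a (.list .nat) l) :
    PolyFn a .nat fun x => (l x).sum := by
  have := foldl (s := .nat) (b := .nat) (f := fun _ r y => r + y) (i := fun _ => 0)
    (add (a := .prod a (.prod .nat .nat)) (f := fun p => p.2.1) (g := fun p => p.2.2)
      (fst (snd id)) (snd (snd id))) hl (const 0) (1 + .X) (fun x r y => by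
      have := nat_size_add_le r y
      simp [Ty.size]; omega)
  convert this using 2 with x
  rw [List.sum_eq_foldl]

theorem length {l : a.denote → List b.denote} (hl : PolyFn a (.list b) l) :
    PolyFn a .nat fun x => (l x).length := by
  convert (map (f := fun _ _ => (1 : ℕ)) hl (const 1)).sum using 2 with x
  simp

theorem mem {f : a.denote → ℕ} {l : a.denote → List ℕ} (hf : PolyFn a .nat f)
    (hl : PolyFn a (.list .nat) l) : PolyFn a .bool fun x => decide (f x ∈ l x) := by
  convert any (f := fun x y => decide (f x = y)) hl
    (eq (a := .prod a .nat) (f := fun p => f p.1) (g := fun p => p.2)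
      (comp (g := f) hf (fst id)) (snd id)) using 2 with x
  rw [Bool.eq_iff_iff]
  simp

/-- The list only serves as a counter, since loops over lists are the only loops of the language. -/
theorem iterate {f : a.denote → s.denote → s.denote} {l : a.denote → List b.denote}
    {i : a.denote → s.denote} (hf : PolyFn (.prod a s) s fun p => f p.1 p.2)
    (hl : PolyFn a (.list b) l) (hi : PolyFn a s i) (q : Polynomial ℕ)
    (hq : ∀ x r, s.size (f x r) ≤ s.size r + q.eval (a.size x)) :
    PolyFn a s fun x => (f x)^[(l x).length] (i x) := by
  have hf' : PolyFn (.prod a (.prod s b)) s (fun p => f p.1 p.2.1) :=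
    comp (g := fun p : (Ty.prod a s).denote => f p.1 p.2) hf (pair (fst id) (fst (snd id)))
  have := foldl (f := fun x r _ => f x r) hf' hl hi q
    (fun x r y => (hq x r).trans (Nat.add_le_add_left (polynomial_eval_mono q (by omega)) _))
  convert this using 2 with x
  have : ∀ (l : List b.denote) r, (f x)^[l.length] r = l.foldl (fun r _ => f x r) r := by
    intro l; induction l <;> simp_all
  simp [this]

end PolyFn

namespace PolyFn

variable {a b c s : Ty}

theorem wk {f : a.denote → b.denote} (hf : PolyFn a b f) :
    PolyFn (.prod a c) b fun p => f p.1 :=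
  comp (g := f) hf (fst id)

theorem arg : PolyFn (.prod a b) b fun p => p.2 := snd id

theorem size_filter_le (l : List b.denote) (f : b.denote → Bool) :
    (Ty.list b).size (l.filter f) ≤ (Ty.list b).size l := by
  have := ((l.filter_sublist (p := f)).map fun x => 1 + b.size x).sum_le_sum (by simp)
  simp only [Ty.size]; omega

end PolyFn

/-! ### Computing the densest core by peeling -/

/-- One round of peeling: keep the entries `p` of an adjacency list with at least `t` entries that
`p` is joined to. -/
def peel (t : ℕ) (l : List (ℕ × List ℕ)) : List (ℕ × List ℕ) :=
  l.filter fun p => decide (t ≤ (l.filter fun q => decide (q.1 ∈ p.2)).length)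

/-- The `t`-core of an adjacency list. -/
def coreList (t : ℕ) (l : List (ℕ × List ℕ)) : List (ℕ × List ℕ) := (peel t)^[l.length] l

/-- A step of the search for the largest power of `2` with a nonempty core: the state consists of
the best power so far (`0` if there is none) with its core. -/
def bestStep (l : List (ℕ × List ℕ)) (s : ℕ × List (ℕ × List ℕ)) : ℕ × List (ℕ × List ℕ) :=
  if (coreList (max 1 (2 * s.1)) l).isEmpty = true then s
  else (max 1 (2 * s.1), coreList (max 1 (2 * s.1)) l)

/-- The largest power of `2` with a nonempty core, and this core; `(0, [])` if there is none. -/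
def bestCore (l : List (ℕ × List ℕ)) : ℕ × List (ℕ × List ℕ) := (bestStep l)^[l.length] (0, [])

abbrev AdjTy : Ty := .list (.prod .nat (.list .nat))

namespace PolyFn

variable {a : Ty}

theorem size_coreList_le (t : ℕ) (l : AdjTy.denote) : AdjTy.size (coreList t l) ≤ AdjTy.size l := by
  have : ∀ n, AdjTy.size ((peel t)^[n] l) ≤ AdjTy.size l := by
    intro n
    induction n with
    | zero => exact le_rfl
    | succ n ih =>
      rw [Function.iterate_succ_apply']
      exact (size_filter_le (b := .prod .nat (.list .nat)) _ _).trans ih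
  exact this _

theorem peel {t : a.denote → ℕ} {l : a.denote → List (ℕ × List ℕ)} (ht : PolyFn a .nat t)
    (hl : PolyFn a AdjTy l) : PolyFn a AdjTy fun x => peel (t x) (l x) := by
  refine filter (b := .prod .nat (.list .nat)) (f := fun x p => decide (t x ≤ ((l x).filter fun q => decide (q.1 ∈ p.2)).length))
    hl (le ht.wk (length (b := .prod .nat (.list .nat)) ?_))
  exact filter (a := .prod a (.prod .nat (.list .nat))) (b := .prod .nat (.list .nat))
    (f := fun x (q : ℕ × List ℕ) => decide (q.1 ∈ x.2.2)) hl.wk (mem arg.fst arg.wk.snd)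

theorem coreList {t : a.denote → ℕ} {l : a.denote → List (ℕ × List ℕ)} (ht : PolyFn a .nat t)
    (hl : PolyFn a AdjTy l) : PolyFn a AdjTy fun x => coreList (t x) (l x) :=
  iterate (s := AdjTy) (b := .prod .nat (.list .nat)) (f := fun x r => _root_.peel (t x) r)
    (peel ht.wk arg) hl hl 0 fun x r => by
      rw [Polynomial.eval_zero]
      exact size_filter_le (b := .prod .nat (.list .nat)) _ _

theorem bestCore {l : a.denote → List (ℕ × List ℕ)} (hl : PolyFn a AdjTy l) :
    PolyFn a (.prod .nat AdjTy) fun x => bestCore (l x) := by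
  obtain ⟨q, hq⟩ := hl.size_le
  -- A step lengthens the level by at most two bits and stores at most a sublist of `l x`, so the
  -- growth is bounded in terms of `x` alone.
  refine iterate (s := .prod .nat AdjTy) (b := .prod .nat (.list .nat))
    (f := fun x r => bestStep (l x) r) (i := fun _ => (0, [])) ?_ hl (pair (const 0) nil) (4 + q) ?_
  · have h2 : PolyFn (.prod a (.prod .nat AdjTy)) .nat fun x => max 1 (2 * x.2.1) := by
      have h := mul (const 2) (arg (a := a) (b := .prod .nat AdjTy)).fst
      convert cond (le (const 1) h) h (const 1) using 2 with x
      rw [max_def]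
      simp
    have h := coreList h2 hl.wk
    exact cond (isEmpty (b := .prod .nat (.list .nat)) h) arg (pair h2 h)
  · intro x r
    have h1 := size_coreList_le (max 1 (2 * r.1)) (l x)
    have h2 := hq x
    have h3 : Nat.size (max 1 (2 * r.1)) ≤ Nat.size r.1 + 2 := by
      have := nat_size_mul_le 2 r.1
      have h : Nat.size 2 = 2 := by decide
      have h : Nat.size 1 = 1 := by decide
      rcases max_choice 1 (2 * r.1) with h | h <;> rw [h] <;> omega
    simp only [Polynomial.eval_add, Polynomial.eval_ofNat]
    unfold bestStep
    split
    · omega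
    · have h4 : ∀ y : (Ty.prod .nat AdjTy).denote, (Ty.prod .nat AdjTy).size y =
          2 + Nat.size y.1 + AdjTy.size y.2 := fun y => by
        rw [Ty.size, Ty.size]; omega
      rw [h4, h4]
      dsimp only
      omega

end PolyFn

/-! ### States and the four rounds of an iteration -/

/-- The type of the states: identifier, number of coins and neighbours; phase, halting flag,
uncovered incident edges and output; and the data of the current iteration: random rank, level,
star, number of its uncovered darts, and votes. -/
abbrev StTy : Ty :=
  .prod (.prod .nat (.prod .nat (.list .nat)))
    (.prod .nat (.prod .bool (.prod (.list .nat) (.prod (.list .nat)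
      (.prod .nat (.prod .nat (.prod (.list .nat) (.prod .nat (.list (.prod .nat .nat))))))))))

abbrev St : Type := StTy.denote
-- An inbox entry: the identifier of the sender with its message, which is its entire state.
abbrev MsgTy : Ty := .prod .nat StTy

def mkSt (stat : ℕ × (ℕ × List ℕ)) (phase : ℕ) (fin : Bool) (unc out : List ℕ) (rank lev : ℕ)
    (star : List ℕ) (deg : ℕ) (votes : List (ℕ × ℕ)) : St :=
  (stat, (phase, (fin, (unc, (out, (rank, (lev, (star, (deg, votes)))))))))

def stStat (s : St) : ℕ × (ℕ × List ℕ) := s.1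
def stMe (s : St) : ℕ := s.1.1
def stCoins (s : St) : ℕ := s.1.2.1
def stNbr (s : St) : List ℕ := s.1.2.2
def stPhase (s : St) : ℕ := s.2.1
def stFin (s : St) : Bool := s.2.2.1
def stUnc (s : St) : List ℕ := s.2.2.2.1
def stOut (s : St) : List ℕ := s.2.2.2.2.1
def stRank (s : St) : ℕ := s.2.2.2.2.2.1
def stLev (s : St) : ℕ := s.2.2.2.2.2.2.1
def stStar (s : St) : List ℕ := s.2.2.2.2.2.2.2.1
def stDeg (s : St) : ℕ := s.2.2.2.2.2.2.2.2.1
def stVotes (s : St) : List (ℕ × ℕ) := s.2.2.2.2.2.2.2.2.2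

/-- The number of pairs of an entry and another entry that it is joined to. -/
def dartCount (l : List (ℕ × List ℕ)) : ℕ :=
  (l.map fun p => (l.filter fun q => decide (q.1 ∈ p.2)).length).sum

/-- The uncovered graph between the senders. -/
def adjOf (I : List (ℕ × St)) : List (ℕ × List ℕ) := I.map fun m => (m.1, stUnc m.2)

/-- The edge from `me` to `b` prefers the star of `m'` to that of `m`. -/
def beats (me b : ℕ) (m' m : ℕ × St) : Bool :=
  decide (b ∈ stNbr m'.2) && (decide (stLev m.2 < stLev m'.2) ||
    (decide (stLev m'.2 = stLev m.2) && (decide (me ∈ stStar m'.2) && (decide (b ∈ stStar m'.2) &&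
      (decide (stRank m'.2 < stRank m.2) ||
        (decide (stRank m'.2 = stRank m.2) && decide (m'.1 < m.1)))))))

/-- The edge from `me` to `b` votes for the star of `m`. -/
def votesFor (me b : ℕ) (I : List (ℕ × St)) (m : ℕ × St) : Bool :=
  decide (b ∈ stNbr m.2) && (decide (me ∈ stStar m.2) && (decide (b ∈ stStar m.2) &&
    !(I.any fun m' => beats me b m' m)))

/-- Every neighbour reports how many of its own uncovered edges vote for `me`, so an edge is counted
once from each endpoint. This matches `stDeg`, which counts darts. -/
def voteCount (me : ℕ) (I : List (ℕ × St)) : ℕ :=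
  (I.map fun m => (((stVotes m.2).filter fun p => decide (p.1 = me)).map fun p => p.2).sum).sum

/-- Looking only at senders is enough: a common neighbour of the endpoints of an uncovered edge has
not halted. -/
def inTriangle (b : ℕ) (I : List (ℕ × St)) : Bool := I.any fun m => decide (b ∈ stNbr m.2)

/-- Used after `acceptStep`, which has emptied the rejected stars. -/
def isCovered (me b : ℕ) (I : List (ℕ × St)) : Bool :=
  I.any fun m => decide (me ∈ stStar m.2) && decide (b ∈ stStar m.2)

/-- First round of an iteration: find a dense star. -/
def starStep (s : St) (rank : ℕ) (I : List (ℕ × St)) : St :=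
  mkSt (stStat s) 1 ((stUnc s).isEmpty && decide ((bestCore (adjOf I)).1 = 0)) (stUnc s) (stOut s)
    rank (bestCore (adjOf I)).1 ((bestCore (adjOf I)).2.map fun p => p.1)
    (dartCount (bestCore (adjOf I)).2) []

/-- Second round of an iteration: the uncovered edges vote for stars. -/
def voteStep (s : St) (I : List (ℕ × St)) : St :=
  mkSt (stStat s) 2 (stFin s) (stUnc s) (stOut s) (stRank s) (stLev s) (stStar s) (stDeg s)
    (I.map fun m => (m.1, ((stUnc s).filter fun b => votesFor (stMe s) b I m).length))

/-- Third round of an iteration: stars with many votes are added to the spanner. -/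
def acceptStep (s : St) (I : List (ℕ × St)) : St :=
  if decide (stDeg s ≤ 8 * voteCount (stMe s) I) = true then
    mkSt (stStat s) 3 (stFin s) (stUnc s)
      ((stNbr s).filter fun b => decide (b ∈ stOut s) || decide (b ∈ stStar s))
      (stRank s) (stLev s) (stStar s) (stDeg s) (stVotes s)
  else mkSt (stStat s) 3 (stFin s) (stUnc s) (stOut s) (stRank s) (stLev s) [] (stDeg s) (stVotes s)

/-- Fourth round of an iteration: find out which edges are covered. Edges that are in no triangle
are added to the spanner. -/
def coverStep (s : St) (I : List (ℕ × St)) : St :=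
  mkSt (stStat s) 0 (stFin s)
    ((stUnc s).filter fun b => inTriangle b I && !(isCovered (stMe s) b I))
    ((stNbr s).filter fun b =>
      decide (b ∈ stOut s) || (decide (b ∈ stUnc s) && !(inTriangle b I))) 0 0 [] 0 []

def updateSt (s : St) (rank : ℕ) (I : List (ℕ × St)) : St :=
  if decide (stPhase s = 0) = true then starStep s rank I
  else if decide (stPhase s = 1) = true then voteStep s I
  else if decide (stPhase s = 2) = true then acceptStep s I
  else coverStep s I

/-- With `Nat.size N + 3` coins the ranks are uniform on more than `8 * N` values, so ties cost only
a constant factor in the analysis. -/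
def initSt (me N : ℕ) (nbr : List ℕ) : St :=
  mkSt (me, (Nat.size N + 3, nbr)) 0 false nbr [] 0 0 [] 0 []

/-! ### The rounds are computable in polynomial time -/

namespace PolyFn

variable {a : Ty} {s m m' : a.denote → St} {n me b : a.denote → ℕ} {I : a.denote → List (ℕ × St)}

theorem stStat (h : PolyFn a StTy s) :
    PolyFn a (.prod .nat (.prod .nat (.list .nat))) fun x => stStat (s x) := h.fst
theorem stMe (h : PolyFn a StTy s) : PolyFn a .nat fun x => stMe (s x) := h.fst.fst
theorem stCoins (h : PolyFn a StTy s) : PolyFn a .nat fun x => stCoins (s x) := h.fst.snd.fst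
theorem stNbr (h : PolyFn a StTy s) : PolyFn a (.list .nat) fun x => stNbr (s x) := h.fst.snd.snd
theorem stPhase (h : PolyFn a StTy s) : PolyFn a .nat fun x => stPhase (s x) := h.snd.fst
theorem stFin (h : PolyFn a StTy s) : PolyFn a .bool fun x => stFin (s x) := h.snd.snd.fst
theorem stUnc (h : PolyFn a StTy s) : PolyFn a (.list .nat) fun x => stUnc (s x) :=
  h.snd.snd.snd.fst
theorem stOut (h : PolyFn a StTy s) : PolyFn a (.list .nat) fun x => stOut (s x) :=
  h.snd.snd.snd.snd.fst
theorem stRank (h : PolyFn a StTy s) : PolyFn a .nat fun x => stRank (s x) :=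
  h.snd.snd.snd.snd.snd.fst
theorem stLev (h : PolyFn a StTy s) : PolyFn a .nat fun x => stLev (s x) :=
  h.snd.snd.snd.snd.snd.snd.fst
theorem stStar (h : PolyFn a StTy s) : PolyFn a (.list .nat) fun x => stStar (s x) :=
  h.snd.snd.snd.snd.snd.snd.snd.fst
theorem stDeg (h : PolyFn a StTy s) : PolyFn a .nat fun x => stDeg (s x) :=
  h.snd.snd.snd.snd.snd.snd.snd.snd.fst
theorem stVotes (h : PolyFn a StTy s) :
    PolyFn a (.list (.prod .nat .nat)) fun x => stVotes (s x) :=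
  h.snd.snd.snd.snd.snd.snd.snd.snd.snd

theorem mkSt {stat : a.denote → ℕ × (ℕ × List ℕ)} {phase rank lev deg : a.denote → ℕ}
    {fin : a.denote → Bool} {unc out star : a.denote → List ℕ}
    {votes : a.denote → List (ℕ × ℕ)}
    (h1 : PolyFn a (.prod .nat (.prod .nat (.list .nat))) stat) (h2 : PolyFn a .nat phase)
    (h3 : PolyFn a .bool fin) (h4 : PolyFn a (.list .nat) unc) (h5 : PolyFn a (.list .nat) out)
    (h6 : PolyFn a .nat rank) (h7 : PolyFn a .nat lev) (h8 : PolyFn a (.list .nat) star)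
    (h9 : PolyFn a .nat deg) (h10 : PolyFn a (.list (.prod .nat .nat)) votes) :
    PolyFn a StTy fun x => mkSt (stat x) (phase x) (fin x) (unc x) (out x) (rank x) (lev x)
      (star x) (deg x) (votes x) :=
  pair h1 (pair h2 (pair h3 (pair h4 (pair h5 (pair h6 (pair h7 (pair h8 (pair h9 h10))))))))

theorem dartCount {l : a.denote → List (ℕ × List ℕ)} (hl : PolyFn a AdjTy l) :
    PolyFn a .nat fun x => dartCount (l x) := by
  refine sum (map (b := .prod .nat (.list .nat)) (c := .nat) (f := fun x (p : ℕ × List ℕ) =>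
    ((l x).filter fun q => decide (q.1 ∈ p.2)).length) hl
    (length (b := .prod .nat (.list .nat)) ?_))
  exact filter (a := .prod a (.prod .nat (.list .nat))) (b := .prod .nat (.list .nat))
    (f := fun x (q : ℕ × List ℕ) => decide (q.1 ∈ x.2.2)) hl.wk (mem arg.fst arg.wk.snd)

theorem adjOf (hI : PolyFn a (.list MsgTy) I) : PolyFn a AdjTy fun x => adjOf (I x) :=
  map (b := MsgTy) (c := .prod .nat (.list .nat)) (f := fun _ (m : ℕ × St) => (m.1, _root_.stUnc m.2)) hI (pair arg.fst (stUnc arg.snd))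

theorem beats {m m' : a.denote → ℕ × St} (hme : PolyFn a .nat me) (hb : PolyFn a .nat b)
    (hm' : PolyFn a MsgTy m') (hm : PolyFn a MsgTy m) :
    PolyFn a .bool fun x => beats (me x) (b x) (m' x) (m x) :=
  have h := hm.snd
  have h' := hm'.snd
  and (mem hb h'.stNbr) (or (lt h.stLev h'.stLev) (and (eq h'.stLev h.stLev)
    (and (mem hme h'.stStar) (and (mem hb h'.stStar) (or (lt h'.stRank h.stRank)
      (and (eq h'.stRank h.stRank) (lt hm'.fst hm.fst)))))))

theorem votesFor {m : a.denote → ℕ × St} (hme : PolyFn a .nat me) (hb : PolyFn a .nat b)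
    (hI : PolyFn a (.list MsgTy) I) (hm : PolyFn a MsgTy m) :
    PolyFn a .bool fun x => votesFor (me x) (b x) (I x) (m x) :=
  have h := hm.snd
  and (mem hb h.stNbr) (and (mem hme h.stStar) (and (mem hb h.stStar)
    (not (any (b := MsgTy) (f := fun x m' => _root_.beats (me x) (b x) m' (m x)) hI
      (beats hme.wk hb.wk arg hm.wk)))))

theorem voteCount (hme : PolyFn a .nat me) (hI : PolyFn a (.list MsgTy) I) :
    PolyFn a .nat fun x => voteCount (me x) (I x) := by
  refine sum (map (b := MsgTy) (c := .nat) (f := fun x (m : ℕ × St) =>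
    (((_root_.stVotes m.2).filter fun p => decide (p.1 = me x)).map fun p => p.2).sum) hI
    (sum (map (b := .prod .nat .nat) (c := .nat) (f := fun _ p => p.2) ?_ arg.snd)))
  exact filter (a := .prod a MsgTy) (b := .prod .nat .nat)
    (f := fun x p => decide (p.1 = me x.1)) (stVotes arg.snd) (eq arg.fst hme.wk.wk)

theorem inTriangle (hb : PolyFn a .nat b) (hI : PolyFn a (.list MsgTy) I) :
    PolyFn a .bool fun x => inTriangle (b x) (I x) :=
  any (b := MsgTy) (f := fun x (m : ℕ × St) => decide (b x ∈ _root_.stNbr m.2)) hI (mem hb.wk (stNbr arg.snd))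

theorem isCovered (hme : PolyFn a .nat me) (hb : PolyFn a .nat b)
    (hI : PolyFn a (.list MsgTy) I) : PolyFn a .bool fun x => isCovered (me x) (b x) (I x) :=
  any (b := MsgTy) (f := fun x (m : ℕ × St) => decide (me x ∈ _root_.stStar m.2) &&
    decide (b x ∈ _root_.stStar m.2)) hI
    (and (mem hme.wk (stStar arg.snd)) (mem hb.wk (stStar arg.snd)))

theorem starStep (hs : PolyFn a StTy s) (hn : PolyFn a .nat n) (hI : PolyFn a (.list MsgTy) I) :
    PolyFn a StTy fun x => starStep (s x) (n x) (I x) :=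
  have h := hI.adjOf.bestCore
  mkSt hs.stStat (const 1) (and (isEmpty (b := .nat) hs.stUnc) (eq h.fst (const 0))) hs.stUnc
    hs.stOut hn h.fst (map (b := .prod .nat (.list .nat)) (f := fun _ p => p.1) h.snd arg.fst)
    h.snd.dartCount nil

theorem voteStep (hs : PolyFn a StTy s) (hI : PolyFn a (.list MsgTy) I) :
    PolyFn a StTy fun x => voteStep (s x) (I x) := by
  refine mkSt hs.stStat (const 2) hs.stFin hs.stUnc hs.stOut hs.stRank hs.stLev hs.stStar hs.stDeg
    (map (b := MsgTy) (c := .prod .nat .nat) (f := fun x (m : ℕ × St) => (m.1,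
      ((_root_.stUnc (s x)).filter fun b => _root_.votesFor (_root_.stMe (s x)) b (I x) m).length))
      hI (pair arg.fst (length (b := .nat) ?_)))
  exact filter (a := .prod a MsgTy) (b := .nat)
    (f := fun x b => _root_.votesFor (_root_.stMe (s x.1)) b (I x.1) x.2) hs.wk.stUnc
    (votesFor hs.wk.wk.stMe arg hI.wk.wk arg.wk)

theorem acceptStep (hs : PolyFn a StTy s) (hI : PolyFn a (.list MsgTy) I) :
    PolyFn a StTy fun x => acceptStep (s x) (I x) :=
  cond (le hs.stDeg (mul (const 8) (voteCount hs.stMe hI)))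
    (mkSt hs.stStat (const 3) hs.stFin hs.stUnc
      (filter (b := .nat) (f := fun x b => decide (b ∈ _root_.stOut (s x)) ||
        decide (b ∈ _root_.stStar (s x))) hs.stNbr
        (or (mem arg hs.wk.stOut) (mem arg hs.wk.stStar)))
      hs.stRank hs.stLev hs.stStar hs.stDeg hs.stVotes)
    (mkSt hs.stStat (const 3) hs.stFin hs.stUnc hs.stOut hs.stRank hs.stLev nil hs.stDeg hs.stVotes)

theorem coverStep (hs : PolyFn a StTy s) (hI : PolyFn a (.list MsgTy) I) :
    PolyFn a StTy fun x => coverStep (s x) (I x) :=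
  mkSt hs.stStat (const 0) hs.stFin
    (filter (b := .nat) (f := fun x b => _root_.inTriangle b (I x) &&
      !(_root_.isCovered (_root_.stMe (s x)) b (I x))) hs.stUnc
      (and (inTriangle arg hI.wk) (not (isCovered hs.wk.stMe arg hI.wk))))
    (filter (b := .nat) (f := fun x b => decide (b ∈ _root_.stOut (s x)) ||
      (decide (b ∈ _root_.stUnc (s x)) && !(_root_.inTriangle b (I x)))) hs.stNbr
      (or (mem arg hs.wk.stOut) (and (mem arg hs.wk.stUnc) (not (inTriangle arg hI.wk)))))
    (const 0) (const 0) nil (const 0) nil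

theorem updateSt : PolyFn (.prod StTy (.prod .nat (.list MsgTy))) StTy
    fun x => updateSt x.1 x.2.1 x.2.2 :=
  have hs : PolyFn (.prod StTy (.prod .nat (.list MsgTy))) StTy fun x => x.1 := fst id
  have hI : PolyFn (.prod StTy (.prod .nat (.list MsgTy))) (.list MsgTy) fun x => x.2.2 :=
    snd (snd id)
  cond (eq hs.stPhase (const 0)) (starStep hs (fst (snd id)) hI)
    (cond (eq hs.stPhase (const 1)) (voteStep hs hI)
      (cond (eq hs.stPhase (const 2)) (acceptStep hs hI) (coverStep hs hI)))

theorem initSt : PolyFn (.prod .nat (.prod .nat (.list .nat))) StTy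
    fun x => initSt x.1 x.2.1 x.2.2 :=
  have h1 : PolyFn (.prod .nat (.prod .nat (.list .nat))) .nat fun x => x.1 := fst id
  have h2 : PolyFn (.prod .nat (.prod .nat (.list .nat))) .nat fun x => x.2.1 := fst (snd id)
  have h3 : PolyFn (.prod .nat (.prod .nat (.list .nat))) (.list .nat) fun x => x.2.2 :=
    snd (snd id)
  mkSt (pair h1 (pair (add h2.natSize (const 3)) h3)) (const 0) false h3 nil (const 0) (const 0) nil
    (const 0) nil

end PolyFn

/-! ### Cores and the density of stars -/

open scoped Classical in
/-- The ordered pairs of vertices of `S` that are joined in `U`. -/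
noncomputable def dartsIn {V : Type*} (U : SimpleGraph V) (S : Finset V) : Finset (V × V) :=
  (S ×ˢ S).filter fun d => U.Adj d.1 d.2

open scoped Classical in
/-- The `t`-core of the graph that `U` induces on the `G`-neighbours of `v`. -/
noncomputable def starCore {V : Type*} [Fintype V] (G U : SimpleGraph V) (v : V) (t : ℕ) :
    Finset V :=
  Finset.univ.filter fun a => ∃ S : Finset V, a ∈ S ∧ (∀ b ∈ S, G.Adj v b) ∧
    ∀ b ∈ S, t ≤ (S.filter fun c => U.Adj b c).card

section Core

open scoped Classical

variable {V : Type*} {G U U' : SimpleGraph V} {v : V} {t t' : ℕ} {S T : Finset V}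

theorem mem_dartsIn {d : V × V} : d ∈ dartsIn U S ↔ d.1 ∈ S ∧ d.2 ∈ S ∧ U.Adj d.1 d.2 := by
  simp [dartsIn, and_assoc]

theorem dartsIn_mono (h : S ⊆ T) : dartsIn U S ⊆ dartsIn U T := fun d hd => by
  rw [mem_dartsIn] at *; exact ⟨h hd.1, h hd.2.1, hd.2.2⟩

theorem card_dartsIn : (dartsIn U S).card = ∑ a ∈ S, (S.filter fun b => U.Adj a b).card := by
  rw [dartsIn, Finset.card_filter, Finset.sum_product]
  simp only [Finset.card_filter]

theorem card_dartsIn_le_erase {a : V} (ha : a ∈ S) : (dartsIn U S).card ≤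
    (dartsIn U (S.erase a)).card + 2 * (S.filter fun b => U.Adj a b).card := by
  have : dartsIn U S ⊆ dartsIn U (S.erase a) ∪ ((S.filter fun b => U.Adj a b).image (fun b => (a, b))
      ∪ (S.filter fun b => U.Adj a b).image fun b => (b, a)) := by
    rintro ⟨x, y⟩ hd
    simp only [mem_dartsIn, Finset.mem_union, Finset.mem_erase, Finset.mem_image,
      Finset.mem_filter, Prod.mk.injEq] at *
    obtain ⟨hx, hy, hxy⟩ := hd
    by_cases h1 : x = a
    · subst h1; exact .inr (.inl ⟨y, ⟨hy, hxy⟩, rfl, rfl⟩)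
    by_cases h2 : y = a
    · subst h2; exact .inr (.inr ⟨x, ⟨hx, hxy.symm⟩, rfl, rfl⟩)
    exact .inl ⟨⟨h1, hx⟩, ⟨h2, hy⟩, hxy⟩
  refine (Finset.card_le_card this).trans ((Finset.card_union_le _ _).trans ?_)
  have h1 := Finset.card_union_le ((S.filter fun b => U.Adj a b).image (fun b => (a, b)))
    ((S.filter fun b => U.Adj a b).image fun b => (b, a))
  have h2 := Finset.card_image_le (s := S.filter fun b => U.Adj a b) (f := fun b => (a, b))
  have h3 := Finset.card_image_le (s := S.filter fun b => U.Adj a b) (f := fun b => (b, a))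
  omega

variable [Fintype V]

theorem mem_starCore {a : V} : a ∈ starCore G U v t ↔ ∃ S : Finset V, a ∈ S ∧
    (∀ b ∈ S, G.Adj v b) ∧ ∀ b ∈ S, t ≤ (S.filter fun c => U.Adj b c).card := by
  simp [starCore]

theorem subset_starCore (h1 : ∀ b ∈ S, G.Adj v b)
    (h2 : ∀ b ∈ S, t ≤ (S.filter fun c => U.Adj b c).card) : S ⊆ starCore G U v t :=
  fun _ ha => mem_starCore.2 ⟨S, ha, h1, h2⟩

theorem adj_of_mem_starCore {a : V} (h : a ∈ starCore G U v t) : G.Adj v a := by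
  obtain ⟨S, ha, h1, -⟩ := mem_starCore.1 h
  exact h1 a ha

/-- A union of sets of minimum degree `t` again has minimum degree `t`; so the core, defined as the
union of all of them, is the largest one. -/
theorem le_degree_starCore {a : V} (h : a ∈ starCore G U v t) :
    t ≤ ((starCore G U v t).filter fun b => U.Adj a b).card := by
  obtain ⟨S, ha, h1, h2⟩ := mem_starCore.1 h
  exact (h2 a ha).trans (Finset.card_le_card (Finset.filter_subset_filter _ (subset_starCore h1 h2)))

theorem starCore_mono (h : U' ≤ U) : starCore G U' v t ⊆ starCore G U v t :=
  subset_starCore (fun _ => adj_of_mem_starCore) fun _ hb => (le_degree_starCore hb).trans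
    (Finset.card_le_card (Finset.monotone_filter_right _ fun _ _ h' => h h'))

theorem starCore_anti (h : t ≤ t') : starCore G U v t' ⊆ starCore G U v t :=
  subset_starCore (fun _ => adj_of_mem_starCore) fun _ hb => h.trans (le_degree_starCore hb)

theorem mul_card_starCore_le :
    t * (starCore G U v t).card ≤ (dartsIn U (starCore G U v t)).card := by
  rw [card_dartsIn, mul_comm, ← smul_eq_mul]
  exact Finset.card_nsmul_le_sum _ _ _ fun _ => le_degree_starCore

theorem mem_starCore_one {a b : V} (ha : G.Adj v a) (hb : G.Adj v b) (h : U.Adj a b) :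
    a ∈ starCore G U v 1 := by
  refine mem_starCore.2 ⟨{a, b}, by simp, by simp [ha, hb], ?_⟩
  intro c hc
  rw [Nat.one_le_iff_ne_zero, ← Nat.pos_iff_ne_zero, Finset.card_pos]
  rcases (by simpa using hc : c = a ∨ c = b) with rfl | rfl
  · exact ⟨b, by simp [h]⟩
  · exact ⟨a, by simp [h.symm]⟩

/-- A core vertex has `t` partners in the core besides itself. This bounds the levels that can
occur. -/
theorem lt_card_starCore (h : (starCore G U v t).Nonempty) : t < (starCore G U v t).card := by
  obtain ⟨a, ha⟩ := h
  refine (le_degree_starCore ha).trans_lt (Finset.card_lt_card ?_)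
  refine (Finset.filter_subset _ _).ssubset_of_ne fun h => ?_
  rw [← h] at ha
  exact U.loopless.irrefl a (Finset.mem_filter.1 ha).2

/-- A star with empty `t`-core has small density. -/
theorem card_dartsIn_le_of_starCore_eq_empty (h : starCore G U v t = ∅) (S : Finset V)
    (hS : ∀ b ∈ S, G.Adj v b) : (dartsIn U S).card ≤ 2 * t * S.card := by
  induction S using Finset.strongInduction with
  | H S ih =>
    -- A vertex with fewer than `t` partners can be deleted at a loss of at most `2 * t` darts; if
    -- there is none, `S` lies in the empty core.
    by_cases hlow : ∃ a ∈ S, (S.filter fun b => U.Adj a b).card < t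
    · obtain ⟨a, ha, hlt⟩ := hlow
      have h1 := ih _ (Finset.erase_ssubset ha) fun b hb => hS b (Finset.mem_of_mem_erase hb)
      have h2 := card_dartsIn_le_erase (U := U) ha
      have h3 := Finset.card_erase_add_one ha
      rw [← h3, mul_add]
      omega
    · push Not at hlow
      have : S = ∅ := Finset.subset_empty.1 (h ▸ subset_starCore hS hlow)
      simp [this, dartsIn]

end Core

/-! ### Levels, votes and the abstract iteration -/

/-- For every vertex the largest power of `2` with a nonempty core among its neighbours (or `0`, if
there is none) and this core. -/
structure StarData {V : Type*} [Fintype V] (G U : SimpleGraph V) where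
  lev : V → ℕ
  star : V → Finset V
  spec : ∀ v, (lev v = 0 ∧ star v = ∅ ∧ starCore G U v 1 = ∅) ∨
    ∃ j, lev v = 2 ^ j ∧ star v = starCore G U v (2 ^ j) ∧ (star v).Nonempty ∧
      starCore G U v (2 ^ (j + 1)) = ∅

namespace StarData

variable {V : Type*} [Fintype V] {G U : SimpleGraph V}

theorem adj_of_mem_star (D : StarData G U) {v a : V} (h : a ∈ D.star v) : G.Adj v a := by
  rcases D.spec v with ⟨-, h2, -⟩ | ⟨j, -, h2, -⟩
  · simp [h2] at h
  · rw [h2] at h; exact adj_of_mem_starCore h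

theorem lev_ne_zero (D : StarData G U) {v a b : V} (ha : G.Adj v a) (hb : G.Adj v b)
    (h : U.Adj a b) : D.lev v ≠ 0 := by
  rcases D.spec v with ⟨-, -, h3⟩ | ⟨j, h1, -⟩
  · have := mem_starCore_one ha hb h
    simp [h3] at this
  · simp [h1]

theorem lev_ne_zero_of_mem (D : StarData G U) {v a : V} (ha : a ∈ D.star v) : D.lev v ≠ 0 := by
  rcases D.spec v with ⟨-, h3, -⟩ | ⟨j, h1, -⟩
  · simp [h3] at ha
  · simp [h1]

theorem star_nonempty (D : StarData G U) {v : V} (h : D.lev v ≠ 0) :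
    (dartsIn U (D.star v)).Nonempty := by
  rcases D.spec v with ⟨h1, -, -⟩ | ⟨j, -, h2, h3, -⟩
  · exact absurd h1 h
  · rw [← Finset.card_pos, h2]
    refine lt_of_lt_of_le ?_ mul_card_starCore_le
    rw [← h2]
    exact Nat.mul_pos (by positivity) h3.card_pos

theorem lev_mul_card_le (D : StarData G U) (v : V) :
    D.lev v * (D.star v).card ≤ (dartsIn U (D.star v)).card := by
  rcases D.spec v with ⟨h1, -, -⟩ | ⟨j, h1, h2, -⟩
  · simp [h1]
  · rw [h2, h1]; exact mul_card_starCore_le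

/-- The core for `2 * lev v` is empty. Together with `lev_mul_card_le` this makes `star v` a densest
star at `v` up to a factor 4. -/
theorem card_dartsIn_le (D : StarData G U) {v : V} (h : D.lev v ≠ 0) (S : Finset V)
    (hS : ∀ b ∈ S, G.Adj v b) : (dartsIn U S).card ≤ 4 * D.lev v * S.card := by
  rcases D.spec v with ⟨h1, -, -⟩ | ⟨j, h1, -, -, h2⟩
  · exact absurd h1 h
  · have := card_dartsIn_le_of_starCore_eq_empty h2 S hS
    rw [h1]
    rw [pow_succ] at this
    linarith

variable [LinearOrder V] (D : StarData G U) (r : V → ℕ)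

/-- The edge `ab` prefers the star of `w` to that of `v`. -/
def Beats (a b w v : V) : Prop :=
  G.Adj a w ∧ G.Adj b w ∧ (D.lev v < D.lev w ∨ (D.lev w = D.lev v ∧ a ∈ D.star w ∧ b ∈ D.star w ∧
    (r w < r v ∨ (r w = r v ∧ w < v))))

/-- The edge `ab` votes for the star of `v`. -/
def VotesFor (a b v : V) : Prop :=
  G.Adj a v ∧ G.Adj b v ∧ a ∈ D.star v ∧ b ∈ D.star v ∧ ∀ w, ¬ D.Beats r a b w v

open scoped Classical in
/-- The uncovered darts that vote for the star of `v`. -/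
noncomputable def votes (v : V) : Finset (V × V) :=
  Finset.univ.filter fun d => U.Adj d.1 d.2 ∧ D.VotesFor r d.1 d.2 v

/-- The star of `v` is added to the spanner. -/
def Accepted (v : V) : Prop := (dartsIn U (D.star v)).card ≤ 8 * (D.votes r v).card

/-- The edge `ab` is covered by a star that is added to the spanner. -/
def Covered (a b : V) : Prop := ∃ v, D.Accepted r v ∧ a ∈ D.star v ∧ b ∈ D.star v

/-- The uncovered edges after the iteration. -/
def nextU : SimpleGraph V where
  Adj a b := U.Adj a b ∧ (∃ w, G.Adj a w ∧ G.Adj b w) ∧ ¬ D.Covered r a b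
  symm := ⟨fun _ _ ⟨h1, ⟨w, h2, h3⟩, h4⟩ =>
    ⟨h1.symm, ⟨w, h3, h2⟩, fun ⟨v, h5, h6, h7⟩ => h4 ⟨v, h5, h7, h6⟩⟩⟩
  loopless := ⟨fun a h => U.loopless.irrefl a h.1⟩

theorem nextU_le : D.nextU r ≤ U := fun _ _ h => h.1

variable {D r}

theorem mem_votes {v : V} {d : V × V} :
    d ∈ D.votes r v ↔ U.Adj d.1 d.2 ∧ D.VotesFor r d.1 d.2 v := by
  simp [votes]

/-- Two stars that contain the edge compete directly, and the order by level, rank and identifier is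
total. -/
theorem VotesFor.unique {a b v w : V} (hv : D.VotesFor r a b v) (hw : D.VotesFor r a b w) :
    v = w := by
  obtain ⟨v1, v2, v3, v4, v5⟩ := hv
  obtain ⟨w1, w2, w3, w4, w5⟩ := hw
  have h1 := w5 v
  have h2 := v5 w
  simp only [Beats, *, true_and] at h1 h2
  rcases lt_trichotomy (D.lev v) (D.lev w) with h | h | h
  · exact absurd (.inl h) h2
  · rcases lt_trichotomy (r v) (r w) with h' | h' | h'
    · exact absurd (.inr ⟨h, .inl h'⟩) h1
    · rcases lt_trichotomy v w with h'' | h'' | h''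
      · exact absurd (.inr ⟨h, .inr ⟨h', h''⟩⟩) h1
      · exact h''
      · exact absurd (.inr ⟨h.symm, .inr ⟨h'.symm, h''⟩⟩) h2
    · exact absurd (.inr ⟨h.symm, .inl h'⟩) h2
  · exact absurd (.inl h) h1

/-- A common neighbour of higher level beats `v` even if its star misses the edge, and the edge then
abstains. The size bound needs this form: the midpoint to which an edge is assigned is an arbitrary
common neighbour. -/
theorem VotesFor.lev_le {a b v w : V} (hv : D.VotesFor r a b v) (ha : G.Adj a w) (hb : G.Adj b w) :
    D.lev w ≤ D.lev v := by
  by_contra h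
  exact hv.2.2.2.2 w ⟨ha, hb, .inl (not_le.1 h)⟩

end StarData

/-! ### The approximation ratio: paying for added stars -/

section Budget

open scoped Classical

variable {V : Type*} [Fintype V]

/-- The darts of `U` outside of `H` that are assigned to `w`. -/
noncomputable def assigned (U H : SimpleGraph V) (asg : V × V → V) (w : V) : Finset (V × V) :=
  Finset.univ.filter fun d => (U.Adj d.1 d.2 ∧ ¬ H.Adj d.1 d.2) ∧ asg d = w

noncomputable def nbrs (H : SimpleGraph V) (w : V) : Finset V :=
  Finset.univ.filter fun a => H.Adj w a

/-- An upper bound on the size of the part of the spanner that is still to be built. -/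
noncomputable def budget (U H : SimpleGraph V) (asg : V × V → V) : ℝ :=
  40 * ((Finset.univ.filter fun d : V × V => U.Adj d.1 d.2 ∧ H.Adj d.1 d.2).card +
    ∑ w, ((nbrs H w).card : ℝ) *
      Real.log (1 + ((assigned U H asg w).card : ℝ) / (nbrs H w).card))

/-- Concavity: `x ↦ s * log (1 + x / s)` has derivative `s / (s + x)`, which on `[l, k]` is smallest
at `k`. -/
theorem mul_div_le_mul_log_sub {s k l : ℝ} (hs : 0 ≤ s) (hl : 0 ≤ l) (hkl : l ≤ k) :
    (k - l) * (s / (s + k)) ≤ s * Real.log (1 + k / s) - s * Real.log (1 + l / s) := by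
  rcases hs.eq_or_lt with rfl | hs
  · simp
  have hk : 0 ≤ k := hl.trans hkl
  have h1 : 0 < 1 + k / s := by positivity
  have h2 : 0 < 1 + l / s := by positivity
  have h3 := Real.log_le_sub_one_of_pos (div_pos h2 h1)
  rw [Real.log_div h2.ne' h1.ne'] at h3
  have h4 : (k - l) * (s / (s + k)) = s * (1 - (1 + l / s) / (1 + k / s)) := by
    have : s + k ≠ 0 := by positivity
    field_simp
    ring
  rw [h4, ← mul_sub]
  exact mul_le_mul_of_nonneg_left (by linarith) hs.le

open StarData in
/-- The size of the part of the spanner that an iteration adds is paid for by the budget. -/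
theorem card_added_le_budget [LinearOrder V] {G U H : SimpleGraph V} (hU : U ≤ G)
    (D : StarData G U) (r : V → ℕ) (hH : ∀ a b, G.Adj a b → H.Adj a b ∨
      ∃ w, H.Adj w a ∧ H.Adj w b) (hHG : H ≤ G) (asg : V × V → V)
    (hasg : ∀ d : V × V, G.Adj d.1 d.2 → ¬ H.Adj d.1 d.2 → H.Adj (asg d) d.1 ∧ H.Adj (asg d) d.2) :
    (((∑ v, if D.Accepted r v then (D.star v).card else 0) + (Finset.univ.filter fun d : V × V =>
      U.Adj d.1 d.2 ∧ ¬ ∃ w, G.Adj d.1 w ∧ G.Adj d.2 w).card : ℕ) : ℝ) +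
        budget (D.nextU r) H asg ≤ budget U H asg := by
  set U' := D.nextU r with hU'
  let k : V → ℕ := fun w => (assigned U H asg w).card
  let s : V → ℕ := fun w => (nbrs H w).card
  let lost : Finset (V × V) := Finset.univ.filter fun d => U.Adj d.1 d.2 ∧ ¬ U'.Adj d.1 d.2
  -- What a dart releases from the budget when it leaves `U`, linearised at the current counts `k`.
  let pay : V × V → ℝ := fun d =>
    if H.Adj d.1 d.2 then 40 else 40 * ((s (asg d) : ℝ) / (s (asg d) + k (asg d)))
  have hpay0 : ∀ d, 0 ≤ pay d := fun d => by
    simp only [pay]; split <;> positivity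
  let triv : Finset (V × V) := Finset.univ.filter fun d : V × V =>
      U.Adj d.1 d.2 ∧ ¬ ∃ w, G.Adj d.1 w ∧ G.Adj d.2 w
  let acc : Finset V := Finset.univ.filter fun v => D.Accepted r v
  have hdisj : (acc : Set V).PairwiseDisjoint (D.votes r) := by
    intro v _ w _ hvw
    refine Finset.disjoint_left.2 fun d hd hd' => hvw ?_
    exact (mem_votes.1 hd).2.unique (mem_votes.1 hd').2
  -- The midpoint `w` has `lev w ≤ lev v`, so `k ≤ 4 * lev v * s` and `40 * s / (s + k) ≥ 40 / (1 +
  -- 4 * lev v) ≥ 8 / lev v` because `lev v ≥ 1`. This fixes the constant 40.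
  have hcost : ∀ v, ∀ d ∈ D.votes r v, 8 / (D.lev v : ℝ) ≤ pay d := by
    intro v d hd
    obtain ⟨hd1, hd2⟩ := mem_votes.1 hd
    have hlv : D.lev v ≠ 0 := D.lev_ne_zero hd2.1.symm hd2.2.1.symm hd1
    have hlv' : (1 : ℝ) ≤ D.lev v := by exact_mod_cast Nat.one_le_iff_ne_zero.2 hlv
    simp only [pay]
    split
    · rw [div_le_iff₀ (by linarith)]; linarith
    · rename_i hdH
      obtain ⟨h1, h2⟩ := hasg d (hU hd1) hdH
      set w := asg d with hw
      have hlw : D.lev w ≠ 0 := D.lev_ne_zero (hHG h1) (hHG h2) hd1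
      have hle : D.lev w ≤ D.lev v := hd2.lev_le (hHG h1).symm (hHG h2).symm
      have hk : k w ≤ 4 * D.lev w * s w := by
        refine le_trans (Finset.card_le_card ?_) (D.card_dartsIn_le hlw (nbrs H w) fun b hb =>
          hHG (by simpa [nbrs] using hb))
        intro e he
        simp only [assigned, Finset.mem_filter, Finset.mem_univ, true_and] at he
        have := hasg e (hU he.1.1) he.1.2
        rw [he.2] at this
        simpa [mem_dartsIn, nbrs, he.1.1] using this
      have hs : 1 ≤ s w := Finset.card_pos.2 ⟨d.1, by simp [nbrs, h1]⟩
      have hk' : (k w : ℝ) ≤ 4 * D.lev v * s w := by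
        have : k w ≤ 4 * D.lev v * s w := hk.trans (by gcongr)
        exact_mod_cast this
      have hs' : (1 : ℝ) ≤ s w := by exact_mod_cast hs
      rw [← mul_div_assoc, div_le_div_iff₀ (by linarith) (by positivity)]
      nlinarith
  -- An accepted star satisfies `lev * card ≤ darts ≤ 8 * votes`, and each vote pays `8 / lev`.
  have hstar : ∀ v ∈ acc, ((D.star v).card : ℝ) ≤ ∑ d ∈ D.votes r v, pay d := by
    intro v hv
    have hv : D.Accepted r v := by simpa [acc] using hv
    by_cases hl : D.lev v = 0
    · have : D.star v = ∅ := by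
        by_contra h
        obtain ⟨a, ha⟩ := Finset.nonempty_iff_ne_empty.2 h
        exact D.lev_ne_zero_of_mem ha hl
      rw [this]
      simpa using Finset.sum_nonneg fun d _ => hpay0 d
    · have hl' : (0 : ℝ) < D.lev v := by exact_mod_cast Nat.pos_of_ne_zero hl
      have h1 : (D.lev v : ℝ) * (D.star v).card ≤ 8 * (D.votes r v).card := by
        exact_mod_cast (D.lev_mul_card_le v).trans hv
      refine le_trans ?_ (Finset.card_nsmul_le_sum _ _ _ (hcost v))
      rw [nsmul_eq_mul, ← mul_div_assoc, le_div_iff₀ hl']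
      linarith
  have htriv : (triv.card : ℝ) ≤ ∑ d ∈ triv, pay d := by
    have : ∀ d ∈ triv, (1 : ℝ) ≤ pay d := by
      intro d hd
      simp only [triv, Finset.mem_filter, Finset.mem_univ, true_and] at hd
      -- An edge in no triangle belongs to every 2-spanner.
      have : H.Adj d.1 d.2 := by
        refine (hH _ _ (hU hd.1)).resolve_right ?_
        rintro ⟨w, h1, h2⟩
        exact hd.2 ⟨w, (hHG h1).symm, (hHG h2).symm⟩
      simp only [pay, this, if_true]; norm_num
    have := Finset.card_nsmul_le_sum _ _ _ this
    simpa using this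
  have hsub : triv ∪ acc.biUnion (D.votes r) ⊆ lost := by
    intro d hd
    rcases Finset.mem_union.1 hd with hd | hd
    · simp only [triv, Finset.mem_filter, Finset.mem_univ, true_and] at hd
      simp only [lost, Finset.mem_filter, Finset.mem_univ, true_and]
      exact ⟨hd.1, fun h => hd.2 h.2.1⟩
    · obtain ⟨v, hv, hd⟩ := Finset.mem_biUnion.1 hd
      obtain ⟨hd1, hd2⟩ := mem_votes.1 hd
      simp only [lost, Finset.mem_filter, Finset.mem_univ, true_and]
      exact ⟨hd1, fun h => h.2.2 ⟨v, by simpa [acc] using hv, hd2.2.2.1, hd2.2.2.2.1⟩⟩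
  have hdisj' : Disjoint triv (acc.biUnion (D.votes r)) := by
    refine Finset.disjoint_left.2 fun d hd hd' => ?_
    obtain ⟨v, hv, hd'⟩ := Finset.mem_biUnion.1 hd'
    simp only [triv, Finset.mem_filter, Finset.mem_univ, true_and] at hd
    have := (mem_votes.1 hd').2
    exact hd.2 ⟨v, this.1, this.2.1⟩
  have hadded : (((∑ v, if D.Accepted r v then (D.star v).card else 0) + triv.card : ℕ) : ℝ) ≤
      ∑ d ∈ lost, pay d := by
    refine le_trans ?_ (Finset.sum_le_sum_of_subset_of_nonneg hsub fun d _ _ => hpay0 d)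
    rw [Finset.sum_union hdisj', Finset.sum_biUnion hdisj, ← Finset.sum_filter, Nat.cast_add,
      Nat.cast_sum, add_comm]
    exact add_le_add htriv (Finset.sum_le_sum hstar)
  have hle : U' ≤ U := D.nextU_le r
  have hk' : ∀ w, ((lost.filter fun d => ¬ H.Adj d.1 d.2).filter fun d => asg d = w).card +
      (assigned U' H asg w).card = k w := by
    intro w
    rw [← Finset.card_union_of_disjoint]
    · congr 1
      ext d
      simp only [lost, assigned, Finset.mem_union, Finset.mem_filter, Finset.mem_univ, true_and]
      have := @hle d.1 d.2
      tauto
    · refine Finset.disjoint_left.2 fun d hd hd' => ?_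
      simp only [lost, assigned, Finset.mem_filter, Finset.mem_univ, true_and] at hd hd'
      tauto
  have hH' : (lost.filter fun d => H.Adj d.1 d.2).card +
      (Finset.univ.filter fun d : V × V => U'.Adj d.1 d.2 ∧ H.Adj d.1 d.2).card =
      (Finset.univ.filter fun d : V × V => U.Adj d.1 d.2 ∧ H.Adj d.1 d.2).card := by
    rw [← Finset.card_union_of_disjoint]
    · congr 1
      ext d
      simp only [lost, Finset.mem_union, Finset.mem_filter, Finset.mem_univ, true_and]
      have := @hle d.1 d.2
      tauto
    · refine Finset.disjoint_left.2 fun d hd hd' => ?_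
      simp only [lost, Finset.mem_filter, Finset.mem_univ, true_and] at hd hd'
      tauto
  have hsum : ∑ d ∈ lost, pay d = 40 * (lost.filter fun d => H.Adj d.1 d.2).card +
      40 * ∑ w, ((k w : ℝ) - (assigned U' H asg w).card) * ((s w : ℝ) / (s w + k w)) := by
    rw [← Finset.sum_filter_add_sum_filter_not lost fun d => H.Adj d.1 d.2]
    congr 1
    · rw [Finset.sum_congr rfl (g := fun _ => (40 : ℝ))]
      · simp [mul_comm]
      · intro d hd
        simp [pay, (Finset.mem_filter.1 hd).2]
    · rw [← Finset.sum_fiberwise _ asg, Finset.mul_sum]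
      refine Finset.sum_congr rfl fun w _ => ?_
      rw [← hk' w, Nat.cast_add, add_sub_cancel_right,
        Finset.sum_congr rfl (g := fun _ => (40 : ℝ) * ((s w : ℝ) / (s w + k w)))]
      · rw [Finset.sum_const, nsmul_eq_mul, ← hk' w, Nat.cast_add]
        ring
      · intro d hd
        simp only [Finset.mem_filter] at hd
        simp [pay, hd.1.2, hd.2]
  have hlog : ∑ w, ((k w : ℝ) - (assigned U' H asg w).card) * ((s w : ℝ) / (s w + k w)) ≤
      ∑ w, ((s w : ℝ) * Real.log (1 + (k w : ℝ) / s w) -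
        (s w : ℝ) * Real.log (1 + ((assigned U' H asg w).card : ℝ) / s w)) := by
    refine Finset.sum_le_sum fun w _ => mul_div_le_mul_log_sub (by positivity) (by positivity) ?_
    exact_mod_cast (hk' w) ▸ Nat.le_add_left _ _
  rw [Finset.sum_sub_distrib] at hlog
  have hH'' : ((lost.filter fun d => H.Adj d.1 d.2).card : ℝ) +
      (Finset.univ.filter fun d : V × V => U'.Adj d.1 d.2 ∧ H.Adj d.1 d.2).card =
      (Finset.univ.filter fun d : V × V => U.Adj d.1 d.2 ∧ H.Adj d.1 d.2).card := by
    exact_mod_cast hH'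
  simp only [budget]
  simp only [triv, k, s] at hadded hsum hlog ⊢
  linarith

end Budget

/-! ### The initial budget and deterministic progress -/

section

open scoped Classical

theorem mul_log_one_add_div_le {s k x : ℝ} (hs : 0 ≤ s) (hk : 0 ≤ k) (hx : 0 < x) :
    s * Real.log (1 + k / s) ≤ s * Real.log x + (s + k) / x - s := by
  rcases hs.eq_or_lt with rfl | hs
  · simpa using div_nonneg hk hx.le
  have h1 : 0 < 1 + k / s := by positivity
  have h3 := Real.log_le_sub_one_of_pos (div_pos h1 hx)
  rw [Real.log_div h1.ne' hx.ne'] at h3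
  have h4 : (s + k) / x = s * ((1 + k / s) / x) := by field_simp
  rw [h4]
  nlinarith

/-- Jensen's inequality for the logarithm: bound each term by the tangent at the common point `1 + K
/ S`; the linear parts cancel in the sum. -/
theorem sum_mul_log_one_add_div_le {ι : Type*} (I : Finset ι) (s k : ι → ℝ)
    (hs : ∀ i ∈ I, 0 ≤ s i) (hk : ∀ i ∈ I, 0 ≤ k i) (hS : 0 < ∑ i ∈ I, s i) :
    ∑ i ∈ I, s i * Real.log (1 + k i / s i) ≤
      (∑ i ∈ I, s i) * Real.log (1 + (∑ i ∈ I, k i) / ∑ i ∈ I, s i) := by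
  set S := ∑ i ∈ I, s i with hSd
  set K := ∑ i ∈ I, k i with hKd
  have hK : 0 ≤ K := Finset.sum_nonneg hk
  have hx : 0 < 1 + K / S := by positivity
  calc ∑ i ∈ I, s i * Real.log (1 + k i / s i)
      ≤ ∑ i ∈ I, (s i * Real.log (1 + K / S) + (s i + k i) / (1 + K / S) - s i) :=
        Finset.sum_le_sum fun i hi => mul_log_one_add_div_le (hs i hi) (hk i hi) hx
    _ = S * Real.log (1 + K / S) + (S + K) / (1 + K / S) - S := by
        rw [Finset.sum_sub_distrib, Finset.sum_add_distrib, ← Finset.sum_mul, ← Finset.sum_div,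
          Finset.sum_add_distrib]
    _ = S * Real.log (1 + K / S) := by
        have : (S + K) / (1 + K / S) = S := by field_simp
        rw [this]; ring

variable {V : Type*} [Fintype V]

theorem ncard_edgeSet_eq (H : SimpleGraph V) : H.edgeSet.ncard = H.edgeFinset.card := by
  rw [← SimpleGraph.coe_edgeFinset, Set.ncard_coe_finset]

theorem sum_card_nbrs (H : SimpleGraph V) : ∑ w, (nbrs H w).card = 2 * H.edgeSet.ncard := by
  rw [ncard_edgeSet_eq, ← SimpleGraph.sum_degrees_eq_twice_card_edges]
  refine Finset.sum_congr rfl fun w _ => ?_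
  rw [← SimpleGraph.card_neighborFinset_eq_degree]
  congr 1
  ext a
  simp [nbrs]

theorem card_darts_univ (H : SimpleGraph V) :
    (dartsIn H Finset.univ).card = 2 * H.edgeSet.ncard := by
  rw [card_dartsIn, ← sum_card_nbrs]
  rfl

theorem sum_card_assigned_le (G H : SimpleGraph V) (asg : V × V → V) :
    ∑ w, (assigned G H asg w).card ≤ 2 * G.edgeSet.ncard := by
  rw [← card_darts_univ]
  have : ∀ w, assigned G H asg w = ((dartsIn G Finset.univ).filter fun d =>
      ¬ H.Adj d.1 d.2).filter fun d => asg d = w := fun w => by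
    ext d; simp [assigned, mem_dartsIn]
  simp only [this]
  refine le_trans (le_of_eq ?_) (Finset.card_filter_le _ fun d : V × V => ¬ H.Adj d.1 d.2)
  rw [Finset.card_eq_sum_card_fiberwise (f := asg) (t := Finset.univ)
    (fun _ _ => Finset.mem_coe.2 (Finset.mem_univ _))]

/-- Merging the terms by concavity leaves `S * log (1 + K / S)` with `S = 2 * |H|` and `K ≤ 2 * m`.
A connected `H` with an edge has `S ≥ n`, whence `1 + K / S ≤ (2 + m / n) ^ 2`. With `L = log (2 + m
/ n) ≥ 1 / 2` the total is at most `40 * (S + 2 * S * L) ≤ 160 * S * L`. -/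
theorem budget_le {G H : SimpleGraph V} (hH : H.Connected) (asg : V × V → V) :
    budget G H asg ≤ 320 * Real.log (2 + (G.edgeSet.ncard : ℝ) / (Fintype.card V : ℝ)) *
      (H.edgeSet.ncard : ℝ) := by
  obtain ⟨S, hSd⟩ : ∃ S : ℝ, S = ∑ w, ((nbrs H w).card : ℝ) := ⟨_, rfl⟩
  obtain ⟨K, hKd⟩ : ∃ K : ℝ, K = ∑ w, ((assigned G H asg w).card : ℝ) := ⟨_, rfl⟩
  obtain ⟨m, hm⟩ : ∃ m : ℝ, m = G.edgeSet.ncard := ⟨_, rfl⟩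
  obtain ⟨n, hn⟩ : ∃ n : ℝ, n = Fintype.card V := ⟨_, rfl⟩
  rw [← hm, ← hn]
  have hSE : S = 2 * H.edgeSet.ncard := by
    rw [hSd]; exact_mod_cast sum_card_nbrs H
  have hKm : K ≤ 2 * m := by
    rw [hKd, hm]; exact_mod_cast sum_card_assigned_le G H asg
  have hK0 : 0 ≤ K := hKd ▸ Finset.sum_nonneg fun _ _ => by positivity
  have hm0 : 0 ≤ m := by rw [hm]; positivity
  have hn0 : 0 ≤ n := by rw [hn]; positivity
  have hS0 : 0 ≤ S := hSd ▸ Finset.sum_nonneg fun _ _ => by positivity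
  have h1 : ((Finset.univ.filter fun d : V × V => G.Adj d.1 d.2 ∧ H.Adj d.1 d.2).card : ℝ) ≤ S := by
    rw [hSE]
    have : (Finset.univ.filter fun d : V × V => G.Adj d.1 d.2 ∧ H.Adj d.1 d.2).card ≤
        2 * H.edgeSet.ncard := by
      rw [← card_darts_univ]
      refine Finset.card_le_card fun d hd => ?_
      simp only [Finset.mem_filter] at hd
      simp [mem_dartsIn, hd.2.2]
    exact_mod_cast this
  have hL : (1 : ℝ) / 2 ≤ Real.log (2 + m / n) := by
    have h2 : Real.log 2 ≤ Real.log (2 + m / n) :=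
      Real.log_le_log (by norm_num) (by linarith [div_nonneg hm0 hn0])
    have := Real.log_two_gt_d9
    linarith
  have hlog : ∑ w, ((nbrs H w).card : ℝ) * Real.log (1 + ((assigned G H asg w).card : ℝ) /
      (nbrs H w).card) ≤ S * (2 * Real.log (2 + m / n)) := by
    rcases hS0.eq_or_lt with h0 | hS
    · have hz : ∀ w, ((nbrs H w).card : ℝ) = 0 := fun w =>
        (Finset.sum_eq_zero_iff_of_nonneg (fun _ _ => by positivity)).1
          (hSd ▸ h0.symm) w (Finset.mem_univ w)
      simp [hz, ← h0]
    · have h2 := sum_mul_log_one_add_div_le Finset.univ (fun w => ((nbrs H w).card : ℝ))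
        (fun w => ((assigned G H asg w).card : ℝ)) (fun _ _ => by positivity)
        (fun _ _ => by positivity) (hSd ▸ hS)
      rw [← hSd, ← hKd] at h2
      refine h2.trans (mul_le_mul_of_nonneg_left ?_ hS0)
      have hnS : n ≤ S := by
        have h3 := hH.card_vert_le_card_edgeSet_add_one
        rw [Nat.card_eq_fintype_card, Nat.card_coe_set_eq] at h3
        have h4 : 0 < H.edgeSet.ncard := by
          rw [hSE] at hS
          have : (0 : ℝ) < H.edgeSet.ncard := by linarith
          exact_mod_cast this
        have h5 : Fintype.card V ≤ 2 * H.edgeSet.ncard := by omega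
        rw [hSE, hn]; exact_mod_cast h5
      have hn1 : 0 < n := by
        have := hH.nonempty
        rw [hn]; exact_mod_cast Fintype.card_pos
      rw [show 2 * Real.log (2 + m / n) = Real.log ((2 + m / n) ^ 2) by
        rw [Real.log_pow, Nat.cast_ofNat]]
      refine Real.log_le_log (by positivity) ?_
      have h6 : K / S ≤ 2 * (m / n) := by
        rw [← mul_div_assoc]
        exact div_le_div₀ (by positivity) hKm hn1 hnS
      have h7 : 0 ≤ m / n := by positivity
      nlinarith
  rw [budget]
  have := mul_nonneg hS0 (by linarith : 0 ≤ Real.log (2 + m / n) - 1 / 2)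
  have h8 : 320 * Real.log (2 + m / n) * H.edgeSet.ncard = 160 * (S * Real.log (2 + m / n)) := by
    rw [hSE]; ring
  rw [h8]
  linarith

namespace StarData

variable {G U : SimpleGraph V} (D : StarData G U) (r : V → ℕ)

theorem exists_max_lev [Nonempty V] : ∃ v, ∀ w, D.lev w ≤ D.lev v := Finite.exists_max _

variable [LinearOrder V]

/-- Every iteration makes progress. -/
theorem card_darts_nextU_lt (h : U ≠ ⊥) :
    (dartsIn (D.nextU r) Finset.univ).card < (dartsIn U Finset.univ).card := by
  have hsub : dartsIn (D.nextU r) Finset.univ ⊆ dartsIn U Finset.univ := fun d hd => by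
    rw [mem_dartsIn] at *; exact ⟨hd.1, hd.2.1, hd.2.2.1⟩
  obtain ⟨a, b, hab⟩ : ∃ a b, U.Adj a b := by
    by_contra h'
    push Not at h'
    exact h (by ext a b; simpa using h' a b)
  suffices ∃ d : V × V, U.Adj d.1 d.2 ∧ ¬ (D.nextU r).Adj d.1 d.2 by
    obtain ⟨d, h1, h2⟩ := this
    refine Finset.card_lt_card (hsub.ssubset_of_ne fun h => h2 ?_)
    have : d ∈ dartsIn U Finset.univ := by simp [mem_dartsIn, h1]
    rw [← h, mem_dartsIn] at this
    exact this.2.2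
  by_cases htri : ∃ w, G.Adj a w ∧ G.Adj b w
  swap
  · exact ⟨(a, b), hab, fun h => htri h.2.1⟩
  obtain ⟨w, hw1, hw2⟩ := htri
  have : Nonempty V := ⟨a⟩
  obtain ⟨v₀, hv₀⟩ := D.exists_max_lev
  -- Of the stars of highest level, take the first by rank and then by identifier: nothing beats it,
  -- so all its darts vote for it.
  obtain ⟨v, hv, hmin⟩ := (Finset.univ.filter fun v => D.lev v = D.lev v₀).exists_min_image
    (fun v => toLex (r v, v)) ⟨v₀, by simp⟩
  simp only [Finset.mem_filter, Finset.mem_univ, true_and] at hv hmin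
  have hl : D.lev v ≠ 0 := by
    have := D.lev_ne_zero hw1.symm hw2.symm hab
    have := hv₀ w
    omega
  have hvotes : dartsIn U (D.star v) ⊆ D.votes r v := by
    intro d hd
    obtain ⟨h1, h2, h3⟩ := mem_dartsIn.1 hd
    refine mem_votes.2 ⟨h3, (D.adj_of_mem_star h1).symm, (D.adj_of_mem_star h2).symm, h1, h2, ?_⟩
    rintro x ⟨-, -, hx | ⟨hx, -, -, hx'⟩⟩
    · have := hv₀ x; omega
    · have := hmin x (hx.trans hv)
      rw [Prod.Lex.toLex_le_toLex] at this
      rcases this with h | ⟨h, h'⟩ <;> rcases hx' with hx' | ⟨hx', hx''⟩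
      · omega
      · omega
      · omega
      · exact absurd h' (not_le.2 hx'')
  have hacc : D.Accepted r v := (Finset.card_le_card hvotes).trans (by omega)
  obtain ⟨d, hd⟩ := D.star_nonempty hl
  obtain ⟨h1, h2, h3⟩ := mem_dartsIn.1 hd
  exact ⟨d, h3, fun h => h.2.2 ⟨v, hacc, h1, h2⟩⟩

end StarData

end

/-! ### The probability of having the smallest rank -/

/-- With `pow_succ_le_add_mul_pow` this encloses `(y + 1) ^ (b + 1) - y ^ (b + 1)` between discrete
derivatives; telescoping then compares power sums with `M ^ (b + 1)`. -/
theorem pow_succ_add_mul_pow_le (y b : ℕ) : y ^ (b + 1) + (b + 1) * y ^ b ≤ (y + 1) ^ (b + 1) := by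
  induction b with
  | zero => simp
  | succ b ih =>
    rw [pow_succ (y + 1)]
    refine le_trans ?_ (Nat.mul_le_mul_right _ ih)
    ring_nf
    nlinarith [Nat.zero_le (y ^ b)]

theorem pow_succ_le_add_mul_pow (y b : ℕ) :
    (y + 1) ^ (b + 1) ≤ y ^ (b + 1) + (b + 1) * (y + 1) ^ b := by
  induction b with
  | zero => simp
  | succ b ih =>
    rw [pow_succ (y + 1)]
    refine (Nat.mul_le_mul_right _ ih).trans ?_
    have : y ^ (b + 1) ≤ (y + 1) ^ (b + 1) := Nat.pow_le_pow_left (by omega) _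
    have h2 : (b + 1) * (y + 1) ^ b * (y + 1) = (b + 1) * (y + 1) ^ (b + 1) := by ring
    rw [add_mul, h2]
    ring_nf at this ⊢
    nlinarith

theorem succ_mul_sum_pow_le (M b : ℕ) : (b + 1) * ∑ y ∈ Finset.range M, y ^ b ≤ M ^ (b + 1) := by
  induction M with
  | zero => simp
  | succ M ih =>
    rw [Finset.sum_range_succ, mul_add]
    have := pow_succ_add_mul_pow_le M b
    omega

theorem pow_succ_le_succ_mul_sum_pow (M b : ℕ) :
    M ^ (b + 1) ≤ (b + 1) * ∑ y ∈ Finset.range M, y ^ b + (b + 1) * M ^ b := by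
  have : ∀ M, M ^ (b + 1) ≤ (b + 1) * ∑ y ∈ Finset.range M, (y + 1) ^ b := by
    intro M
    induction M with
    | zero => simp
    | succ M ih =>
      rw [Finset.sum_range_succ, mul_add]
      have := pow_succ_le_add_mul_pow M b
      omega
  refine (this M).trans ?_
  rw [← mul_add, ← Finset.sum_range_succ]
  refine Nat.mul_le_mul_left _ ?_
  rw [Finset.sum_range_succ']
  exact Nat.le_add_right _ _

section StrictMin

open scoped Classical

variable {V : Type*} [Fintype V] {M : ℕ}

/-- The ranks for which `v` has the unique smallest rank in `A`. -/
noncomputable def strictMin (M : ℕ) (A : Finset V) (v : V) : Finset (V → Fin M) :=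
  Finset.univ.filter fun r => ∀ w ∈ A, w ≠ v → r v < r w

theorem mem_strictMin {A : Finset V} {v : V} {r : V → Fin M} :
    r ∈ strictMin M A v ↔ ∀ w ∈ A, w ≠ v → r v < r w := by
  simp [strictMin]

/-- Fix the rank `x` of `v`: each other member of `A` has `M - 1 - x` larger ranks available, and
vertices outside `A` are free. -/
theorem card_strictMin {A : Finset V} {v : V} (hv : v ∈ A) :
    (strictMin M A v).card =
      M ^ (Fintype.card V - A.card) * ∑ y ∈ Finset.range M, y ^ (A.card - 1) := by
  rw [Finset.card_eq_sum_card_fiberwise (f := fun r => r v) (t := Finset.univ)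
    (fun _ _ => Finset.mem_coe.2 (Finset.mem_univ _))]
  have key : ∀ x : Fin M, ((strictMin M A v).filter fun r => r v = x).card =
      M ^ (Fintype.card V - A.card) * (M - 1 - x) ^ (A.card - 1) := by
    intro x
    have : (strictMin M A v).filter (fun r => r v = x) = Fintype.piFinset fun w =>
        if w ∈ A then (if w = v then {x} else Finset.Ioi x) else Finset.univ := by
      ext r
      simp only [strictMin, Finset.mem_filter, Finset.mem_univ, true_and, Fintype.mem_piFinset]
      constructor
      · rintro ⟨h1, rfl⟩ w
        by_cases hA : w ∈ A
        · by_cases hw : w = v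
          · simp [hw, hv]
          · simp [hA, hw, h1 w hA hw]
        · simp [hA]
      · intro h
        have hx : r v = x := by simpa [hv] using h v
        refine ⟨fun w hA hw => ?_, hx⟩
        simpa [hA, hw, hx] using h w
    rw [this, Fintype.card_piFinset]
    have : ∀ w, (if w ∈ A then (if w = v then {x} else Finset.Ioi x) else Finset.univ).card =
        if w ∈ A then (if w = v then 1 else M - 1 - x) else M := fun w => by
      split_ifs <;> simp
    simp only [this]
    rw [Finset.prod_ite, Finset.prod_const]
    have h1 : (Finset.univ.filter fun w => w ∈ A) = A := by ext; simp
    have h2 : (Finset.univ.filter fun w => w ∉ A) = Aᶜ := by ext; simp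
    rw [h1, h2, Finset.card_compl, mul_comm, ← Finset.mul_prod_erase _ _ hv,
      Finset.prod_congr rfl (g := fun _ => M - 1 - (x : ℕ))]
    · simp [Finset.card_erase_of_mem hv]
    · intro w hw
      rw [if_neg (Finset.ne_of_mem_erase hw)]
  rw [Finset.sum_congr rfl fun x _ => key x, ← Finset.mul_sum]
  congr 1
  rw [Fin.sum_univ_eq_sum_range fun x => (M - 1 - x) ^ (A.card - 1),
    Finset.sum_range_reflect fun x => x ^ (A.card - 1)]

theorem card_mul_card_strictMin_le {A : Finset V} {v : V} (hv : v ∈ A) :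
    A.card * (strictMin M A v).card ≤ M ^ Fintype.card V := by
  rw [card_strictMin hv]
  have hA : A.card - 1 + 1 = A.card := Nat.succ_pred_eq_of_pos (Finset.card_pos.2 ⟨v, hv⟩)
  have h1 := succ_mul_sum_pow_le M (A.card - 1)
  rw [hA] at h1
  calc _ = M ^ (Fintype.card V - A.card) *
        (A.card * ∑ y ∈ Finset.range M, y ^ (A.card - 1)) := by ring
    _ ≤ M ^ (Fintype.card V - A.card) * M ^ A.card := Nat.mul_le_mul_left _ h1
    _ = M ^ Fintype.card V := by
      rw [← pow_add, Nat.sub_add_cancel A.card_le_univ]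

/-- Ties are the only loss against probability `1 / |A|`. They correspond to the boundary term `|A|
* M ^ (|A| - 1)` of the power sum, at most `M ^ |A| / 8` for these `M`. -/
theorem le_card_mul_card_strictMin {A : Finset V} {v : V} (hv : v ∈ A)
    (hM : 8 * Fintype.card V ≤ M) :
    7 * M ^ Fintype.card V ≤ 8 * (A.card * (strictMin M A v).card) := by
  rw [card_strictMin hv]
  have hA : A.card - 1 + 1 = A.card := Nat.succ_pred_eq_of_pos (Finset.card_pos.2 ⟨v, hv⟩)
  have h1 := pow_succ_le_succ_mul_sum_pow M (A.card - 1)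
  rw [hA] at h1
  have h2 : 8 * (A.card * M ^ (A.card - 1)) ≤ M ^ A.card := by
    calc 8 * (A.card * M ^ (A.card - 1)) = (8 * A.card) * M ^ (A.card - 1) := by ring
      _ ≤ M * M ^ (A.card - 1) :=
        Nat.mul_le_mul_right _ ((Nat.mul_le_mul_left _ A.card_le_univ).trans hM)
      _ = M ^ A.card := by rw [← pow_succ', hA]
  calc 7 * M ^ Fintype.card V = M ^ (Fintype.card V - A.card) * (7 * M ^ A.card) := by
        rw [← Nat.sub_add_cancel A.card_le_univ, pow_add, Nat.sub_add_cancel A.card_le_univ]; ring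
    _ ≤ M ^ (Fintype.card V - A.card) *
        (8 * (A.card * ∑ y ∈ Finset.range M, y ^ (A.card - 1))) :=
        Nat.mul_le_mul_left _ (by omega)
    _ = _ := by ring

end StrictMin

/-- Of two elements at least one has the smaller value. Applied to numbers of rivals: on average, at
least half of the darts of a star have no more rivals than a given one. -/
theorem card_sq_le_two_mul_sum_card_filter_le {α : Type*} (C : Finset α) (f : α → ℕ) :
    C.card ^ 2 ≤ 2 * ∑ d ∈ C, (C.filter fun e => f e ≤ f d).card := by
  simp only [Finset.card_filter]
  calc C.card ^ 2 = ∑ _d ∈ C, ∑ _e ∈ C, 1 := by simp [sq]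
    _ ≤ ∑ d ∈ C, ∑ e ∈ C, ((if f e ≤ f d then 1 else 0) + if f d ≤ f e then 1 else 0) := by
      refine Finset.sum_le_sum fun d _ => Finset.sum_le_sum fun e _ => ?_
      rcases le_total (f e) (f d) with h | h
      · rw [if_pos h]; omega
      · rw [if_pos h]; omega
    _ = _ := by
      simp only [Finset.sum_add_distrib]
      rw [Finset.sum_comm (f := fun d e => if f d ≤ f e then 1 else 0), two_mul]

/-! ### Expected progress at the highest level -/

namespace StarData

open scoped Classical

variable {V : Type*} [Fintype V] [LinearOrder V] {G U : SimpleGraph V} (D : StarData G U) {M : ℕ}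

/-- The stars of level `l` that cover a dart. -/
noncomputable def rivals (l : ℕ) (d : V × V) : Finset V :=
  Finset.univ.filter fun w => D.lev w = l ∧ d.1 ∈ D.star w ∧ d.2 ∈ D.star w

variable {D} {l : ℕ} {v : V} {d : V × V}

theorem mem_rivals : v ∈ D.rivals l d ↔ D.lev v = l ∧ d.1 ∈ D.star v ∧ d.2 ∈ D.star v := by
  simp [rivals]

/-- At the highest level nobody can win by level, so only rivals can beat `v`, and they all have
larger ranks. -/
theorem mem_votes_of_mem_strictMin (hl : ∀ w, D.lev w ≤ l) (hv : D.lev v = l)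
    (hd : d ∈ dartsIn U (D.star v)) {r : V → Fin M} (hr : r ∈ strictMin M (D.rivals l d) v) :
    d ∈ D.votes (fun w => (r w : ℕ)) v := by
  obtain ⟨h1, h2, h3⟩ := mem_dartsIn.1 hd
  refine mem_votes.2 ⟨h3, (D.adj_of_mem_star h1).symm, (D.adj_of_mem_star h2).symm, h1, h2, ?_⟩
  rintro x ⟨-, -, hx | ⟨hx, hx1, hx2, hx'⟩⟩
  · have := hl x; omega
  · have hne : x ≠ v := by
      rintro rfl
      rcases hx' with h | ⟨-, h⟩
      · exact lt_irrefl _ h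
      · exact lt_irrefl _ h
    have hlt := mem_strictMin.1 hr x (mem_rivals.2 ⟨hx.trans hv, hx1, hx2⟩) hne
    rcases hx' with h | ⟨h, -⟩
    · exact absurd hlt (not_lt.2 (le_of_lt h))
    · exact absurd hlt (not_lt.2 (le_of_eq (Fin.ext h)))

variable (D) in
/-- The ranks for which a dart votes for the star of `v` and this star is added to the spanner. -/
noncomputable def good (M l : ℕ) (v : V) (d : V × V) : Finset (V → Fin M) :=
  (strictMin M (D.rivals l d) v).filter fun r => D.Accepted (fun w => (r w : ℕ)) v

/-- Let `d` have `a` rivals. The star of `v` wins `d` with probability at most `1 / a`. If `e` has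
at most `a` rivals, `v` wins both darts with probability at least `(7 / 8) / (2 * a)`, as the union
has at most `2 * a` elements. When the star is rejected, fewer than an eighth of its darts vote for
it. Counting pairs of a rank assignment winning `d` and a further dart `e` won by `v` from both
sides gives the inequality. -/
theorem card_mul_card_good_ge (hl : ∀ w, D.lev w ≤ l) (hv : D.lev v = l)
    (hd : d ∈ dartsIn U (D.star v)) (hM : 8 * Fintype.card V ≤ M) :
    (M : ℝ) ^ Fintype.card V * (7 / 16 * ((dartsIn U (D.star v)).filter fun e =>
      (D.rivals l e).card ≤ (D.rivals l d).card).card - (dartsIn U (D.star v)).card / 8) ≤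
    (dartsIn U (D.star v)).card * ((D.rivals l d).card * (D.good M l v d).card) := by
  set C := dartsIn U (D.star v) with hC
  set L := C.filter fun e => (D.rivals l e).card ≤ (D.rivals l d).card with hL
  set P : ℝ := (M : ℝ) ^ Fintype.card V with hP
  set a : ℝ := ((D.rivals l d).card : ℝ) with ha
  have hmem : ∀ e ∈ C, v ∈ D.rivals l e := fun e he => by
    obtain ⟨h1, h2, -⟩ := mem_dartsIn.1 he
    exact mem_rivals.2 ⟨hv, h1, h2⟩
  have ha0 : 0 < a := by
    rw [ha]; exact_mod_cast Finset.card_pos.2 ⟨v, hmem d hd⟩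
  have hP0 : 0 ≤ P := by positivity
  let S := strictMin M (D.rivals l d) v
  have hlow : ∀ e ∈ L, 7 * P ≤ 16 * a *
      ((S.filter fun r => r ∈ strictMin M (D.rivals l e) v).card : ℝ) := by
    intro e he
    have heC := (Finset.mem_filter.1 he).1
    have hle := (Finset.mem_filter.1 he).2
    have h1 := le_card_mul_card_strictMin (M := M)
      (Finset.mem_union_left (D.rivals l e) (hmem d hd)) hM
    have h2 : strictMin M (D.rivals l d ∪ D.rivals l e) v ⊆
        S.filter fun r => r ∈ strictMin M (D.rivals l e) v := by
      intro r hr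
      simp only [S, mem_strictMin, Finset.mem_filter] at hr ⊢
      exact ⟨fun w hw => hr w (Finset.mem_union_left _ hw),
        fun w hw => hr w (Finset.mem_union_right _ hw)⟩
    have h3 : (D.rivals l d ∪ D.rivals l e).card ≤ 2 * (D.rivals l d).card :=
      (Finset.card_union_le _ _).trans (by omega)
    have h4 : 7 * M ^ Fintype.card V ≤ 16 * (D.rivals l d).card *
        (S.filter fun r => r ∈ strictMin M (D.rivals l e) v).card := by
      calc _ ≤ _ := h1
        _ ≤ 8 * (2 * (D.rivals l d).card *
            (S.filter fun r => r ∈ strictMin M (D.rivals l e) v).card) :=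
          Nat.mul_le_mul_left _ (Nat.mul_le_mul h3 (Finset.card_le_card h2))
        _ = _ := by ring
    rw [hP, ha]
    exact_mod_cast h4
  have hdouble : ∑ e ∈ L, ((S.filter fun r => r ∈ strictMin M (D.rivals l e) v).card : ℝ) =
      ∑ r ∈ S, ((L.filter fun e => r ∈ strictMin M (D.rivals l e) v).card : ℝ) := by
    simp only [Finset.card_filter, Nat.cast_sum]
    exact Finset.sum_comm
  have hupp : ∀ r ∈ S, ((L.filter fun e => r ∈ strictMin M (D.rivals l e) v).card : ℝ) ≤
      (if D.Accepted (fun w => (r w : ℕ)) v then (C.card : ℝ) else 0) + C.card / 8 := by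
    intro r _
    have hsub : (L.filter fun e => r ∈ strictMin M (D.rivals l e) v) ⊆
        D.votes (fun w => (r w : ℕ)) v := by
      intro e he
      obtain ⟨h1, h2⟩ := Finset.mem_filter.1 he
      exact mem_votes_of_mem_strictMin hl hv (Finset.mem_filter.1 h1).1 h2
    split_ifs with hacc
    · have : (L.filter fun e => r ∈ strictMin M (D.rivals l e) v).card ≤ C.card :=
        Finset.card_le_card ((Finset.filter_subset _ _).trans (Finset.filter_subset _ _))
      have : ((L.filter fun e => r ∈ strictMin M (D.rivals l e) v).card : ℝ) ≤ C.card := by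
        exact_mod_cast this
      have : (0 : ℝ) ≤ C.card / 8 := by positivity
      linarith
    · have h1 := Finset.card_le_card hsub
      have h2 : 8 * (L.filter fun e => r ∈ strictMin M (D.rivals l e) v).card ≤ C.card := by
        have : ¬ C.card ≤ 8 * (D.votes (fun w => (r w : ℕ)) v).card := hacc
        omega
      have h3 : (8 : ℝ) * (L.filter fun e => r ∈ strictMin M (D.rivals l e) v).card ≤ C.card := by
        exact_mod_cast h2
      linarith
  have h1 : (L.card : ℝ) * (7 * P) ≤ 16 * a * (C.card * (D.good M l v d).card +
      S.card * (C.card / 8)) := by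
    calc (L.card : ℝ) * (7 * P) ≤ ∑ e ∈ L, 16 * a *
          ((S.filter fun r => r ∈ strictMin M (D.rivals l e) v).card : ℝ) := by
          rw [← nsmul_eq_mul]; exact Finset.card_nsmul_le_sum _ _ _ hlow
      _ = 16 * a * ∑ r ∈ S, ((L.filter fun e => r ∈ strictMin M (D.rivals l e) v).card : ℝ) := by
          rw [← Finset.mul_sum, hdouble]
      _ ≤ 16 * a * ∑ r ∈ S, ((if D.Accepted (fun w => (r w : ℕ)) v then (C.card : ℝ) else 0) +
          C.card / 8) := by gcongr with r hr; exact hupp r hr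
      _ = _ := by
          rw [Finset.sum_add_distrib, ← Finset.sum_filter, Finset.sum_const, Finset.sum_const,
            nsmul_eq_mul, nsmul_eq_mul, good]
          ring
  have h2 : a * S.card ≤ P := by
    rw [ha, hP]; exact_mod_cast card_mul_card_strictMin_le (M := M) (hmem d hd)
  have h3 : a * S.card * C.card ≤ P * C.card := by gcongr
  linarith

/-- Summation over `d`: the sets of darts with no more rivals have total size at least half the
square of the number of darts, and `7 / 32 - 1 / 8 = 3 / 32`. -/
theorem sum_card_good_ge (hl : ∀ w, D.lev w ≤ l) (hv : D.lev v = l)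
    (hM : 8 * Fintype.card V ≤ M) :
    3 * (M : ℝ) ^ Fintype.card V * (dartsIn U (D.star v)).card ≤
      32 * ∑ d ∈ dartsIn U (D.star v), ((D.rivals l d).card * (D.good M l v d).card : ℝ) := by
  have h1 := Finset.sum_le_sum fun d hd => card_mul_card_good_ge (d := d) hl hv hd hM
  set C := dartsIn U (D.star v) with hC
  rcases Nat.eq_zero_or_pos C.card with h0 | h0
  · rw [h0, Nat.cast_zero, mul_zero]
    exact mul_nonneg (by norm_num) (Finset.sum_nonneg fun _ _ =>
      mul_nonneg (Nat.cast_nonneg _) (Nat.cast_nonneg _))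
  have hC0 : (0 : ℝ) < C.card := by exact_mod_cast h0
  have h2 : (C.card : ℝ) ^ 2 ≤ 2 * ∑ d ∈ C, ((C.filter fun e =>
      (D.rivals l e).card ≤ (D.rivals l d).card).card : ℝ) := by
    have := card_sq_le_two_mul_sum_card_filter_le C fun d => (D.rivals l d).card
    have h := (Nat.cast_le (α := ℝ)).2 this
    rwa [Nat.cast_pow, Nat.cast_mul, Nat.cast_sum, Nat.cast_ofNat] at h
  rw [← Finset.mul_sum, ← Finset.mul_sum, Finset.sum_sub_distrib, ← Finset.mul_sum,
    Finset.sum_const, nsmul_eq_mul] at h1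
  have hP0 : 0 ≤ (M : ℝ) ^ Fintype.card V := by positivity
  have h3 := mul_le_mul_of_nonneg_left h2 hP0
  refine le_of_mul_le_mul_left ?_ hC0
  nlinarith

/-- In expectation, a constant fraction of the darts in the stars of highest level is covered. -/
theorem sum_card_uncovered_le (hl : ∀ w, D.lev w ≤ l) (hM : 8 * Fintype.card V ≤ M) :
    32 * ∑ r : V → Fin M, ∑ v with D.lev v = l,
      (dartsIn (D.nextU fun w => (r w : ℕ)) (D.star v)).card ≤
    29 * M ^ Fintype.card V * ∑ v with D.lev v = l, (dartsIn U (D.star v)).card := by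
  let T : Finset V := Finset.univ.filter fun v => D.lev v = l
  let N : (V → Fin M) → V → Finset (V × V) := fun r v =>
    (dartsIn U (D.star v)).filter fun d => D.Covered (fun w => (r w : ℕ)) d.1 d.2
  have hsplit : ∀ r v, (dartsIn (D.nextU fun w => (r w : ℕ)) (D.star v)).card + (N r v).card ≤
      (dartsIn U (D.star v)).card := by
    intro r v
    rw [← Finset.card_union_of_disjoint]
    · refine Finset.card_le_card (Finset.union_subset (fun d hd => ?_) (Finset.filter_subset _ _))
      rw [mem_dartsIn] at *
      exact ⟨hd.1, hd.2.1, hd.2.2.1⟩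
    · refine Finset.disjoint_left.2 fun d hd hd' => ?_
      exact (mem_dartsIn.1 hd).2.2.2.2 (Finset.mem_filter.1 hd').2
  let cov : (V → Fin M) → V × V → Prop := fun r d => D.Covered (fun w => (r w : ℕ)) d.1 d.2
  -- Exchanging the sums counts a dart once for each rival. The factor `(rivals l d).card` in
  -- `sum_card_good_ge` is therefore the number of stars in which `d` becomes covered.
  have hswap : ∀ F : V → V × V → ℝ, ∑ v ∈ T, ∑ d ∈ dartsIn U (D.star v), F v d =
      ∑ d ∈ dartsIn U Finset.univ, ∑ v ∈ D.rivals l d, F v d := by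
    intro F
    refine Finset.sum_comm' fun v d => ?_
    simp only [T, mem_dartsIn, mem_rivals, Finset.mem_filter, Finset.mem_univ, true_and]
    tauto
  have hcov : ∀ d ∈ dartsIn U Finset.univ, ∑ v ∈ D.rivals l d, ((D.good M l v d).card : ℝ) ≤
      ((Finset.univ.filter fun r => cov r d).card : ℝ) := by
    intro d hd
    have hgood : ∀ v ∈ D.rivals l d, ∀ r ∈ D.good M l v d,
        d ∈ D.votes (fun w => (r w : ℕ)) v ∧ D.Accepted (fun w => (r w : ℕ)) v := by
      intro v hv r hr
      obtain ⟨h1, h2⟩ := Finset.mem_filter.1 hr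
      obtain ⟨h3, h4, h5⟩ := mem_rivals.1 hv
      exact ⟨mem_votes_of_mem_strictMin hl h3 (mem_dartsIn.2 ⟨h4, h5, (mem_dartsIn.1 hd).2.2⟩) h1,
        h2⟩
    -- A dart votes only once, so these events exclude each other for different `v`, and their
    -- probabilities add up.
    have hdisj : (D.rivals l d : Set V).PairwiseDisjoint fun v => D.good M l v d := by
      intro v hv w hw hvw
      refine Finset.disjoint_left.2 fun r hr hr' => hvw ?_
      exact (mem_votes.1 (hgood v hv r hr).1).2.unique (mem_votes.1 (hgood w hw r hr').1).2
    rw [← Nat.cast_sum, ← Finset.card_biUnion hdisj]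
    refine Nat.cast_le.2 (Finset.card_le_card fun r hr => ?_)
    obtain ⟨v, hv, hr⟩ := Finset.mem_biUnion.1 hr
    obtain ⟨-, h4, h5⟩ := mem_rivals.1 hv
    exact Finset.mem_filter.2 ⟨Finset.mem_univ _, v, (hgood v hv r hr).2, h4, h5⟩
  have hmain : 3 * (M : ℝ) ^ Fintype.card V * ∑ v ∈ T, ((dartsIn U (D.star v)).card : ℝ) ≤
      32 * ∑ r : V → Fin M, ∑ v ∈ T, ((N r v).card : ℝ) := by
    calc 3 * (M : ℝ) ^ Fintype.card V * ∑ v ∈ T, ((dartsIn U (D.star v)).card : ℝ)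
        = ∑ v ∈ T, 3 * (M : ℝ) ^ Fintype.card V * ((dartsIn U (D.star v)).card : ℝ) :=
          Finset.mul_sum _ _ _
      _ ≤ ∑ v ∈ T, 32 * ∑ d ∈ dartsIn U (D.star v),
            ((D.rivals l d).card * (D.good M l v d).card : ℝ) :=
          Finset.sum_le_sum fun v hv => sum_card_good_ge hl (Finset.mem_filter.1 hv).2 hM
      _ = 32 * ∑ d ∈ dartsIn U Finset.univ, (D.rivals l d).card *
            ∑ v ∈ D.rivals l d, ((D.good M l v d).card : ℝ) := by
          rw [← Finset.mul_sum, hswap]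
          simp only [Finset.mul_sum]
      _ ≤ 32 * ∑ d ∈ dartsIn U Finset.univ, (D.rivals l d).card *
            ((Finset.univ.filter fun r => cov r d).card : ℝ) := by
          gcongr with d hd; exact hcov d hd
      _ = 32 * ∑ d ∈ dartsIn U Finset.univ, ∑ v ∈ D.rivals l d,
            ∑ r : V → Fin M, if cov r d then (1 : ℝ) else 0 := by
          simp only [Finset.sum_const, nsmul_eq_mul, Finset.card_filter, Nat.cast_sum,
            Nat.cast_ite, Nat.cast_one, Nat.cast_zero]
      _ = 32 * ∑ r : V → Fin M, ∑ v ∈ T, ((N r v).card : ℝ) := by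
          rw [← hswap, Finset.sum_comm (s := Finset.univ) (t := T)]
          congr 1
          refine Finset.sum_congr rfl fun v _ => ?_
          rw [Finset.sum_comm]
          refine Finset.sum_congr rfl fun r _ => ?_
          simp only [N, cov, Finset.card_filter, Nat.cast_sum, Nat.cast_ite, Nat.cast_one,
            Nat.cast_zero]
  have h1 : ∑ r : V → Fin M, ∑ v ∈ T, (dartsIn (D.nextU fun w => (r w : ℕ)) (D.star v)).card +
      ∑ r : V → Fin M, ∑ v ∈ T, (N r v).card ≤
      M ^ Fintype.card V * ∑ v ∈ T, (dartsIn U (D.star v)).card := by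
    rw [← Finset.sum_add_distrib]
    have : M ^ Fintype.card V = (Finset.univ : Finset (V → Fin M)).card := by simp
    rw [this, ← smul_eq_mul, ← Finset.sum_const]
    refine Finset.sum_le_sum fun r _ => ?_
    rw [← Finset.sum_add_distrib]
    exact Finset.sum_le_sum fun v _ => hsplit r v
  have h2 : 3 * M ^ Fintype.card V * ∑ v ∈ T, (dartsIn U (D.star v)).card ≤
      32 * ∑ r : V → Fin M, ∑ v ∈ T, (N r v).card := by exact_mod_cast hmain
  simp only [T] at h1 h2 ⊢
  linarith

end StarData

/-! ### The potential function -/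

section Potential

variable {V : Type*} [Fintype V]

/-- The total number of uncovered darts in the `2 ^ j`-cores. -/
noncomputable def phi (G U : SimpleGraph V) (j : ℕ) : ℕ :=
  ∑ v, (dartsIn U (starCore G U v (2 ^ j))).card

/-- The potential: the cores, weighted such that those of the highest level dominate. -/
noncomputable def psi (G U : SimpleGraph V) (J : ℕ) : ℕ :=
  ∑ j ∈ Finset.range J, (Fintype.card V ^ 3 + 1) ^ j * phi G U j

variable {G U U' : SimpleGraph V} {J : ℕ}

theorem phi_mono (h : U' ≤ U) (j : ℕ) : phi G U' j ≤ phi G U j := by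
  refine Finset.sum_le_sum fun v _ => Finset.card_le_card fun d hd => ?_
  rw [mem_dartsIn] at *
  exact ⟨starCore_mono h hd.1, starCore_mono h hd.2.1, h hd.2.2⟩

theorem phi_le (G U : SimpleGraph V) (j : ℕ) : phi G U j ≤ Fintype.card V ^ 3 := by
  have : ∀ v ∈ (Finset.univ : Finset V),
      (dartsIn U (starCore G U v (2 ^ j))).card ≤ Fintype.card V ^ 2 := fun v _ => by
    have := Finset.card_le_univ (dartsIn U (starCore G U v (2 ^ j)))
    rwa [Fintype.card_prod, ← sq] at this
  refine (Finset.sum_le_card_nsmul _ _ _ this).trans (le_of_eq ?_)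
  rw [Finset.card_univ, smul_eq_mul]; ring

/-- The values `phi` are at most `n ^ 3`, hence digits in base `n ^ 3 + 1`: all lower levels
together weigh less than a single dart at level `j`. -/
theorem sum_weight_mul_phi_lt (G U : SimpleGraph V) (j : ℕ) :
    ∑ i ∈ Finset.range j, (Fintype.card V ^ 3 + 1) ^ i * phi G U i <
      (Fintype.card V ^ 3 + 1) ^ j := by
  induction j with
  | zero => simp
  | succ j ih =>
    rw [Finset.sum_range_succ, pow_succ (Fintype.card V ^ 3 + 1), mul_add, mul_one, add_comm]
    exact add_lt_add_of_le_of_lt (Nat.mul_le_mul_left _ (phi_le G U j)) ih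

theorem psi_mono (h : U' ≤ U) : psi G U' J ≤ psi G U J :=
  Finset.sum_le_sum fun j _ => Nat.mul_le_mul_left _ (phi_mono h j)

theorem psi_le (G U : SimpleGraph V) (J : ℕ) : psi G U J ≤ (Fintype.card V ^ 3 + 1) ^ J :=
  (sum_weight_mul_phi_lt G U J).le

theorem not_adj_of_psi_eq_zero (hJ : 1 ≤ J) (h : psi G U J = 0) {a b w : V} (hab : U.Adj a b)
    (ha : G.Adj a w) (hb : G.Adj b w) : False := by
  have h1 := (Finset.sum_eq_zero_iff.1 h) 0 (Finset.mem_range.2 hJ)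
  rw [pow_zero, one_mul] at h1
  have h2 := Finset.sum_eq_zero_iff.1 h1 w (Finset.mem_univ w)
  rw [Finset.card_eq_zero, pow_zero] at h2
  have : (a, b) ∈ dartsIn U (starCore G U w 1) := mem_dartsIn.2
    ⟨mem_starCore_one ha.symm hb.symm hab, mem_starCore_one hb.symm ha.symm hab.symm, hab⟩
  rw [h2] at this
  simp at this

-- Let `j` be the highest exponent present. Levels above contribute nothing, the term of level `j`
-- keeps at most 29/32 in expectation, and the lower terms do not grow and weigh less than `W ^ j ≤
-- W ^ j * phi G U j`. Spreading the gain of 3/32 over both parts leaves the factor 31/32.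
open StarData in
theorem psi_step [LinearOrder V] (D : StarData G U) (hU : U ≤ G)
    (hJ : ∀ v, starCore G G v (2 ^ J) = ∅) {M : ℕ} (hM : 8 * Fintype.card V ≤ M) :
    32 * ∑ r : V → Fin M, psi G (D.nextU fun w => (r w : ℕ)) J ≤
      31 * M ^ Fintype.card V * psi G U J := by
  have hcard : (Finset.univ : Finset (V → Fin M)).card = M ^ Fintype.card V := by simp
  by_cases htop : ∃ v, D.lev v ≠ 0
  swap
  · push Not at htop
    have hz : psi G U J = 0 := by
      refine Finset.sum_eq_zero fun j _ => ?_
      rw [phi, Finset.sum_eq_zero, mul_zero]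
      intro v _
      rcases D.spec v with ⟨-, -, h⟩ | ⟨j, h, -⟩
      · have : starCore G U v (2 ^ j) = ∅ :=
          Finset.subset_empty.1 ((starCore_anti Nat.one_le_two_pow).trans h.subset)
        simp [this, dartsIn]
      · have := htop v
        simp [h] at this
    rw [hz, Finset.sum_eq_zero]
    · simp
    · intro r _
      exact Nat.le_zero.1 (hz ▸ psi_mono (D.nextU_le _))
  obtain ⟨v₁, hv₁⟩ := htop
  have : Nonempty V := ⟨v₁⟩
  obtain ⟨v₀, hv₀⟩ := D.exists_max_lev
  obtain ⟨j, hj1, hj2, hj3, -⟩ := (D.spec v₀).resolve_left fun h => by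
    have := hv₀ v₁; omega
  have hjJ : j < J := by
    by_contra h
    obtain ⟨a, ha⟩ := hj3
    rw [hj2] at ha
    have := starCore_anti (Nat.pow_le_pow_right (by norm_num) (not_lt.1 h)) (starCore_mono hU ha)
    simp [hJ] at this
  rw [hj1] at hv₀
  have hstar : ∀ v, D.lev v = 2 ^ j → D.star v = starCore G U v (2 ^ j) := by
    intro v hv
    rcases D.spec v with ⟨h, -⟩ | ⟨i, h1, h2, -⟩
    · rw [hv] at h; simp at h
    · rw [h2, ← h1, hv]
  have hnot : ∀ v, D.lev v ≠ 2 ^ j → starCore G U v (2 ^ j) = ∅ := by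
    intro v hv
    rcases D.spec v with ⟨-, -, h⟩ | ⟨i, h1, -, -, h2⟩
    · exact Finset.subset_empty.1 ((starCore_anti Nat.one_le_two_pow).trans h.subset)
    · have hlt : 2 ^ i < 2 ^ j := lt_of_le_of_ne (h1 ▸ hv₀ v) (h1 ▸ hv)
      have : i + 1 ≤ j := (Nat.pow_lt_pow_iff_right (by norm_num)).1 hlt
      exact Finset.subset_empty.1
        ((starCore_anti (Nat.pow_le_pow_right (by norm_num) this)).trans h2.subset)
  have habove : ∀ i, j < i → phi G U i = 0 := by
    intro i hi
    refine Finset.sum_eq_zero fun v _ => ?_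
    have : starCore G U v (2 ^ i) = ∅ := by
      refine Finset.subset_empty.1
        ((starCore_anti (Nat.pow_le_pow_right (by norm_num) hi)).trans ?_)
      rcases D.spec v with ⟨-, -, h⟩ | ⟨k, h1, -, -, h2⟩
      · exact (starCore_anti Nat.one_le_two_pow).trans h.subset
      · have : k ≤ j := (Nat.pow_le_pow_iff_right (a := 2) (by norm_num)).1 (h1 ▸ hv₀ v)
        exact (starCore_anti (Nat.pow_le_pow_right (by norm_num) (by omega))).trans h2.subset
    simp [this, dartsIn]
  have hphi : phi G U j = ∑ v with D.lev v = 2 ^ j, (dartsIn U (D.star v)).card := by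
    rw [Finset.sum_filter]
    refine Finset.sum_congr rfl fun v _ => ?_
    split_ifs with h
    · rw [hstar v h]
    · rw [hnot v h]; simp [dartsIn]
  have hphi' : ∀ r : V → ℕ, phi G (D.nextU r) j ≤
      ∑ v with D.lev v = 2 ^ j, (dartsIn (D.nextU r) (D.star v)).card := by
    intro r
    rw [Finset.sum_filter]
    refine Finset.sum_le_sum fun v _ => ?_
    have hm := starCore_mono (G := G) (v := v) (t := 2 ^ j) (D.nextU_le r)
    split_ifs with h
    · rw [hstar v h]; exact Finset.card_le_card (dartsIn_mono hm)
    · rw [hnot v h] at hm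
      rw [Finset.subset_empty.1 hm]; simp [dartsIn]
  have hpos : 1 ≤ phi G U j := by
    rw [hphi]
    refine le_trans ?_ (Finset.single_le_sum (f := fun v => (dartsIn U (D.star v)).card)
      (fun _ _ => Nat.zero_le _) (Finset.mem_filter.2 ⟨Finset.mem_univ v₀, hj1⟩))
    exact Finset.card_pos.2 (D.star_nonempty (by simp [hj1]))
  set W := Fintype.card V ^ 3 + 1 with hW
  set P := M ^ Fintype.card V with hP
  set low := ∑ i ∈ Finset.range j, W ^ i * phi G U i with hlow
  have hlow_lt : low < W ^ j := sum_weight_mul_phi_lt G U j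
  have hsplit : ∀ U'', U'' ≤ U → psi G U'' J =
      ∑ i ∈ Finset.range j, W ^ i * phi G U'' i + W ^ j * phi G U'' j := by
    intro U'' h
    rw [← Finset.sum_range_succ, psi]
    refine (Finset.sum_subset (Finset.range_mono hjJ) fun i _ hi => ?_).symm
    rw [Finset.mem_range, not_lt] at hi
    rw [Nat.le_zero.1 ((phi_mono h i).trans (habove i (by omega)).le), mul_zero]
  have hnext : ∀ r : V → Fin M, psi G (D.nextU fun w => (r w : ℕ)) J ≤
      low + W ^ j * ∑ v with D.lev v = 2 ^ j,
        (dartsIn (D.nextU fun w => (r w : ℕ)) (D.star v)).card := by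
    intro r
    rw [hsplit _ (D.nextU_le _)]
    exact add_le_add (Finset.sum_le_sum fun i _ => Nat.mul_le_mul_left _
      (phi_mono (D.nextU_le _) i)) (Nat.mul_le_mul_left _ (hphi' _))
  have h1 := Finset.sum_le_sum fun r (_ : r ∈ Finset.univ) => hnext r
  rw [Finset.sum_add_distrib, Finset.sum_const, hcard, smul_eq_mul, ← Finset.mul_sum] at h1
  have h2 := Nat.mul_le_mul_left (W ^ j) (sum_card_uncovered_le hv₀ hM)
  rw [← hphi] at h2
  rw [hsplit U le_rfl]
  have h3 : P * low ≤ P * (W ^ j * phi G U j) :=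
    Nat.mul_le_mul_left _ (hlow_lt.le.trans (Nat.le_mul_of_pos_right _ hpos))
  have h4 : W ^ j * (29 * P * phi G U j) = 29 * (P * (W ^ j * phi G U j)) := by ring
  rw [h4, Nat.mul_left_comm] at h2
  have h5 : 31 * P * (low + W ^ j * phi G U j) =
      31 * (P * low) + 31 * (P * (W ^ j * phi G U j)) := by ring
  rw [← hlow, h5]
  generalize P * (W ^ j * phi G U j) = X at h2 h3 ⊢
  generalize P * low = Y at h1 h3 ⊢
  refine (Nat.mul_le_mul_left 32 h1).trans ?_
  rw [mul_add]
  refine (Nat.add_le_add_left h2 _).trans ?_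
  omega

open StarData in
theorem nextU_eq_bot_of_psi_eq_zero [LinearOrder V] (D : StarData G U) (r : V → ℕ) (hJ : 1 ≤ J)
    (h : psi G U J = 0) : D.nextU r = ⊥ := by
  ext a b
  refine ⟨fun hab => ?_, fun h => h.elim⟩
  obtain ⟨h1, ⟨w, h2, h3⟩, -⟩ := hab
  exact not_adj_of_psi_eq_zero hJ h h1 h2 h3

end Potential

/-! ### Correctness of the core computation -/

/-- As long as `F` changes the list it shortens it, so as many rounds as the list is long reach a
fixed point. -/
theorem iterate_fixed_of_sublist {α : Type*} {F : List α → List α} (hF : ∀ l, (F l).Sublist l) :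
    ∀ (n : ℕ) (l : List α), l.length ≤ n → F (F^[n] l) = F^[n] l := by
  intro n
  induction n with
  | zero =>
    intro l hl
    rw [List.length_eq_zero_iff.1 (Nat.le_zero.1 hl)]
    exact List.sublist_nil.1 (hF [])
  | succ n ih =>
    intro l hl
    rw [Function.iterate_succ_apply]
    by_cases h : F l = l
    · rw [h, Function.iterate_fixed h, h]
    · refine ih _ ?_
      by_contra h'
      exact h ((hF l).eq_of_length_le (by omega))

theorem iterate_sublist {α : Type*} {F : List α → List α} (hF : ∀ l, (F l).Sublist l) (n : ℕ)
    (l : List α) : (F^[n] l).Sublist l := by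
  induction n with
  | zero => exact List.Sublist.refl l
  | succ n ih => rw [Function.iterate_succ_apply']; exact (hF _).trans ih

section

open scoped Classical

/-- The `2 ^ n`-core on `n` vertices is empty; the level is read off from the least exponent whose
core is empty. -/
theorem exists_starData {V : Type*} [Fintype V] (G U : SimpleGraph V) :
    Nonempty (StarData G U) := by
  have key : ∀ v, ∃ p : ℕ × Finset V, (p.1 = 0 ∧ p.2 = ∅ ∧ starCore G U v 1 = ∅) ∨
      ∃ j, p.1 = 2 ^ j ∧ p.2 = starCore G U v (2 ^ j) ∧ p.2.Nonempty ∧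
        starCore G U v (2 ^ (j + 1)) = ∅ := by
    intro v
    have hex : ∃ j, starCore G U v (2 ^ j) = ∅ := by
      refine ⟨Fintype.card V, Finset.not_nonempty_iff_eq_empty.1 fun h => ?_⟩
      have h1 := lt_card_starCore h
      have h2 := (starCore G U v (2 ^ Fintype.card V)).card_le_univ
      have h3 := Nat.lt_two_pow_self (n := Fintype.card V)
      omega
    rcases Nat.eq_zero_or_pos (Nat.find hex) with h0 | h0
    · have := Nat.find_spec hex
      rw [h0, pow_zero] at this
      exact ⟨(0, ∅), .inl ⟨rfl, rfl, this⟩⟩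
    · obtain ⟨j, hj⟩ := Nat.exists_eq_add_of_lt h0
      rw [zero_add] at hj
      have h1 := Nat.find_spec hex
      rw [hj] at h1
      exact ⟨(2 ^ j, starCore G U v (2 ^ j)), .inr ⟨j, rfl, rfl,
        Finset.nonempty_iff_ne_empty.2 (Nat.find_min hex (by omega)), h1⟩⟩
  choose p hp using key
  exact ⟨⟨fun v => (p v).1, fun v => (p v).2, hp⟩⟩

variable {V : Finset ℕ} {G U : SimpleGraph V}

/-- Peeling, on the level of vertices. -/
noncomputable def peelVertices (U : SimpleGraph V) (t : ℕ) (L : List V) : List V :=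
  L.filter fun u => decide (t ≤ (L.filter fun w => decide (U.Adj u w)).length)

variable {f : V → List ℕ} {v : V} {L : List V}

theorem length_filter_map {K : List V} {u : V} (hf : ∀ u ∈ L, ∀ b : V, (b : ℕ) ∈ f u ↔ U.Adj u b)
    (hu : u ∈ L) : ((K.map fun u : V => ((u : ℕ), f u)).filter fun q => decide (q.1 ∈ f u)).length =
      (K.filter fun w => decide (U.Adj u w)).length := by
  rw [List.filter_map, List.length_map]
  congr 2
  funext w
  simp [hf u hu]

theorem peel_map (t : ℕ) {K : List V} (hf : ∀ u ∈ L, ∀ b : V, (b : ℕ) ∈ f u ↔ U.Adj u b)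
    (hK : K ⊆ L) : peel t (K.map fun u : V => ((u : ℕ), f u)) =
      (peelVertices U t K).map fun u : V => ((u : ℕ), f u) := by
  rw [peel, List.filter_map, peelVertices]
  congr 1
  refine List.filter_congr fun u hu => ?_
  simp only [Function.comp_apply, length_filter_map hf (hK hu)]

theorem peelVertices_sublist (t : ℕ) (K : List V) : (peelVertices U t K).Sublist K :=
  List.filter_sublist

theorem coreList_map (t : ℕ) (hf : ∀ u ∈ L, ∀ b : V, (b : ℕ) ∈ f u ↔ U.Adj u b) :
    coreList t (L.map fun u : V => ((u : ℕ), f u)) =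
      ((peelVertices U t)^[L.length] L).map fun u : V => ((u : ℕ), f u) := by
  rw [coreList, List.length_map]
  generalize L.length = n
  induction n with
  | zero => rfl
  | succ n ih =>
    rw [Function.iterate_succ_apply', ih, Function.iterate_succ_apply', peel_map t hf]
    exact (iterate_sublist (peelVertices_sublist t) n L).subset

theorem length_filter_eq_card {α : Type*} [DecidableEq α] {K : List α} (hK : K.Nodup) (P : α → Prop) :
    (K.filter fun w => decide (P w)).length = (K.toFinset.filter P).card := by
  rw [← List.toFinset_card_of_nodup (hK.filter _), List.toFinset_filter]
  congr 1
  ext; simp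

/-- Peeling never removes a core vertex, and its fixed point has minimum degree `t`. The list may
omit neighbours without uncovered edges, such as halted ones: for `t ≥ 1` they lie in no core. -/
theorem toFinset_peelVertices {t : ℕ} (ht : 1 ≤ t) (hL : L.Nodup) (hLv : ∀ u ∈ L, G.Adj v u)
    (hLU : ∀ u b, G.Adj v u → U.Adj u b → u ∈ L) :
    ((peelVertices U t)^[L.length] L).toFinset = starCore G U v t := by
  have hsub := fun n => iterate_sublist (peelVertices_sublist (U := U) t) n L
  refine Finset.Subset.antisymm ?_ ?_
  · have hfix := iterate_fixed_of_sublist (peelVertices_sublist (U := U) t) L.length L le_rfl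
    set K := (peelVertices U t)^[L.length] L with hK
    refine subset_starCore (fun b hb => hLv b ((hsub _).subset (List.mem_toFinset.1 hb))) ?_
    intro b hb
    rw [List.mem_toFinset, ← hfix, peelVertices, List.mem_filter, decide_eq_true_iff,
      length_filter_eq_card (hL.sublist (hsub _))] at hb
    exact hb.2
  · generalize L.length = n
    induction n with
    | zero =>
      intro a ha
      have h1 := ht.trans (le_degree_starCore ha)
      obtain ⟨b, hb⟩ := Finset.card_pos.1 h1
      exact List.mem_toFinset.2 (hLU a b (adj_of_mem_starCore ha) (Finset.mem_filter.1 hb).2)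
    | succ n ih =>
      intro a ha
      rw [Function.iterate_succ_apply', List.mem_toFinset, peelVertices, List.mem_filter,
        decide_eq_true_iff, length_filter_eq_card (hL.sublist (hsub _))]
      exact ⟨List.mem_toFinset.1 (ih ha), (le_degree_starCore ha).trans
        (Finset.card_le_card (Finset.filter_subset_filter _ ih))⟩

/-- After a failed step the state no longer changes. So either every step so far succeeded, or the
next core is known to be empty. -/
theorem bestCore_inv (l : List (ℕ × List ℕ)) (i : ℕ) :
    ((bestStep l)^[i] (0, []) = (0, []) ∧ (i = 0 ∨ coreList 1 l = [])) ∨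
    ∃ j, (bestStep l)^[i] (0, []) = (2 ^ j, coreList (2 ^ j) l) ∧ coreList (2 ^ j) l ≠ [] ∧
      (j + 1 = i ∨ coreList (2 ^ (j + 1)) l = []) := by
  induction i with
  | zero => exact .inl ⟨rfl, .inl rfl⟩
  | succ i ih =>
    rw [Function.iterate_succ_apply']
    rcases ih with ⟨h1, h2⟩ | ⟨j, h1, h2, h3⟩
    · rw [h1, bestStep]
      by_cases h : coreList 1 l = []
      · exact .inl ⟨by simp [h], .inr h⟩
      · refine .inr ⟨0, by simp [h], by simpa using h, .inl ?_⟩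
        rcases h2 with h2 | h2
        · omega
        · exact absurd h2 h
    · rw [h1, bestStep]
      have hmax : max 1 (2 * 2 ^ j) = 2 ^ (j + 1) := by
        rw [← pow_succ', max_eq_right Nat.one_le_two_pow]
      rw [hmax]
      by_cases h : coreList (2 ^ (j + 1)) l = []
      · exact .inr ⟨j, by simp [h], h2, .inr h⟩
      · refine .inr ⟨j + 1, by simp [h], h, .inl ?_⟩
        rcases h3 with h3 | h3
        · omega
        · exact absurd h3 h

/-- The search finds the level and the star of a vertex. -/
theorem bestCore_spec (D : StarData G U) (hf : ∀ u ∈ L, ∀ b : V, (b : ℕ) ∈ f u ↔ U.Adj u b)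
    (hL : L.Nodup) (hLv : ∀ u ∈ L, G.Adj v u) (hLU : ∀ u b, G.Adj v u → U.Adj u b → u ∈ L) :
    (bestCore (L.map fun u : V => ((u : ℕ), f u))).1 = D.lev v ∧ ∃ K : List V,
      (bestCore (L.map fun u : V => ((u : ℕ), f u))).2 = K.map (fun u : V => ((u : ℕ), f u)) ∧
      K.Sublist L ∧ K.toFinset = D.star v := by
  set l := L.map fun u : V => ((u : ℕ), f u) with hl
  have hlen : l.length = L.length := List.length_map _
  have hcore : ∀ t, 1 ≤ t → (coreList t l = [] ↔ starCore G U v t = ∅) := by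
    intro t ht
    rw [hl, coreList_map t hf, ← toFinset_peelVertices ht hL hLv hLU, List.map_eq_nil_iff,
      List.toFinset_eq_empty_iff]
  rcases bestCore_inv l l.length with ⟨h1, h2⟩ | ⟨j, h1, h2, h3⟩
  · have hc : starCore G U v 1 = ∅ := by
      rw [← hcore 1 le_rfl]
      rcases h2 with h2 | h2
      · rw [coreList, h2, List.length_eq_zero_iff.1 h2]; rfl
      · exact h2
    have hD : D.lev v = 0 ∧ D.star v = ∅ := by
      rcases D.spec v with ⟨h4, h5, -⟩ | ⟨j, -, h4, h5, -⟩
      · exact ⟨h4, h5⟩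
      · rw [h4, Finset.subset_empty.1 ((starCore_anti Nat.one_le_two_pow).trans hc.subset)] at h5
        simp at h5
    rw [bestCore, h1]
    exact ⟨hD.1.symm, [], rfl, List.nil_sublist _, by simp [hD.2]⟩
  · have hne : (starCore G U v (2 ^ j)).Nonempty := by
      rw [Finset.nonempty_iff_ne_empty, Ne, ← hcore _ Nat.one_le_two_pow]
      exact h2
    -- If every step succeeded, `2 ^ (j + 1)` exceeds the number of entries, which is too few for a
    -- nonempty core.
    have hnext : starCore G U v (2 ^ (j + 1)) = ∅ := by
      rcases h3 with h3 | h3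
      · refine Finset.not_nonempty_iff_eq_empty.1 fun h => ?_
        have h4 := lt_card_starCore h
        rw [← toFinset_peelVertices Nat.one_le_two_pow hL hLv hLU] at h4
        have h5 := List.toFinset_card_le ((peelVertices U (2 ^ (j + 1)))^[L.length] L)
        have h6 := (iterate_sublist (peelVertices_sublist (U := U) (2 ^ (j + 1)))
          L.length L).length_le
        have h7 := Nat.lt_two_pow_self (n := j + 1)
        omega
      · exact (hcore _ Nat.one_le_two_pow).1 h3
    have hD : D.lev v = 2 ^ j ∧ D.star v = starCore G U v (2 ^ j) := by
      rcases D.spec v with ⟨-, -, h4⟩ | ⟨i, h4, h5, h6, h7⟩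
      · rw [Finset.subset_empty.1 ((starCore_anti Nat.one_le_two_pow).trans h4.subset)] at hne
        simp at hne
      · have : i = j := by
          rw [h5] at h6
          by_contra hij
          rcases lt_or_gt_of_ne hij with h | h
          · obtain ⟨a, ha⟩ := hne
            have := starCore_anti (Nat.pow_le_pow_right (n := 2) (by norm_num) h) ha
            simp [h7] at this
          · obtain ⟨a, ha⟩ := h6
            have := starCore_anti (Nat.pow_le_pow_right (n := 2) (by norm_num) h) ha
            simp [hnext] at this
        subst this
        exact ⟨h4, h5⟩
    rw [bestCore, h1, hD.1, hD.2]
    exact ⟨rfl, _, coreList_map _ hf, iterate_sublist (peelVertices_sublist _) _ _,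
      toFinset_peelVertices Nat.one_le_two_pow hL hLv hLU⟩

theorem dartCount_map {K : List V} (hf : ∀ u ∈ K, ∀ b : V, (b : ℕ) ∈ f u ↔ U.Adj u b)
    (hK : K.Nodup) :
    dartCount (K.map fun u : V => ((u : ℕ), f u)) = (dartsIn U K.toFinset).card := by
  rw [dartCount, List.map_map, card_dartsIn, List.sum_toFinset _ hK]
  congr 1
  refine List.map_congr_left fun u hu => ?_
  rw [Function.comp_apply, length_filter_map hf hu, length_filter_eq_card hK]

end

/-! ### The rounds carry out the abstract iteration -/

open LocalAlgorithm (neighborList)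

namespace StarData

variable {V : Type*} [Fintype V] {G U : SimpleGraph V} {D : StarData G U}

variable (D) in
/-- The vertices that take part in an iteration. -/
def Active (v : V) : Prop := (∃ b, U.Adj v b) ∨ D.lev v ≠ 0

theorem active_of_mem_star {v a : V} (h : a ∈ D.star v) : D.Active v :=
  .inr (D.lev_ne_zero_of_mem h)

open scoped Classical in
variable (D) in
/-- The number of uncovered edges at `a` that vote for `w`. -/
noncomputable def votesAt [LinearOrder V] (r : V → ℕ) (a w : V) : ℕ :=
  (Finset.univ.filter fun b => U.Adj a b ∧ D.VotesFor r a b w).card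

theorem card_votes_eq_sum [LinearOrder V] {r : V → ℕ} (w : V) :
    (D.votes r w).card = ∑ a, D.votesAt r a w := by
  classical
  rw [votes, Finset.card_filter, Fintype.sum_prod_type]
  refine Finset.sum_congr rfl fun a _ => ?_
  rw [votesAt, Finset.card_filter]

variable (D) in
/-- The outputs after the iteration. -/
def nextOut [LinearOrder V] (r : V → ℕ) (O : V → V → Prop) (v b : V) : Prop :=
  (O v b ∨ (D.Accepted r v ∧ b ∈ D.star v)) ∨ (U.Adj v b ∧ ¬ ∃ w, G.Adj v w ∧ G.Adj b w)

end StarData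

section Simulation

variable {V : Finset ℕ} (G : SimpleGraph V) [DecidableRel G.Adj]

theorem mem_neighborList {v u : V} : u ∈ neighborList G v ↔ G.Adj v u := by
  simp [neighborList]

theorem nodup_neighborList (v : V) : (neighborList G v).Nodup := Finset.sort_nodup _ _

/-- The messages that `v` receives when the vertices send their states. -/
def inboxOf (c : V → St) (v : V) : List (ℕ × St) :=
  ((neighborList G v).filter fun u => !(stFin (c u))).map fun u : V => ((u : ℕ), c u)

/-- A round with the outcomes `ρ` of the coin flips. -/
def stepWith (c : V → St) (ρ : V → ℕ) : V → St := fun v =>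
  if stFin (c v) = true then c v else updateSt (c v) (ρ v) (inboxOf G c v)

open scoped Classical in
/-- The list of the neighbours of `v` that satisfy `P`. -/
noncomputable def nbrIds (v : V) (P : V → Prop) : List ℕ :=
  ((neighborList G v).filter fun u => decide (P u)).map fun u : V => (u : ℕ)

variable {G}

theorem mem_inboxOf {c : V → St} {v : V} {m : ℕ × St} :
    m ∈ inboxOf G c v ↔ ∃ u : V, G.Adj v u ∧ stFin (c u) = false ∧ m = ((u : ℕ), c u) := by
  simp only [inboxOf, List.mem_map, List.mem_filter, mem_neighborList, Bool.not_eq_true']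
  constructor
  · rintro ⟨u, ⟨h1, h2⟩, rfl⟩; exact ⟨u, h1, h2, rfl⟩
  · rintro ⟨u, h1, h2, rfl⟩; exact ⟨u, ⟨h1, h2⟩, rfl⟩

theorem any_inboxOf {c : V → St} {v : V} {P : ℕ × St → Bool} :
    (inboxOf G c v).any P = true ↔
      ∃ u : V, G.Adj v u ∧ stFin (c u) = false ∧ P ((u : ℕ), c u) = true := by
  rw [List.any_eq_true]
  constructor
  · rintro ⟨m, h1, h2⟩
    obtain ⟨u, h3, h4, rfl⟩ := mem_inboxOf.1 h1
    exact ⟨u, h3, h4, h2⟩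
  · rintro ⟨u, h1, h2, h3⟩
    exact ⟨_, mem_inboxOf.2 ⟨u, h1, h2, rfl⟩, h3⟩

theorem mem_nbrIds {v b : V} {P : V → Prop} : (b : ℕ) ∈ nbrIds G v P ↔ G.Adj v b ∧ P b := by
  classical
  simp only [nbrIds, List.mem_map, List.mem_filter, mem_neighborList, decide_eq_true_iff]
  constructor
  · rintro ⟨u, h, h'⟩; rwa [← Subtype.ext h']
  · intro h; exact ⟨b, h, rfl⟩

theorem nbrIds_congr {v : V} {P Q : V → Prop} (h : ∀ b, G.Adj v b → (P b ↔ Q b)) :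
    nbrIds G v P = nbrIds G v Q := by
  classical
  rw [nbrIds, nbrIds]
  congr 1
  refine List.filter_congr fun u hu => ?_
  rw [decide_eq_decide]
  exact h u ((mem_neighborList G).1 hu)

theorem filter_nbrIds {v : V} {P Q : V → Prop} {R : ℕ → Bool}
    (h : ∀ b, G.Adj v b → P b → (R b = true ↔ Q b)) :
    (nbrIds G v P).filter R = nbrIds G v fun b => P b ∧ Q b := by
  classical
  rw [nbrIds, nbrIds, List.filter_map, List.filter_filter]
  congr 1
  refine List.filter_congr fun u hu => ?_
  rw [Bool.eq_iff_iff]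
  simp only [Function.comp_apply, Bool.and_eq_true, decide_eq_true_iff]
  have := h u ((mem_neighborList G).1 hu)
  tauto

open scoped Classical in
theorem length_nbrIds {v : V} {P : V → Prop} :
    (nbrIds G v P).length = (Finset.univ.filter fun b => G.Adj v b ∧ P b).card := by
  rw [nbrIds, List.length_map, length_filter_eq_card (nodup_neighborList G v)]
  congr 1
  ext b
  simp [mem_neighborList]

theorem nbrIds_eq_nil {v : V} {P : V → Prop} :
    nbrIds G v P = [] ↔ ∀ b, G.Adj v b → ¬ P b := by
  classical
  rw [nbrIds, List.map_eq_nil_iff, List.filter_eq_nil_iff]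
  simp [mem_neighborList]

variable (G) in
/-- `c` is a configuration at the start of an iteration, with the uncovered edges `U` and the
outputs `O`. -/
structure StartConfig (U : SimpleGraph V) (O : V → V → Prop) (N : ℕ) (c : V → St) : Prop where
  le : U ≤ G
  stat : ∀ v, stStat (c v) = ((v : ℕ), (Nat.size N + 3, nbrIds G v fun _ => True))
  unc : ∀ v, stUnc (c v) = nbrIds G v (U.Adj v)
  out : ∀ v, stOut (c v) = nbrIds G v (O v)
  phase : ∀ v, stFin (c v) = false → stPhase (c v) = 0
  fin : ∀ v, stFin (c v) = true → (∀ b, ¬ U.Adj v b) ∧ ∀ a b, G.Adj v a → G.Adj v b → ¬ U.Adj a b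

variable {U : SimpleGraph V}

variable (G) in
/-- What all vertices know after the first round of an iteration. -/
structure KnowsStars (U : SimpleGraph V) (O : V → V → Prop) (N : ℕ) (D : StarData G U)
    (c : V → St) : Prop where
  le : U ≤ G
  stat : ∀ v, stStat (c v) = ((v : ℕ), (Nat.size N + 3, nbrIds G v fun _ => True))
  unc : ∀ v, stUnc (c v) = nbrIds G v (U.Adj v)
  out : ∀ v, stOut (c v) = nbrIds G v (O v)
  fin : ∀ v, stFin (c v) = false ↔ D.Active v

variable (G) in
/-- What the active vertices know after the first round of an iteration. -/
structure StarConfig (U : SimpleGraph V) (O : V → V → Prop) (N : ℕ) (D : StarData G U) (r : V → ℕ)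
    (phase : ℕ) (c : V → St) : Prop extends KnowsStars G U O N D c where
  phase_eq : ∀ v, D.Active v → stPhase (c v) = phase
  rank : ∀ v, D.Active v → stRank (c v) = r v
  lev : ∀ v, D.Active v → stLev (c v) = D.lev v
  star : ∀ v, D.Active v → ∀ a : V, (a : ℕ) ∈ stStar (c v) ↔ a ∈ D.star v
  deg : ∀ v, D.Active v → stDeg (c v) = (dartsIn U (D.star v)).card

section Accessors

variable (stat : ℕ × (ℕ × List ℕ)) (phase : ℕ) (fin : Bool) (unc out : List ℕ) (rank lev : ℕ)
    (star : List ℕ) (deg : ℕ) (votes : List (ℕ × ℕ))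

@[simp] theorem stStat_mkSt :
    stStat (mkSt stat phase fin unc out rank lev star deg votes) = stat := rfl
@[simp] theorem stPhase_mkSt :
    stPhase (mkSt stat phase fin unc out rank lev star deg votes) = phase := rfl
@[simp] theorem stFin_mkSt :
    stFin (mkSt stat phase fin unc out rank lev star deg votes) = fin := rfl
@[simp] theorem stUnc_mkSt :
    stUnc (mkSt stat phase fin unc out rank lev star deg votes) = unc := rfl
@[simp] theorem stOut_mkSt :
    stOut (mkSt stat phase fin unc out rank lev star deg votes) = out := rfl
@[simp] theorem stRank_mkSt :
    stRank (mkSt stat phase fin unc out rank lev star deg votes) = rank := rfl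
@[simp] theorem stLev_mkSt :
    stLev (mkSt stat phase fin unc out rank lev star deg votes) = lev := rfl
@[simp] theorem stStar_mkSt :
    stStar (mkSt stat phase fin unc out rank lev star deg votes) = star := rfl
@[simp] theorem stDeg_mkSt :
    stDeg (mkSt stat phase fin unc out rank lev star deg votes) = deg := rfl
@[simp] theorem stVotes_mkSt :
    stVotes (mkSt stat phase fin unc out rank lev star deg votes) = votes := rfl

end Accessors

theorem stMe_eq {s : St} {n k : ℕ} {l : List ℕ} (h : stStat s = (n, (k, l))) : stMe s = n :=
  congrArg (fun p : ℕ × (ℕ × List ℕ) => p.1) h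

theorem stNbr_eq {s : St} {n k : ℕ} {l : List ℕ} (h : stStat s = (n, (k, l))) : stNbr s = l :=
  congrArg (fun p : ℕ × (ℕ × List ℕ) => p.2.2) h

/-- A halted vertex has no uncovered edge at it or among its neighbours. It therefore lies in no
star and has level 0, and its silence does not affect the cores computed by others. -/
theorem StartConfig.step {O : V → V → Prop} {N : ℕ} {c : V → St} (h : StartConfig G U O N c)
    (D : StarData G U) (r : V → ℕ) : StarConfig G U O N D r 1 (stepWith G c r) := by
  classical
  have halive : ∀ v, stFin (c v) = true → ¬ D.Active v := by
    rintro v hv (⟨b, hb⟩ | hl)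
    · exact (h.fin v hv).1 b hb
    · obtain ⟨d, hd⟩ := D.star_nonempty hl
      obtain ⟨h1, h2, h3⟩ := mem_dartsIn.1 hd
      exact (h.fin v hv).2 _ _ (D.adj_of_mem_star h1) (D.adj_of_mem_star h2) h3
  have hspec : ∀ v, (bestCore (adjOf (inboxOf G c v))).1 = D.lev v ∧ ∃ K : List V,
      (bestCore (adjOf (inboxOf G c v))).2 = K.map (fun u : V => ((u : ℕ), stUnc (c u))) ∧
      K.Nodup ∧ K.toFinset = D.star v := by
    intro v
    have hadj : adjOf (inboxOf G c v) = ((neighborList G v).filter fun u => !(stFin (c u))).map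
        fun u : V => ((u : ℕ), stUnc (c u)) := by
      rw [adjOf, inboxOf, List.map_map]; rfl
    have hnd := (nodup_neighborList G v).filter fun u => !(stFin (c u))
    obtain ⟨h1, K, h2, h3, h4⟩ := bestCore_spec (v := v) (f := fun u => stUnc (c u)) D
      (L := (neighborList G v).filter fun u => !(stFin (c u)))
      (fun u _ b => by
        rw [h.unc, mem_nbrIds]
        exact ⟨fun h => h.2, fun h' => ⟨h.le h', h'⟩⟩)
      hnd (fun u hu => (mem_neighborList G).1 (List.mem_filter.1 hu).1)
      (fun u b hu hb => List.mem_filter.2 ⟨(mem_neighborList G).2 hu, by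
        rw [Bool.not_eq_true', ← Bool.not_eq_true]
        exact fun h' => (h.fin u h').1 b hb⟩)
    rw [hadj]
    exact ⟨h1, K, h2, hnd.sublist h3, h4⟩
  have hstep : ∀ v, stFin (c v) = false →
      stepWith G c r v = starStep (c v) (r v) (inboxOf G c v) := by
    intro v hv
    simp [stepWith, hv, updateSt, h.phase v hv]
  have hdead : ∀ v, stFin (c v) = true → stepWith G c r v = c v := fun v hv => by
    simp [stepWith, hv]
  have hact : ∀ v, D.Active v → stFin (c v) = false := fun v hv => by
    rw [← Bool.not_eq_true]; exact fun h' => halive v h' hv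
  have hunc : ∀ v, (stUnc (c v)).isEmpty = true ↔ ∀ b, ¬ U.Adj v b := by
    intro v
    rw [h.unc, List.isEmpty_iff, nbrIds_eq_nil]
    exact ⟨fun h' b hb => h' b (h.le hb) hb, fun h' b _ => h' b⟩
  refine ⟨⟨h.le, fun v => ?_, fun v => ?_, fun v => ?_, fun v => ?_⟩, fun v hv => ?_, fun v hv => ?_,
    fun v hv => ?_, fun v hv => ?_, fun v hv => ?_⟩
  · cases hv : stFin (c v)
    · rw [hstep v hv]; exact h.stat v
    · rw [hdead v hv]; exact h.stat v
  · cases hv : stFin (c v)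
    · rw [hstep v hv]; exact h.unc v
    · rw [hdead v hv]; exact h.unc v
  · cases hv : stFin (c v)
    · rw [hstep v hv]; exact h.out v
    · rw [hdead v hv]; exact h.out v
  · cases hv : stFin (c v)
    · rw [hstep v hv, starStep, stFin_mkSt, ← Bool.not_eq_true, Bool.and_eq_true, hunc,
        decide_eq_true_iff, (hspec v).1, StarData.Active, not_and_or]
      push Not
      rfl
    · rw [hdead v hv, hv]
      simpa using halive v hv
  · rw [hstep v (hact v hv)]; rfl
  · rw [hstep v (hact v hv)]; rfl
  · rw [hstep v (hact v hv)]; exact (hspec v).1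
  · intro a
    obtain ⟨-, K, h2, h3, h4⟩ := hspec v
    rw [hstep v (hact v hv), starStep, stStar_mkSt, h2, ← h4]
    simp
  · obtain ⟨-, K, h2, h3, h4⟩ := hspec v
    rw [hstep v (hact v hv), starStep, stDeg_mkSt, h2, ← h4]
    refine dartCount_map (fun u _ b => ?_) h3
    rw [h.unc, mem_nbrIds]
    exact ⟨fun h => h.2, fun h' => ⟨h.le h', h'⟩⟩

variable {O : V → V → Prop} {N : ℕ} {D : StarData G U} {r : V → ℕ} {c : V → St}

theorem mem_stNbr (h : KnowsStars G U O N D c) {w b : V} :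
    (b : ℕ) ∈ stNbr (c w) ↔ G.Adj w b := by
  rw [stNbr_eq (h.stat w), mem_nbrIds, and_true]

theorem beats_iff {k : ℕ} (h : StarConfig G U O N D r k c) {a b w v : V} (haw : G.Adj a w)
    (hw : D.Active w) (hv : D.Active v) :
    beats a b ((w : ℕ), c w) ((v : ℕ), c v) = true ↔ D.Beats r a b w v := by
  simp only [beats, Bool.and_eq_true, Bool.or_eq_true, decide_eq_true_iff, mem_stNbr h.1,
    h.lev _ hw, h.lev _ hv, h.star _ hw, h.rank _ hw, h.rank _ hv, StarData.Beats, haw, true_and,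
    G.adj_comm w b, Subtype.coe_lt_coe]

/-- Any `w` that could beat `v` has nonzero level or a nonempty star, so it is active and its
message is in the inbox. -/
theorem votesFor_iff {k : ℕ} (h : StarConfig G U O N D r k c) {a b v : V} (hav : G.Adj a v)
    (hv : D.Active v) :
    votesFor a b (inboxOf G c a) ((v : ℕ), c v) = true ↔ D.VotesFor r a b v := by
  have hany : (inboxOf G c a).any (fun m' => beats a b m' ((v : ℕ), c v)) = true ↔
      ∃ w, D.Beats r a b w v := by
    rw [any_inboxOf]
    constructor
    · rintro ⟨w, h1, h2, h3⟩
      exact ⟨w, (beats_iff h h1 ((h.fin w).1 h2) hv).1 h3⟩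
    · rintro ⟨w, hw⟩
      have hact : D.Active w := by
        rcases hw.2.2 with h1 | ⟨-, h1, -⟩
        · exact .inr (by omega)
        · exact StarData.active_of_mem_star h1
      exact ⟨w, hw.1, (h.fin w).2 hact, (beats_iff h hw.1 hact hv).2 hw⟩
  simp only [votesFor, Bool.and_eq_true, decide_eq_true_iff, Bool.not_eq_true', ← Bool.not_eq_true,
    hany, mem_stNbr h.1, h.star _ hv, StarData.VotesFor, hav, true_and, G.adj_comm v b, not_exists]

theorem sum_votes_eq (F : ℕ × St → ℕ) {a w : V} (haw : G.Adj a w) (hw : stFin (c w) = false) :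
    ((((inboxOf G c a).map fun m => (m.1, F m)).filter fun p => decide (p.1 = (w : ℕ))).map
      fun p => p.2).sum = F ((w : ℕ), c w) := by
  have h1 : (((inboxOf G c a).map fun m => (m.1, F m)).filter fun p => decide (p.1 = (w : ℕ))).map
      (fun p => p.2) = ((neighborList G a).filter fun u => decide (u = w)).map
        fun u : V => F ((u : ℕ), c u) := by
    rw [inboxOf, List.map_map, List.filter_map, List.map_map, List.filter_filter]
    rw [List.filter_congr (q := fun u : V => decide (u = w))]
    · rfl
    · intro u _
      rw [Bool.eq_iff_iff]
      simp only [Function.comp_apply, Bool.and_eq_true, decide_eq_true_iff, Bool.not_eq_true']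
      refine ⟨fun h => Subtype.ext h.1, ?_⟩
      rintro rfl
      exact ⟨rfl, hw⟩
  have hsingle : (neighborList G a).filter (fun u => decide (u = w)) = [w] := by
    have := (nodup_neighborList G a).filter fun u => decide (u = w)
    rw [List.eq_replicate_of_mem (a := w) (l := (neighborList G a).filter fun u => decide (u = w))
      fun x hx => by simpa using (List.mem_filter.1 hx).2] at this ⊢
    have h2 : w ∈ (neighborList G a).filter fun u => decide (u = w) :=
      List.mem_filter.2 ⟨(mem_neighborList G).2 haw, by simp⟩
    have h3 := List.length_pos_of_mem h2
    have h4 := List.nodup_replicate.1 this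
    rw [show ((neighborList G a).filter fun u => decide (u = w)).length = 1 by omega]
    rfl
  rw [h1, hsingle, List.map_singleton, List.sum_singleton]

theorem StarConfig.vote_step (h : StarConfig G U O N D r 1 c) (ρ : V → ℕ) :
    StarConfig G U O N D r 2 (stepWith G c ρ) ∧ ∀ a, D.Active a → ∀ w, G.Adj a w → D.Active w →
      (((stVotes (stepWith G c ρ a)).filter fun p => decide (p.1 = (w : ℕ))).map fun p => p.2).sum =
        D.votesAt r a w := by
  classical
  have hstep : ∀ v, D.Active v → stepWith G c ρ v = voteStep (c v) (inboxOf G c v) := by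
    intro v hv
    simp [stepWith, (h.fin v).2 hv, updateSt, h.phase_eq v hv]
  have hdead : ∀ v, ¬ D.Active v → stepWith G c ρ v = c v := fun v hv => by
    rw [← h.fin, Bool.not_eq_false] at hv
    simp [stepWith, hv]
  refine ⟨⟨⟨h.le, fun v => ?_, fun v => ?_, fun v => ?_, fun v => ?_⟩, fun v hv => ?_,
    fun v hv => ?_, fun v hv => ?_, fun v hv => ?_, fun v hv => ?_⟩, fun a ha w haw hw => ?_⟩
  · by_cases hv : D.Active v
    · rw [hstep v hv]; exact h.stat v
    · rw [hdead v hv]; exact h.stat v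
  · by_cases hv : D.Active v
    · rw [hstep v hv]; exact h.unc v
    · rw [hdead v hv]; exact h.unc v
  · by_cases hv : D.Active v
    · rw [hstep v hv]; exact h.out v
    · rw [hdead v hv]; exact h.out v
  · by_cases hv : D.Active v
    · rw [hstep v hv]; exact h.fin v
    · rw [hdead v hv]; exact h.fin v
  · rw [hstep v hv]; rfl
  · rw [hstep v hv]; exact h.rank v hv
  · rw [hstep v hv]; exact h.lev v hv
  · rw [hstep v hv]; exact h.star v hv
  · rw [hstep v hv]; exact h.deg v hv
  · have hme : stMe (c a) = a := stMe_eq (h.stat a)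
    rw [hstep a ha, voteStep, stVotes_mkSt, sum_votes_eq (fun m => ((stUnc (c a)).filter fun b =>
      votesFor (stMe (c a)) b (inboxOf G c a) m).length) haw ((h.fin w).2 hw), h.unc,
      filter_nbrIds (Q := fun b => D.VotesFor r a b w), length_nbrIds, StarData.votesAt]
    · congr 1
      ext b
      simp only [Finset.mem_filter, Finset.mem_univ, true_and]
      exact ⟨fun h => h.2, fun h' => ⟨h.le h'.1, h'⟩⟩
    · intro b _ _
      rw [hme]
      exact votesFor_iff h haw hw

/-- Vertices that send nothing to `w` have no uncovered edge voting for it, so the sum over the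
inbox is the sum over all vertices. -/
theorem voteCount_eq (h : KnowsStars G U O N D c)
    (hvotes : ∀ a, D.Active a → ∀ w, G.Adj a w → D.Active w →
      (((stVotes (c a)).filter fun p => decide (p.1 = (w : ℕ))).map fun p => p.2).sum =
        D.votesAt r a w) {w : V} (hw : D.Active w) :
    voteCount w (inboxOf G c w) = (D.votes r w).card := by
  classical
  have hnd := (nodup_neighborList G w).filter fun u => !(stFin (c u))
  rw [voteCount, inboxOf, List.map_map, StarData.card_votes_eq_sum, ← List.sum_toFinset _ hnd]
  have hzero : ∀ a ∈ Finset.univ,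
      a ∉ ((neighborList G w).filter fun u => !(stFin (c u))).toFinset → D.votesAt r a w = 0 := by
    intro a _ ha
    rw [StarData.votesAt, Finset.card_eq_zero, Finset.filter_eq_empty_iff]
    rintro b - ⟨h1, h2⟩
    refine ha (List.mem_toFinset.2 (List.mem_filter.2 ⟨(mem_neighborList G).2 h2.1.symm, ?_⟩))
    rw [Bool.not_eq_true', h.fin]
    exact .inl ⟨b, h1⟩
  rw [← Finset.sum_subset (Finset.subset_univ _) hzero]
  refine Finset.sum_congr rfl fun a ha => ?_
  rw [List.mem_toFinset, List.mem_filter, mem_neighborList, Bool.not_eq_true', h.fin] at ha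
  exact hvotes a ha.2 w ha.1.symm hw

theorem StarConfig.accept_step (h : StarConfig G U O N D r 2 c)
    (hvotes : ∀ a, D.Active a → ∀ w, G.Adj a w → D.Active w →
      (((stVotes (c a)).filter fun p => decide (p.1 = (w : ℕ))).map fun p => p.2).sum =
        D.votesAt r a w) (ρ : V → ℕ) :
    KnowsStars G U (fun v b => O v b ∨ (D.Accepted r v ∧ b ∈ D.star v)) N D (stepWith G c ρ) ∧
      (∀ v, D.Active v → stPhase (stepWith G c ρ v) = 3) ∧
      ∀ v, D.Active v → ∀ a : V, (a : ℕ) ∈ stStar (stepWith G c ρ v) ↔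
        D.Accepted r v ∧ a ∈ D.star v := by
  classical
  have hstep : ∀ v, D.Active v → stepWith G c ρ v = acceptStep (c v) (inboxOf G c v) := by
    intro v hv
    simp [stepWith, (h.fin v).2 hv, updateSt, h.phase_eq v hv]
  have hdead : ∀ v, ¬ D.Active v → stepWith G c ρ v = c v := fun v hv => by
    rw [← h.fin, Bool.not_eq_false] at hv
    simp [stepWith, hv]
  have hacc : ∀ v, D.Active v → (decide (stDeg (c v) ≤
      8 * voteCount (stMe (c v)) (inboxOf G c v)) = true ↔ D.Accepted r v) := by
    intro v hv
    rw [decide_eq_true_iff, h.deg v hv, stMe_eq (h.stat v), voteCount_eq h.1 hvotes hv]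
    rfl
  refine ⟨⟨h.le, fun v => ?_, fun v => ?_, fun v => ?_, fun v => ?_⟩, fun v hv => ?_,
    fun v hv a => ?_⟩
  · by_cases hv : D.Active v
    · rw [hstep v hv, acceptStep]; split <;> exact h.stat v
    · rw [hdead v hv]; exact h.stat v
  · by_cases hv : D.Active v
    · rw [hstep v hv, acceptStep]; split <;> exact h.unc v
    · rw [hdead v hv]; exact h.unc v
  · by_cases hv : D.Active v
    · rw [hstep v hv, acceptStep]
      split
      · rename_i ha
        rw [stOut_mkSt, stNbr_eq (h.stat v), filter_nbrIds (Q := fun b => O v b ∨ b ∈ D.star v)]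
        · refine nbrIds_congr fun b _ => ?_
          simp [(hacc v hv).1 ha]
        · intro b hb _
          simp [h.out, mem_nbrIds, h.star v hv, hb]
      · rename_i ha
        rw [stOut_mkSt, h.out]
        refine nbrIds_congr fun b _ => ?_
        simp [mt (hacc v hv).2 ha]
    · rw [hdead v hv, h.out]
      refine nbrIds_congr fun b _ => ?_
      have : b ∉ D.star v := fun hb => hv (StarData.active_of_mem_star hb)
      simp [this]
  · by_cases hv : D.Active v
    · rw [hstep v hv, acceptStep]; split <;> exact h.fin v
    · rw [hdead v hv]; exact h.fin v
  · rw [hstep v hv, acceptStep]; split <;> rfl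
  · rw [hstep v hv, acceptStep]
    split
    · rename_i ha
      rw [stStar_mkSt, h.star v hv]
      simp [(hacc v hv).1 ha]
    · rename_i ha
      simp [mt (hacc v hv).2 ha]

theorem KnowsStars.cover_step
    (h : KnowsStars G U (fun v b => O v b ∨ (D.Accepted r v ∧ b ∈ D.star v)) N D c)
    (hphase : ∀ v, D.Active v → stPhase (c v) = 3)
    (hstar : ∀ v, D.Active v → ∀ a : V, (a : ℕ) ∈ stStar (c v) ↔ D.Accepted r v ∧ a ∈ D.star v)
    (ρ : V → ℕ) : StartConfig G (D.nextU r) (D.nextOut r O) N (stepWith G c ρ) := by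
  classical
  have hstep : ∀ v, D.Active v → stepWith G c ρ v = coverStep (c v) (inboxOf G c v) := by
    intro v hv
    simp [stepWith, (h.fin v).2 hv, updateSt, hphase v hv]
  have hdead : ∀ v, ¬ D.Active v → stepWith G c ρ v = c v := fun v hv => by
    rw [← h.fin, Bool.not_eq_false] at hv
    simp [stepWith, hv]
  have htri : ∀ v b : V, U.Adj v b → (inTriangle b (inboxOf G c v) = true ↔
      ∃ w, G.Adj v w ∧ G.Adj b w) := by
    intro v b hb
    rw [inTriangle, any_inboxOf]
    simp only [decide_eq_true_iff, mem_stNbr h]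
    constructor
    · rintro ⟨w, h1, -, h2⟩; exact ⟨w, h1, h2.symm⟩
    · rintro ⟨w, h1, h2⟩
      exact ⟨w, h1, (h.fin w).2 (.inr (D.lev_ne_zero h1.symm h2.symm hb)), h2.symm⟩
  have hcov : ∀ v b : V, (isCovered v b (inboxOf G c v) = true ↔ D.Covered r v b) := by
    intro v b
    rw [isCovered, any_inboxOf]
    simp only [Bool.and_eq_true, decide_eq_true_iff]
    constructor
    · rintro ⟨w, -, h2, h3, h4⟩
      rw [h.fin] at h2
      rw [hstar w h2] at h3 h4
      exact ⟨w, h3.1, h3.2, h4.2⟩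
    · rintro ⟨w, h1, h2, h3⟩
      have hw := StarData.active_of_mem_star h2
      refine ⟨w, (D.adj_of_mem_star h2).symm, (h.fin w).2 hw, ?_, ?_⟩ <;> rw [hstar w hw]
      · exact ⟨h1, h2⟩
      · exact ⟨h1, h3⟩
  have hactU : ∀ {v b : V}, ¬ D.Active v → ¬ U.Adj v b := fun hv hb => hv (.inl ⟨_, hb⟩)
  refine ⟨(D.nextU_le r).trans h.le, fun v => ?_, fun v => ?_, fun v => ?_, fun v => ?_,
    fun v hv => ?_⟩
  · by_cases hv : D.Active v
    · rw [hstep v hv]; exact h.stat v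
    · rw [hdead v hv]; exact h.stat v
  · by_cases hv : D.Active v
    · rw [hstep v hv, coverStep, stUnc_mkSt, h.unc, stMe_eq (h.stat v),
        filter_nbrIds (Q := fun b => (∃ w, G.Adj v w ∧ G.Adj b w) ∧ ¬ D.Covered r v b)]
      · rfl
      · intro b _ hb
        rw [Bool.and_eq_true, htri v b hb, Bool.not_eq_true', ← Bool.not_eq_true, hcov]
    · rw [hdead v hv, h.unc]
      refine nbrIds_congr fun b _ => ?_
      exact ⟨fun hb => absurd hb (hactU hv), fun hb => hb.1⟩
  · by_cases hv : D.Active v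
    · rw [hstep v hv, coverStep, stOut_mkSt, stNbr_eq (h.stat v),
        filter_nbrIds (Q := D.nextOut r O v)]
      · exact nbrIds_congr fun b _ => by simp
      · intro b hb _
        simp only [Bool.or_eq_true, Bool.and_eq_true, decide_eq_true_iff, h.out, h.unc, mem_nbrIds,
          hb, true_and, StarData.nextOut, Bool.not_eq_true', ← Bool.not_eq_true]
        by_cases hU : U.Adj v b
        · rw [htri v b hU]
        · simp [hU]
    · rw [hdead v hv, h.out]
      refine nbrIds_congr fun b _ => ?_
      exact ⟨fun hb => .inl hb, fun hb => hb.resolve_right fun hb => hactU hv hb.1⟩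
  · intro hv
    by_cases hact : D.Active v
    · rw [hstep v hact]; rfl
    · rw [hdead v hact, h.fin] at hv
      exact absurd hv hact
  · have hact : ¬ D.Active v := by
      intro hact
      have := (h.fin v).2 hact
      rw [hstep v hact] at hv
      have h2 : stFin (coverStep (c v) (inboxOf G c v)) = stFin (c v) := rfl
      rw [h2, this] at hv
      exact absurd hv (by simp)
    refine ⟨fun b hb => hactU hact hb.1, fun a b ha hb hab => hact (.inr ?_)⟩
    exact D.lev_ne_zero ha hb hab.1

/-- The four rounds of an iteration. -/
theorem StartConfig.iteration (h : StartConfig G U O N c) (D : StarData G U)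
    (r ρ₁ ρ₂ ρ₃ : V → ℕ) : StartConfig G (D.nextU r) (D.nextOut r O) N
      (stepWith G (stepWith G (stepWith G (stepWith G c r) ρ₁) ρ₂) ρ₃) := by
  have h1 := h.step D r
  obtain ⟨h2, h2'⟩ := h1.vote_step ρ₁
  obtain ⟨h3, h3', h3''⟩ := h2.accept_step h2' ρ₂
  exact h3.cover_step h3' h3'' ρ₃

theorem StartConfig.init (N : ℕ) : StartConfig G G (fun _ _ => False) N
    fun v => initSt v N ((neighborList G v).map fun u : V => (u : ℕ)) := by
  classical
  have hT : ∀ v, ((neighborList G v).map fun u : V => (u : ℕ)) = nbrIds G v fun _ => True := by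
    intro v; simp [nbrIds]
  refine ⟨le_rfl, fun v => ?_, fun v => ?_, fun v => ?_, fun v _ => rfl, fun v hv => ?_⟩
  · rw [← hT]; rfl
  · rw [initSt, stUnc_mkSt, hT]
    exact nbrIds_congr fun b hb => by simp [hb]
  · rw [initSt, stOut_mkSt, eq_comm, nbrIds_eq_nil]
    simp
  · exact absurd hv (by simp [initSt])

end Simulation

/-! ### The algorithm as programs, and its rounds -/

noncomputable def initProg : Prog (.prod .nat (.prod .nat (.list .nat))) StTy :=
  PolyFn.initSt.choose
noncomputable def updateProg : Prog (.prod StTy (.prod .nat (.list MsgTy))) StTy :=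
  PolyFn.updateSt.choose
noncomputable def coinsProg : Prog StTy .nat := (PolyFn.stCoins PolyFn.id).choose
noncomputable def finProg : Prog StTy .bool := (PolyFn.stFin PolyFn.id).choose
noncomputable def outProg : Prog StTy (.list .nat) := (PolyFn.stOut PolyFn.id).choose

/-- The distributed algorithm for the minimum 2-spanner problem. -/
@[reducible] noncomputable def spannerAlg : LocalAlgorithm where
  State := StTy
  Msg := StTy
  init := initProg
  send := .fst
  coins := coinsProg
  update := updateProg
  halted := finProg
  output := outProg

theorem initProg_eval (x : (Ty.prod .nat (.prod .nat (.list .nat))).denote) :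
    initProg.eval x = initSt x.1 x.2.1 x.2.2 := by
  obtain ⟨q, hq⟩ := PolyFn.initSt.choose_spec
  exact (hq x).1

theorem updateProg_eval (x : (Ty.prod StTy (.prod .nat (.list MsgTy))).denote) :
    updateProg.eval x = updateSt x.1 x.2.1 x.2.2 := by
  obtain ⟨q, hq⟩ := PolyFn.updateSt.choose_spec
  exact (hq x).1

theorem coinsProg_eval (s : St) : coinsProg.eval s = stCoins s := by
  obtain ⟨q, hq⟩ := (PolyFn.stCoins PolyFn.id).choose_spec
  exact (hq s).1

theorem finProg_eval (s : St) : finProg.eval s = stFin s := by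
  obtain ⟨q, hq⟩ := (PolyFn.stFin PolyFn.id).choose_spec
  exact (hq s).1

theorem outProg_eval (s : St) : outProg.eval s = stOut s := by
  obtain ⟨q, hq⟩ := (PolyFn.stOut PolyFn.id).choose_spec
  exact (hq s).1

section Run

open LocalAlgorithm

variable {V : Finset ℕ} (G : SimpleGraph V) [DecidableRel G.Adj]

theorem hasHalted_iff (c : spannerAlg.Config V) (v : V) :
    spannerAlg.HasHalted c v ↔ stFin (c v) = true := by
  rw [HasHalted, ← finProg_eval]

theorem spannerAlg_inbox (c : spannerAlg.Config V) (v : V) :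
    spannerAlg.inbox G c v = inboxOf G c v := by
  rw [inbox, inboxOf]
  congr 1
  refine List.filter_congr fun u _ => ?_
  rw [Bool.eq_iff_iff, decide_eq_true_iff, hasHalted_iff, Bool.not_eq_true', Bool.not_eq_true]

theorem spannerAlg_next (c : spannerAlg.Config V) (r : spannerAlg.Flips c) :
    spannerAlg.next G c r = stepWith G c fun v => r v := by
  funext v
  rw [next, stepWith]
  have h := hasHalted_iff c v
  by_cases hv : stFin (c v) = true
  · rw [if_pos (h.2 hv), if_pos hv]
  · rw [if_neg (mt h.1 hv), if_neg hv, ← spannerAlg_inbox]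
    exact updateProg_eval _

theorem spannerAlg_initConfig (N : ℕ) : spannerAlg.initConfig G N = fun v : V =>
    initSt v N ((neighborList G v).map fun u : V => (u : ℕ)) := by
  funext v
  exact initProg_eval _

theorem mem_support_run_succ {N t : ℕ} {c' : spannerAlg.Config V} :
    c' ∈ (spannerAlg.run G N (t + 1)).support ↔
      ∃ c ∈ (spannerAlg.run G N t).support, ∃ r : spannerAlg.Flips c, spannerAlg.next G c r = c' := by
  rw [run, PMF.mem_support_bind_iff]
  simp

end Run

/-! ### Size of the states and polynomial local time -/

/-- A list of at most `l` numbers of at most `l` bits. -/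
def ShortList (l : ℕ) (L : List ℕ) : Prop := L.length ≤ l ∧ ∀ x ∈ L, Nat.size x ≤ l

/-- The data in a state are small. -/
structure SmallState (l : ℕ) (s : St) : Prop where
  me : Nat.size (stMe s) ≤ l
  coins : stCoins s ≤ l + 3
  nbr : ShortList l (stNbr s)
  phase : stPhase s ≤ 3
  unc : ShortList l (stUnc s)
  out : ShortList l (stOut s)
  rank : Nat.size (stRank s) ≤ l + 3
  lev : Nat.size (stLev s) ≤ l
  star : ShortList l (stStar s)
  deg : stDeg s ≤ l * l
  votes : (stVotes s).length ≤ l ∧ ∀ p ∈ stVotes s, Nat.size p.1 ≤ l ∧ p.2 ≤ l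

theorem nat_size_le_self (n : ℕ) : Nat.size n ≤ n := Nat.size_le.2 Nat.lt_two_pow_self

theorem size_list_le {a : Ty} {L : List a.denote} {l b : ℕ} (hL : L.length ≤ l)
    (hb : ∀ x ∈ L, a.size x ≤ b) : (Ty.list a).size L ≤ 1 + l * (1 + b) := by
  have h := List.sum_le_card_nsmul (L.map fun x => 1 + a.size x) (1 + b) (by
    intro y hy
    obtain ⟨x, hx, rfl⟩ := List.mem_map.1 hy
    exact Nat.add_le_add_left (hb x hx) 1)
  rw [List.length_map, smul_eq_mul] at h
  rw [Ty.size]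
  exact Nat.add_le_add_left (h.trans (Nat.mul_le_mul_right _ hL)) 1

theorem ShortList.size_le {l : ℕ} {L : List ℕ} (h : ShortList l L) :
    (Ty.list .nat).size L ≤ 1 + l * (2 + l) := by
  refine (size_list_le (a := .nat) (b := 1 + l) h.1 fun x hx => ?_).trans (le_of_eq (by ring))
  rw [Ty.size]
  exact Nat.add_le_add_left (h.2 x hx) 1

theorem ShortList.sublist {l : ℕ} {L L' : List ℕ} (h : ShortList l L) (h' : L'.Sublist L) :
    ShortList l L' :=
  ⟨h'.length_le.trans h.1, fun x hx => h.2 x (h'.subset hx)⟩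

theorem shortList_nil (l : ℕ) : ShortList l [] := ⟨Nat.zero_le _, by simp⟩

theorem SmallState.size_le {l : ℕ} {s : St} (h : SmallState l s) :
    StTy.size s ≤ 50 * (l + 1) ^ 2 := by
  have e : StTy.size s = 1 + (1 + (1 + Nat.size (stMe s)) + (1 + (1 + Nat.size (stCoins s)) +
      (Ty.list .nat).size (stNbr s))) + (1 + (1 + Nat.size (stPhase s)) + (1 + 1 +
      (1 + (Ty.list .nat).size (stUnc s) + (1 + (Ty.list .nat).size (stOut s) +
      (1 + (1 + Nat.size (stRank s)) + (1 + (1 + Nat.size (stLev s)) +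
      (1 + (Ty.list .nat).size (stStar s) + (1 + (1 + Nat.size (stDeg s)) +
      (Ty.list (.prod .nat .nat)).size (stVotes s))))))))) := rfl
  have h1 := h.me
  have h2 := (nat_size_le_self (stCoins s)).trans h.coins
  have h3 := h.nbr.size_le
  have h4 := (nat_size_le_self (stPhase s)).trans h.phase
  have h5 := h.unc.size_le
  have h6 := h.out.size_le
  have h7 := h.rank
  have h8 := h.lev
  have h9 := h.star.size_le
  have h10 := (nat_size_le_self (stDeg s)).trans h.deg
  have h11 : (Ty.list (.prod .nat .nat)).size (stVotes s) ≤ 1 + l * (1 + (3 + 2 * l)) := by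
    refine size_list_le (a := .prod .nat .nat) h.votes.1 fun p hp => ?_
    have h12 := (h.votes.2 p hp).1
    have h13 := (nat_size_le_self p.2).trans (h.votes.2 p hp).2
    rw [Ty.size, Ty.size, Ty.size]
    omega
  rw [e]
  have h14 : (l + 1) ^ 2 = l * l + 2 * l + 1 := by ring
  have h15 : l * (2 + l) = l * l + 2 * l := by ring
  have h16 : l * (1 + (3 + 2 * l)) = 2 * (l * l) + 4 * l := by ring
  rw [h15] at h3 h5 h6 h9
  rw [h16] at h11
  rw [h14]
  generalize l * l = x at *
  omega

theorem size_bestCore_le (L : List (ℕ × List ℕ)) : Nat.size (bestCore L).1 ≤ L.length := by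
  rw [Nat.size_le]
  have : ∀ i, ((bestStep L)^[i] (0, [])).1 < 2 ^ i := by
    intro i
    induction i with
    | zero => simp
    | succ i ih =>
      rw [Function.iterate_succ_apply', bestStep, pow_succ]
      split
      · omega
      · exact max_lt (by omega) (by omega)
  exact this _

theorem length_bestCore_le (L : List (ℕ × List ℕ)) : (bestCore L).2.Sublist L := by
  have hc : ∀ t, (coreList t L).Sublist L := fun t =>
    iterate_sublist (F := peel t) (fun l => List.filter_sublist) _ _
  rcases bestCore_inv L L.length with ⟨h1, -⟩ | ⟨j, h1, -⟩
  · rw [bestCore, h1]; exact List.nil_sublist _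
  · rw [bestCore, h1]; exact hc _

theorem dartCount_le (L : List (ℕ × List ℕ)) : dartCount L ≤ L.length * L.length := by
  have h := List.sum_le_card_nsmul (L.map fun p => (L.filter fun q => decide (q.1 ∈ p.2)).length)
    L.length (by
      intro y hy
      obtain ⟨x, hx, rfl⟩ := List.mem_map.1 hy
      exact List.length_filter_le _ _)
  rwa [List.length_map, smul_eq_mul] at h

/-- Nothing accumulates: outputs are filtered from `stNbr`, uncovered edges only shrink, and stars
and votes are rebuilt from the inbox. The bound `l` thus survives every round. -/
theorem SmallState.update {l : ℕ} {s : St} (h : SmallState l s) {rank : ℕ}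
    (hr : Nat.size rank ≤ l + 3) {I : List (ℕ × St)} (hI : I.length ≤ l)
    (hI' : ∀ m ∈ I, Nat.size m.1 ≤ l) : SmallState l (updateSt s rank I) := by
  have hvn : ([] : List (ℕ × ℕ)).length ≤ l ∧ ∀ p ∈ ([] : List (ℕ × ℕ)),
      Nat.size p.1 ≤ l ∧ p.2 ≤ l := ⟨Nat.zero_le _, by simp⟩
  have hadj : (adjOf I).length = I.length := List.length_map _
  rw [updateSt]
  split
  · have hsub := length_bestCore_le (adjOf I)
    have hlen := hsub.length_le
    refine ⟨h.me, h.coins, h.nbr, by simp [starStep], h.unc, h.out, hr, ?_, ?_, ?_, hvn⟩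
    · exact (size_bestCore_le _).trans (hadj ▸ hI)
    · refine ⟨by rw [starStep, stStar_mkSt, List.length_map]; omega, fun x hx => ?_⟩
      obtain ⟨p, hp, rfl⟩ := List.mem_map.1 hx
      obtain ⟨m, hm, rfl⟩ := List.mem_map.1 (hsub.subset hp)
      exact hI' m hm
    · refine (dartCount_le _).trans (Nat.mul_le_mul ?_ ?_) <;> omega
  split
  · refine ⟨h.me, h.coins, h.nbr, by simp [voteStep], h.unc, h.out, h.rank, h.lev, h.star, h.deg,
      ?_, ?_⟩
    · rw [voteStep, stVotes_mkSt, List.length_map]; exact hI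
    · intro p hp
      obtain ⟨m, hm, rfl⟩ := List.mem_map.1 hp
      exact ⟨hI' m hm, (List.length_filter_le _ _).trans h.unc.1⟩
  split
  · rw [acceptStep]
    split
    · exact ⟨h.me, h.coins, h.nbr, by simp, h.unc, h.nbr.sublist List.filter_sublist, h.rank, h.lev,
        h.star, h.deg, h.votes⟩
    · exact ⟨h.me, h.coins, h.nbr, by simp, h.unc, h.out, h.rank, h.lev, shortList_nil l, h.deg,
        h.votes⟩
  · exact ⟨h.me, h.coins, h.nbr, by simp [coverStep], h.unc.sublist List.filter_sublist,
      h.nbr.sublist List.filter_sublist, by simp [coverStep], by simp [coverStep], shortList_nil l,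
      by simp [coverStep], hvn⟩

section Time

open LocalAlgorithm

variable {V : Finset ℕ} (G : SimpleGraph V) [DecidableRel G.Adj] (N : ℕ)

theorem size_id_le (v : V) : Nat.size (v : ℕ) ≤ inputLength V N :=
  (Finset.le_sup (f := Nat.size) v.2).trans (Nat.le_add_left _ _)

theorem length_neighborList_le (v : V) : (neighborList G v).length ≤ inputLength V N := by
  refine ((nodup_neighborList G v).length_le_card).trans ?_
  rw [Fintype.card_coe, inputLength]
  omega

theorem shortList_neighborList (v : V) :
    ShortList (inputLength V N) ((neighborList G v).map fun u : V => (u : ℕ)) := by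
  refine ⟨by rw [List.length_map]; exact length_neighborList_le G N v, fun x hx => ?_⟩
  obtain ⟨u, -, rfl⟩ := List.mem_map.1 hx
  exact size_id_le N u

theorem length_inboxOf_le (c : V → St) (v : V) : (inboxOf G c v).length ≤ inputLength V N := by
  rw [inboxOf, List.length_map]
  exact (List.length_filter_le _ _).trans (length_neighborList_le G N v)

variable {G N}

theorem size_rank_le {c : spannerAlg.Config V} {v : V} (h : SmallState (inputLength V N) (c v))
    (r : spannerAlg.Flips c) : Nat.size (r v : ℕ) ≤ inputLength V N + 3 := by
  refine le_trans (Nat.size_le.2 (r v).2) ?_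
  exact (coinsProg_eval (c v)).le.trans h.coins

theorem smallState_run {t : ℕ} {c : spannerAlg.Config V}
    (hc : c ∈ (spannerAlg.run G N t).support) (v : V) : SmallState (inputLength V N) (c v) := by
  induction t generalizing c v with
  | zero =>
    rw [run, PMF.support_pure, Set.mem_singleton_iff] at hc
    rw [hc, spannerAlg_initConfig]
    refine ⟨size_id_le N v, ?_, shortList_neighborList G N v, by simp [initSt],
      shortList_neighborList G N v, shortList_nil _, by simp [initSt], by simp [initSt],
      shortList_nil _, by simp [initSt], by simp [initSt]⟩
    change Nat.size N + 3 ≤ _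
    rw [inputLength]; omega
  | succ t ih =>
    obtain ⟨c, hc', r, rfl⟩ := (mem_support_run_succ G).1 hc
    rw [spannerAlg_next, stepWith]
    split
    · exact ih hc' v
    · refine (ih hc' v).update (size_rank_le (ih hc' v) r) (length_inboxOf_le G N c v) ?_
      intro m hm
      obtain ⟨u, -, -, rfl⟩ := mem_inboxOf.1 hm
      exact size_id_le N u

theorem spannerAlg_hasPolynomialLocalTime : spannerAlg.HasPolynomialLocalTime := by
  obtain ⟨qi, hqi⟩ := PolyFn.initSt.choose_spec
  obtain ⟨qu, hqu⟩ := PolyFn.updateSt.choose_spec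
  obtain ⟨qc, hqc⟩ := (PolyFn.stCoins PolyFn.id).choose_spec
  obtain ⟨qf, hqf⟩ := (PolyFn.stFin PolyFn.id).choose_spec
  obtain ⟨qo, hqo⟩ := (PolyFn.stOut PolyFn.id).choose_spec
  -- Bounds in terms of the input length: `S` for a state, `I₀` for the initial input, `R` for the
  -- input of an update.
  let S : Polynomial ℕ := 50 * (.X + 1) ^ 2
  let I₀ : Polynomial ℕ := 5 + 2 * .X + .X * (2 + .X)
  let R : Polynomial ℕ := 7 + S + .X + .X * (3 + .X + S)
  refine ⟨I₀ + qi.comp I₀ + (qf.comp S + qo.comp S + qc.comp S + (.X + 3) + .X * (1 + S) + R +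
    qu.comp R), fun V G _ N hconn hN v => ?_⟩
  set l := inputLength V N with hl
  have hSe : S.eval l = 50 * (l + 1) ^ 2 := by simp [S]
  have hI₀ : I₀.eval l = 5 + 2 * l + l * (2 + l) := by simp [I₀]
  have hR : R.eval l = 7 + S.eval l + l + l * (3 + l + S.eval l) := by simp [R]
  simp only [Polynomial.eval_add, Polynomial.eval_comp, Polynomial.eval_mul, Polynomial.eval_X,
    Polynomial.eval_one, Polynomial.eval_ofNat]
  refine ⟨?_, fun t c hc r => ?_⟩
  · have h1 := size_id_le N v
    have h2 : _ ≤ 1 + l * (2 + l) := (shortList_neighborList G N v).size_le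
    have h3 : Nat.size N ≤ l := by rw [hl, inputLength]; omega
    have h4 : Ty.size (.prod .nat (.prod .nat (.list .nat))) (initInput G N v) =
      1 + (1 + Nat.size (v : ℕ)) + (1 + (1 + Nat.size N) +
        (Ty.list .nat).size ((neighborList G v).map fun u : V => (u : ℕ))) := rfl
    have h5 : Ty.size (.prod .nat (.prod .nat (.list .nat))) (initInput G N v) ≤ I₀.eval l := by
      rw [h4, hI₀]; omega
    have h6 : initProg.cost (initInput G N v) ≤ qi.eval (I₀.eval l) :=
      (hqi _).2.trans (polynomial_eval_mono qi h5)
    change _ + initProg.cost (initInput G N v) ≤ _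
    omega
  · have hsm := smallState_run hc
    have hs : ∀ u, StTy.size (c u) ≤ S.eval l := fun u => hSe ▸ (hsm u).size_le
    have hf : finProg.cost (c v) ≤ qf.eval (S.eval l) :=
      (hqf _).2.trans (polynomial_eval_mono qf (hs v))
    have ho : outProg.cost (c v) ≤ qo.eval (S.eval l) :=
      (hqo _).2.trans (polynomial_eval_mono qo (hs v))
    have hco : coinsProg.cost (c v) ≤ qc.eval (S.eval l) :=
      (hqc _).2.trans (polynomial_eval_mono qc (hs v))
    have hce : @LE.le ℕ _ (coinsProg.eval (c v)) (l + 3) := (coinsProg_eval (c v)).le.trans (hsm v).coins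
    have hsend : ((neighborList G v).map fun u : V => spannerAlg.send.cost (c v, (u : ℕ))).sum ≤
        l * (1 + S.eval l) := by
      have h1 := List.sum_le_card_nsmul
        ((neighborList G v).map fun u : V => spannerAlg.send.cost (c v, (u : ℕ)))
        (1 + S.eval l) (by
          intro y hy
          obtain ⟨u, hu, rfl⟩ := List.mem_map.1 hy
          exact Nat.add_le_add_left (hs v) 1)
      rw [List.length_map, smul_eq_mul] at h1
      exact h1.trans (Nat.mul_le_mul_right _ (length_neighborList_le G N v))
    have hinb : (Ty.list MsgTy).size (inboxOf G c v) ≤ 1 + l * (1 + (2 + l + S.eval l)) := by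
      refine size_list_le (a := MsgTy) (length_inboxOf_le G N c v) fun m hm => ?_
      obtain ⟨u, -, -, rfl⟩ := mem_inboxOf.1 hm
      have h1 := size_id_le N u
      have h2 := hs u
      rw [Ty.size, Ty.size]
      dsimp only
      omega
    have hin : Ty.size (.prod StTy (.prod .nat (.list MsgTy))) (spannerAlg.updateInput G c r v) ≤
        R.eval l := by
      have h1 := size_rank_le (hsm v) r
      have h2 := hs v
      have h3 : Ty.size (.prod StTy (.prod .nat (.list MsgTy))) (spannerAlg.updateInput G c r v) =
        1 + StTy.size (c v) + (1 + (1 + Nat.size (r v : ℕ)) +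
          (Ty.list MsgTy).size (spannerAlg.inbox G c v)) := rfl
      rw [h3, spannerAlg_inbox, hR]
      have h4 : l * (1 + (2 + l + S.eval l)) = l * (3 + l + S.eval l) := by ring
      omega
    have hupd : updateProg.cost (spannerAlg.updateInput G c r v) ≤ qu.eval (R.eval l) :=
      (hqu _).2.trans (polynomial_eval_mono qu hin)
    rw [localTime]
    change finProg.cost (c v) + _ ≤ _
    split
    · change _ + outProg.cost (c v) ≤ _
      omega
    · change _ + (coinsProg.cost (c v) + coinsProg.eval (c v) + _ +
        Ty.size (.prod StTy (.prod .nat (.list MsgTy))) (spannerAlg.updateInput G c r v) +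
        updateProg.cost (spannerAlg.updateInput G c r v)) ≤ _
      omega

end Time

/-! ### Invariants of every execution -/

open scoped Classical in
theorem ncard_nextOut_le {V : Type*} [Fintype V] [LinearOrder V] {G U : SimpleGraph V}
    (D : StarData G U) (r : V → ℕ) (O : V → V → Prop) :
    {d : V × V | D.nextOut r O d.1 d.2}.ncard ≤ {d : V × V | O d.1 d.2}.ncard +
      ((∑ v, if D.Accepted r v then (D.star v).card else 0) +
        (Finset.univ.filter fun d : V × V =>
          U.Adj d.1 d.2 ∧ ¬ ∃ w, G.Adj d.1 w ∧ G.Adj d.2 w).card) := by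
  have e : {d : V × V | D.nextOut r O d.1 d.2} = ({d : V × V | O d.1 d.2} ∪
      {d : V × V | D.Accepted r d.1 ∧ d.2 ∈ D.star d.1}) ∪
      {d : V × V | U.Adj d.1 d.2 ∧ ¬ ∃ w, G.Adj d.1 w ∧ G.Adj d.2 w} := rfl
  have h1 : {d : V × V | D.Accepted r d.1 ∧ d.2 ∈ D.star d.1}.ncard =
      ∑ v, if D.Accepted r v then (D.star v).card else 0 := by
    rw [Set.ncard_eq_toFinset_card', Set.toFinset_ofPred, Finset.card_filter,
      Fintype.sum_prod_type]
    refine Finset.sum_congr rfl fun v _ => ?_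
    split_ifs with h
    · simp only [h, true_and]
      rw [← Finset.card_filter, Finset.filter_univ_mem]
    · simp [h]
  have h2 : {d : V × V | U.Adj d.1 d.2 ∧ ¬ ∃ w, G.Adj d.1 w ∧ G.Adj d.2 w}.ncard =
      (Finset.univ.filter fun d : V × V =>
          U.Adj d.1 d.2 ∧ ¬ ∃ w, G.Adj d.1 w ∧ G.Adj d.2 w).card := by
    rw [Set.ncard_eq_toFinset_card', Set.toFinset_ofPred]
  rw [e]
  refine (Set.ncard_union_le _ _).trans ?_
  rw [← add_assoc]
  refine Nat.add_le_add ((Set.ncard_union_le _ _).trans ?_) h2.le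
  exact Nat.add_le_add_left h1.le _

section Execution

open LocalAlgorithm

variable {V : Finset ℕ} (G : SimpleGraph V) [DecidableRel G.Adj]

/-- What holds after `i` iterations. -/
structure Progress (N i : ℕ) (U : SimpleGraph V) (O : V → V → Prop) (c : V → St) : Prop
    extends StartConfig G U O N c where
  adj : ∀ a b, O a b → G.Adj a b
  covered : ∀ a b, G.Adj a b → ¬ U.Adj a b → O a b ∨ O b a ∨ ∃ w, O w a ∧ O w b
  paid : ∀ (H : SimpleGraph V) (asg : V × V → V), H ≤ G →
    (∀ a b, G.Adj a b → H.Adj a b ∨ ∃ w, H.Adj w a ∧ H.Adj w b) →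
    (∀ d : V × V, G.Adj d.1 d.2 → ¬ H.Adj d.1 d.2 → H.Adj (asg d) d.1 ∧ H.Adj (asg d) d.2) →
    ({d : V × V | O d.1 d.2}.ncard : ℝ) + budget U H asg ≤ budget G H asg
  progress : U = ⊥ ∨ (dartsIn U Finset.univ).card + i ≤ (dartsIn G Finset.univ).card

variable {G} {N i : ℕ} {U : SimpleGraph V} {O : V → V → Prop} {c : V → St}

/-- The size invariant telescopes: new outputs are paid by the drop of the budget. It is kept for
all `H` and `asg` at once, because the execution does not depend on them. -/
theorem Progress.iteration (h : Progress G N i U O c) (D : StarData G U) (r ρ₁ ρ₂ ρ₃ : V → ℕ) :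
    Progress G N (i + 1) (D.nextU r) (D.nextOut r O)
      (stepWith G (stepWith G (stepWith G (stepWith G c r) ρ₁) ρ₂) ρ₃) where
  toStartConfig := h.toStartConfig.iteration D r ρ₁ ρ₂ ρ₃
  adj := by
    rintro a b ((h1 | ⟨-, h1⟩) | ⟨h1, -⟩)
    · exact h.adj a b h1
    · exact D.adj_of_mem_star h1
    · exact h.le h1
  covered := by
    intro a b hab hn
    by_cases hU : U.Adj a b
    · by_cases ht : ∃ w, G.Adj a w ∧ G.Adj b w
      · by_cases hc : D.Covered r a b
        · obtain ⟨w, hw, ha, hb⟩ := hc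
          exact .inr (.inr ⟨w, .inl (.inr ⟨hw, ha⟩), .inl (.inr ⟨hw, hb⟩)⟩)
        · exact absurd ⟨hU, ht, hc⟩ hn
      · exact .inl (.inr ⟨hU, ht⟩)
    · rcases h.covered a b hab hU with h1 | h1 | ⟨w, h1, h2⟩
      · exact .inl (.inl (.inl h1))
      · exact .inr (.inl (.inl (.inl h1)))
      · exact .inr (.inr ⟨w, .inl (.inl h1), .inl (.inl h2)⟩)
  paid := by
    intro H asg hHG hH hasg
    have h1 := card_added_le_budget h.le D r hH hHG asg hasg
    have h2 := h.paid H asg hHG hH hasg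
    have h3 : ({d : V × V | D.nextOut r O d.1 d.2}.ncard : ℝ) ≤ _ :=
      Nat.cast_le.2 (ncard_nextOut_le D r O)
    rw [Nat.cast_add] at h3
    linarith
  progress := by
    by_cases hU : U = ⊥
    · exact .inl (le_bot_iff.1 (hU ▸ D.nextU_le r))
    · have h1 := h.progress.resolve_left hU
      have h2 := D.card_darts_nextU_lt r hU
      exact .inr (by omega)

theorem Progress.init (N : ℕ) : Progress G N 0 G (fun _ _ => False)
    fun v => initSt v N ((neighborList G v).map fun u : V => (u : ℕ)) where
  toStartConfig := StartConfig.init N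
  adj := fun _ _ h => h.elim
  covered := fun _ _ h h' => absurd h h'
  paid := by simp
  progress := .inr le_rfl

theorem exists_stepWith_of_mem_support {t : ℕ} {c : spannerAlg.Config V}
    (hc : c ∈ (spannerAlg.run G N (t + 1)).support) :
    ∃ c₀ ∈ (spannerAlg.run G N t).support, ∃ ρ : V → ℕ, c = stepWith G c₀ ρ := by
  obtain ⟨c₀, h, r, rfl⟩ := (mem_support_run_succ G).1 hc
  exact ⟨c₀, h, _, spannerAlg_next G c₀ r⟩

theorem exists_progress (i : ℕ) {c : spannerAlg.Config V}
    (hc : c ∈ (spannerAlg.run G N (4 * i)).support) : ∃ U O, Progress G N i U O c := by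
  induction i generalizing c with
  | zero =>
    rw [Nat.mul_zero, run, PMF.support_pure, Set.mem_singleton_iff] at hc
    rw [hc, spannerAlg_initConfig]
    exact ⟨_, _, Progress.init N⟩
  | succ i ih =>
    obtain ⟨c₃, h₃, ρ₃, rfl⟩ := exists_stepWith_of_mem_support (t := 4 * i + 3) hc
    obtain ⟨c₂, h₂, ρ₂, rfl⟩ := exists_stepWith_of_mem_support (t := 4 * i + 2) h₃
    obtain ⟨c₁, h₁, ρ₁, rfl⟩ := exists_stepWith_of_mem_support (t := 4 * i + 1) h₂
    obtain ⟨c₀, h₀, r, rfl⟩ := exists_stepWith_of_mem_support h₁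
    obtain ⟨U, O, h⟩ := ih h₀
    obtain ⟨D⟩ := exists_starData G U
    exact ⟨_, _, h.iteration D r ρ₁ ρ₂ ρ₃⟩

theorem StartConfig.allHalted_step (h : StartConfig G ⊥ O N c) (ρ : V → ℕ) :
    spannerAlg.AllHalted (stepWith G c ρ) := by
  obtain ⟨D⟩ := exists_starData G (⊥ : SimpleGraph V)
  intro v
  rw [hasHalted_iff]
  by_contra hv
  rcases ((h.step D ρ).fin v).1 (by simpa using hv) with ⟨b, hb⟩ | hl
  · exact hb
  · obtain ⟨d, hd⟩ := D.star_nonempty hl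
    exact (mem_dartsIn.1 hd).2.2

/-- Each iteration with `U ≠ ⊥` loses a dart, so one iteration more than there are darts empties
`U`; the last round lets the vertices notice it. -/
theorem exists_forall_allHalted (G : SimpleGraph V) [DecidableRel G.Adj] (N : ℕ) :
    ∃ T, ∀ c ∈ (spannerAlg.run G N T).support, spannerAlg.AllHalted c := by
  refine ⟨4 * ((dartsIn G Finset.univ).card + 1) + 1, fun c hc => ?_⟩
  obtain ⟨c₀, h₀, ρ, rfl⟩ := exists_stepWith_of_mem_support hc
  obtain ⟨U, O, h⟩ := exists_progress _ h₀
  have hU : U = ⊥ := h.progress.resolve_right (by omega)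
  subst hU
  exact h.toStartConfig.allHalted_step ρ

theorem stepWith_of_allHalted {c : spannerAlg.Config V} (h : spannerAlg.AllHalted c)
    (ρ : V → ℕ) : stepWith G c ρ = c := by
  funext v
  rw [stepWith, if_pos ((hasHalted_iff c v).1 (h v))]

theorem mem_support_run_add {t : ℕ} {c : spannerAlg.Config V}
    (hc : c ∈ (spannerAlg.run G N t).support) (h : spannerAlg.AllHalted c) (s : ℕ) :
    c ∈ (spannerAlg.run G N (t + s)).support := by
  induction s with
  | zero => exact hc
  | succ s ih =>
    refine (mem_support_run_succ G).2 ⟨c, ih, Classical.arbitrary _, ?_⟩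
    rw [spannerAlg_next, stepWith_of_allHalted h]

/-- A halted execution is complete. -/
theorem exists_progress_of_allHalted {t : ℕ} {c : spannerAlg.Config V}
    (hc : c ∈ (spannerAlg.run G N t).support) (h : spannerAlg.AllHalted c) :
    ∃ O, Progress G N t ⊥ O c := by
  -- Halted configurations are stationary, so the run may be prolonged from `t` to `4 * t` rounds, a
  -- whole number of iterations.
  obtain ⟨U, O, hP⟩ := exists_progress t
    ((by omega : t + 3 * t = 4 * t) ▸ mem_support_run_add hc h (3 * t))
  have hU : U = ⊥ := by
    refine le_bot_iff.1 fun a b hab => ?_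
    exact (hP.fin a ((hasHalted_iff c a).1 (h a))).1 b hab
  exact ⟨O, hU ▸ hP⟩

theorem exists_common_or_adj_of_walk {H : SimpleGraph V} {u v : V} (p : H.Walk u v)
    (hp : p.length ≤ 2) (h : u ≠ v) : H.Adj u v ∨ ∃ w, H.Adj w u ∧ H.Adj w v := by
  cases p with
  | nil => exact absurd rfl h
  | cons h1 p =>
    cases p with
    | nil => exact .inl h1
    | cons h2 p =>
      cases p with
      | nil => exact .inr ⟨_, h1.symm, h2⟩
      | cons h3 p => simp at hp

theorem mem_output_iff {c : spannerAlg.Config V} (h : StartConfig G U O N c) {a b : V} :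
    (b : ℕ) ∈ spannerAlg.output.eval (c a) ↔ G.Adj a b ∧ O a b := by
  have : spannerAlg.output.eval (c a) = nbrIds G a (O a) := (outProg_eval (c a)).trans (h.out a)
  rw [this, mem_nbrIds]

theorem outputsEdges {t : ℕ} {c : spannerAlg.Config V} (h : Progress G N t U O c) :
    spannerAlg.OutputsEdges G c := by
  intro v x hx
  have : spannerAlg.output.eval (c v) = nbrIds G v (O v) := (outProg_eval (c v)).trans (h.out v)
  rw [this, nbrIds] at hx
  obtain ⟨u, hu, rfl⟩ := List.mem_map.1 hx
  exact ⟨u, (mem_neighborList G).1 (List.mem_filter.1 hu).1, rfl⟩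

theorem outputGraph_adj {t : ℕ} {c : spannerAlg.Config V} (h : Progress G N t U O c) {a b : V} :
    (spannerAlg.outputGraph c).Adj a b ↔ O a b ∨ O b a := by
  have e : ∀ a b, (G.Adj a b ∧ O a b) ↔ O a b := fun a b => ⟨fun h => h.2, fun h' => ⟨h.adj a b h', h'⟩⟩
  rw [outputGraph, SimpleGraph.fromRel_adj, mem_output_iff h.toStartConfig,
    mem_output_iff h.toStartConfig, e, e, and_iff_right_iff_imp]
  rintro (h' | h')
  · exact (h.adj _ _ h').ne
  · exact (h.adj _ _ h').ne.symm

theorem isSpanner_outputGraph {t : ℕ} {c : spannerAlg.Config V} (h : Progress G N t ⊥ O c) :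
    IsSpanner 2 G (spannerAlg.outputGraph c) := by
  constructor
  · intro a b hab
    rcases (outputGraph_adj h).1 hab with h1 | h1
    · exact h.adj _ _ h1
    · exact (h.adj _ _ h1).symm
  · intro a b hab
    have hd : ∀ {a b}, O a b → (spannerAlg.outputGraph c).Adj a b := fun h1 =>
      (outputGraph_adj h).2 (.inl h1)
    rcases h.covered a b hab id with h1 | h1 | ⟨w, h1, h2⟩
    · exact ⟨.cons (hd h1) .nil, by simp⟩
    · exact ⟨.cons (hd h1).symm .nil, by simp⟩
    · exact ⟨.cons (hd h1).symm (.cons (hd h2) .nil), by simp⟩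

theorem ncard_outputGraph_le {t : ℕ} {c : spannerAlg.Config V} (h : Progress G N t U O c) :
    (spannerAlg.outputGraph c).edgeSet.ncard ≤ {d : V × V | O d.1 d.2}.ncard := by
  refine (Set.ncard_le_ncard (t := (fun d : V × V => s(d.1, d.2)) '' {d : V × V | O d.1 d.2})
    ?_ (Set.toFinite _)).trans (Set.ncard_image_le (Set.toFinite _))
  intro e he
  induction e with
  | _ a b =>
    rcases (outputGraph_adj h).1 he with h1 | h1
    · exact ⟨(a, b), h1, rfl⟩
    · exact ⟨(b, a), h1, Sym2.eq_swap⟩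

theorem budget_nonneg (U H : SimpleGraph V) (asg : V × V → V) : 0 ≤ budget U H asg := by
  rw [budget]
  refine mul_nonneg (by norm_num) (add_nonneg (Nat.cast_nonneg _)
    (Finset.sum_nonneg fun w _ => mul_nonneg (Nat.cast_nonneg _) (Real.log_nonneg ?_)))
  have : (0 : ℝ) ≤ ((assigned U H asg w).card : ℝ) / (nbrs H w).card := by positivity
  linarith

theorem connected_of_isSpanner {V : Type*} {G H : SimpleGraph V} {k : ℕ} (hG : G.Connected)
    (h : IsSpanner k G H) : H.Connected := by
  have := hG.nonempty
  refine ⟨fun a b => ?_⟩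
  obtain ⟨p⟩ := hG.preconnected a b
  induction p with
  | nil => exact .rfl
  | cons h1 _ ih => exact (h.2 _ _ h1).elim fun q _ => q.reachable.trans ih

/-- Assign every edge outside `H` to the midpoint of a path of length 2 in `H`; what remains of the
budget is nonnegative, so the outputs cost at most the initial budget. -/
theorem ncard_outputGraph_le_of_isSpanner {t : ℕ} {c : spannerAlg.Config V} (hG : G.Connected)
    (h : Progress G N t ⊥ O c) {H : SimpleGraph V} (hH : IsSpanner 2 G H) :
    ((spannerAlg.outputGraph c).edgeSet.ncard : ℝ) ≤
      320 * Real.log (2 + (G.edgeSet.ncard : ℝ) / (V.card : ℝ)) * (H.edgeSet.ncard : ℝ) := by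
  have h2 : ∀ a b, G.Adj a b → H.Adj a b ∨ ∃ w, H.Adj w a ∧ H.Adj w b := fun a b hab => by
    obtain ⟨p, hp⟩ := hH.2 a b hab
    exact exists_common_or_adj_of_walk p hp hab.ne
  have h3 : ∀ d : V × V, ∃ w, G.Adj d.1 d.2 → ¬ H.Adj d.1 d.2 → H.Adj w d.1 ∧ H.Adj w d.2 := by
    intro d
    by_cases h4 : G.Adj d.1 d.2 ∧ ¬ H.Adj d.1 d.2
    · obtain ⟨w, hw⟩ := (h2 _ _ h4.1).resolve_left h4.2
      exact ⟨w, fun _ _ => hw⟩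
    · exact ⟨d.1, fun h5 h6 => absurd ⟨h5, h6⟩ h4⟩
  choose asg hasg using h3
  have h4 := h.paid H asg hH.1 h2 hasg
  have h5 := budget_nonneg ⊥ H asg
  have h6 := budget_le (G := G) (connected_of_isSpanner hG hH) asg
  have h7 : ((spannerAlg.outputGraph c).edgeSet.ncard : ℝ) ≤ {d : V × V | O d.1 d.2}.ncard :=
    Nat.cast_le.2 (ncard_outputGraph_le h)
  rw [Fintype.card_coe] at h6
  linarith

end Execution

/-! ### The probability of not having halted -/

section Probability

open LocalAlgorithm ENNReal

/-- The average of a function over a finite type does not exceed a bound on its values. -/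
theorem inv_card_mul_sum_le {α : Type*} [Fintype α] [Nonempty α] {f : α → ℝ≥0∞} {b : ℝ≥0∞}
    (h : ∀ a, f a ≤ b) : (Fintype.card α : ℝ≥0∞)⁻¹ * ∑ a, f a ≤ b := by
  rw [ENNReal.inv_mul_le_iff (by simp) (by simp)]
  refine (Finset.sum_le_card_nsmul _ _ b fun a _ => h a).trans ?_
  rw [nsmul_eq_mul, Finset.card_univ]

variable {V : Finset ℕ} (G : SimpleGraph V) [DecidableRel G.Adj]

/-- The distribution of the configuration `t` rounds after the configuration `c`. -/
noncomputable def runFrom : ℕ → spannerAlg.Config V → PMF (spannerAlg.Config V)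
  | 0, c => PMF.pure c
  | t + 1, c => (PMF.uniformOfFintype (spannerAlg.Flips c)).bind fun r =>
      runFrom t (spannerAlg.next G c r)

/-- `run` appends rounds at the end, whereas `runFrom` splits off the first round, as is needed for
conditioning on it. -/
theorem run_add (N s t : ℕ) :
    spannerAlg.run G N (s + t) = (spannerAlg.run G N s).bind (runFrom G t) := by
  induction t generalizing s with
  | zero => exact (PMF.bind_pure _).symm
  | succ t ih =>
    rw [show s + (t + 1) = s + 1 + t by omega, ih, run, PMF.bind_bind]
    congr 1
    funext c
    rw [PMF.bind_map]
    rfl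

theorem run_eq_runFrom (N t : ℕ) :
    spannerAlg.run G N t = runFrom G t (spannerAlg.initConfig G N) := by
  rw [← Nat.zero_add t, run_add, run, PMF.pure_bind, Nat.zero_add]

/-- The probability that `t` rounds after the configuration `c` some vertex has not halted. -/
noncomputable def liveProb (t : ℕ) (c : spannerAlg.Config V) : ℝ≥0∞ :=
  (runFrom G t c).toOuterMeasure {c | ¬ spannerAlg.AllHalted c}

variable {G}

theorem liveProb_zero {c : spannerAlg.Config V} (h : spannerAlg.AllHalted c) :
    liveProb G 0 c = 0 := by
  rw [liveProb, runFrom, PMF.toOuterMeasure_pure_apply, if_neg (fun h' => h' h)]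

theorem liveProb_le_one (t : ℕ) (c : spannerAlg.Config V) : liveProb G t c ≤ 1 := by
  rw [liveProb, PMF.toOuterMeasure_apply, ← (runFrom G t c).tsum_coe]
  exact ENNReal.tsum_le_tsum fun a => Set.indicator_le_self _ _ a

theorem liveProb_succ (t : ℕ) (c : spannerAlg.Config V) :
    liveProb G (t + 1) c = (Fintype.card (spannerAlg.Flips c) : ℝ≥0∞)⁻¹ *
      ∑ r : spannerAlg.Flips c, liveProb G t (stepWith G c fun v => r v) := by
  rw [liveProb, runFrom, PMF.toOuterMeasure_bind_apply, tsum_fintype, Finset.mul_sum]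
  refine Finset.sum_congr rfl fun r _ => ?_
  rw [PMF.uniformOfFintype_apply, ← spannerAlg_next]
  rfl

theorem liveProb_succ_le {t : ℕ} {c : spannerAlg.Config V} {b : ℝ≥0∞}
    (h : ∀ ρ, liveProb G t (stepWith G c ρ) ≤ b) : liveProb G (t + 1) c ≤ b := by
  rw [liveProb_succ]
  exact inv_card_mul_sum_le fun r => h _

/-- The type of coin outcomes depends on the configuration; once all vertices flip equally many
coins, the average is over a fixed function space. -/
theorem inv_card_mul_sum_pi {m : V → ℕ} {M : ℕ} (hm : ∀ v, m v = M) (F : (V → ℕ) → ℝ≥0∞) :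
    (Fintype.card ((v : V) → Fin (m v)) : ℝ≥0∞)⁻¹ * ∑ r : (v : V) → Fin (m v), F (fun v => r v) =
      ((M : ℝ≥0∞) ^ Fintype.card V)⁻¹ * ∑ r : V → Fin M, F (fun v => r v) := by
  obtain rfl : m = fun _ => M := funext hm
  simp

variable {N : ℕ} {U : SimpleGraph V} {O : V → V → Prop} {c : spannerAlg.Config V} {J : ℕ}

theorem StartConfig.liveProb_succ (h : StartConfig G U O N c) (t : ℕ) :
    liveProb G (t + 1) c = (((2 ^ (Nat.size N + 3) : ℕ) : ℝ≥0∞) ^ Fintype.card V)⁻¹ *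
      ∑ r : V → Fin (2 ^ (Nat.size N + 3)), liveProb G t (stepWith G c fun v => r v) := by
  rw [_root_.liveProb_succ]
  refine inv_card_mul_sum_pi (fun v => ?_) fun ρ => liveProb G t (stepWith G c ρ)
  have h1 : spannerAlg.coins.eval (c v) = Nat.size N + 3 :=
    (coinsProg_eval (c v)).trans (congrArg (fun x => x.2.1) (h.stat v))
  rw [h1]

/-- Averaging over the ranks, `psi_step` contributes a factor 31/32 per iteration. At the end a
nonzero `psi` is at least 1 and bounds any probability. If `psi` is zero, the uncovered edges lie in
no triangle: one more iteration of four rounds takes them, and a fifth round halts. -/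
theorem liveProb_le_psi (hN : V.card ≤ N) (hJ₀ : 1 ≤ J) (hJ : ∀ v, starCore G G v (2 ^ J) = ∅)
    (i : ℕ) (h : StartConfig G U O N c) :
    liveProb G (4 * i + 5) c ≤ ENNReal.ofReal ((31 / 32) ^ i * psi G U J) := by
  obtain ⟨D⟩ := exists_starData G U
  induction i generalizing c U O D with
  | zero =>
    rw [pow_zero, one_mul, ENNReal.ofReal_natCast]
    rcases Nat.eq_zero_or_pos (psi G U J) with h0 | h0
    · refine liveProb_succ_le fun r => liveProb_succ_le fun ρ₁ => liveProb_succ_le fun ρ₂ =>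
        liveProb_succ_le fun ρ₃ => liveProb_succ_le fun ρ₄ => ?_
      have h1 := h.iteration D r ρ₁ ρ₂ ρ₃
      rw [nextU_eq_bot_of_psi_eq_zero D r hJ₀ h0] at h1
      rw [liveProb_zero (h1.allHalted_step ρ₄)]
      exact zero_le
    · exact (liveProb_le_one _ _).trans (by exact_mod_cast h0)
  | succ i ih =>
    have h1 : ∀ r : V → ℕ, liveProb G (4 * (i + 1) + 4) (stepWith G c r) ≤
        ENNReal.ofReal ((31 / 32) ^ i * psi G (D.nextU r) J) := by
      intro r
      refine liveProb_succ_le fun ρ₁ => liveProb_succ_le fun ρ₂ => liveProb_succ_le fun ρ₃ => ?_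
      exact ih (h.iteration D r ρ₁ ρ₂ ρ₃) (exists_starData G _).some
    rw [h.liveProb_succ, ENNReal.inv_mul_le_iff (by simp) (by finiteness)]
    refine (Finset.sum_le_sum fun r _ => h1 _).trans ?_
    have hM : 8 * Fintype.card V ≤ 2 ^ (Nat.size N + 3) := by
      have := Nat.lt_size_self N
      rw [Fintype.card_coe, pow_add]
      omega
    have h2 := psi_step D h.le hJ hM
    generalize 2 ^ (Nat.size N + 3) = M at *
    rw [← ENNReal.ofReal_sum_of_nonneg fun r _ => by positivity, ← Finset.mul_sum,
      ← ENNReal.ofReal_natCast, ← ENNReal.ofReal_pow (Nat.cast_nonneg _),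
      ← ENNReal.ofReal_mul (by positivity)]
    refine ENNReal.ofReal_le_ofReal ?_
    have h3 : (32 : ℝ) * ∑ r : V → Fin M, (psi G (D.nextU fun w => (r w : ℕ)) J : ℝ) ≤
        31 * (M : ℝ) ^ Fintype.card V * psi G U J := by exact_mod_cast h2
    have h4 : (0 : ℝ) ≤ (31 / 32) ^ i := by positivity
    rw [pow_succ]
    nlinarith

theorem one_sub_liveProb_le (N t : ℕ) : 1 - liveProb G t (spannerAlg.initConfig G N) ≤
    (spannerAlg.run G N t).toOuterMeasure {c | spannerAlg.AllHalted c} := by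
  rw [liveProb, ← run_eq_runFrom, tsub_le_iff_right, PMF.toOuterMeasure_apply,
    PMF.toOuterMeasure_apply, ← ENNReal.tsum_add, ← (spannerAlg.run G N t).tsum_coe]
  refine ENNReal.tsum_le_tsum fun c => ?_
  by_cases h : spannerAlg.AllHalted c <;> simp [h]

theorem starCore_eq_empty_of_maxDegree_le {t : ℕ} (h : G.maxDegree ≤ t) (U : SimpleGraph V)
    (v : V) : starCore G U v t = ∅ := by
  classical
  rw [← Finset.not_nonempty_iff_eq_empty]
  intro h'
  have h1 := lt_card_starCore h'
  have h2 : (starCore G U v t).card ≤ G.degree v := by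
    rw [← SimpleGraph.card_neighborFinset_eq_degree]
    exact Finset.card_le_card fun a ha => by simpa using adj_of_mem_starCore ha
  have := G.degree_le_maxDegree v
  omega

theorem le_toOuterMeasure_allHalted (hN : V.card ≤ N) (i : ℕ) :
    ENNReal.ofReal (1 - (31 / 32) ^ i * ((V.card : ℝ) ^ 3 + 1) ^ (Nat.size G.maxDegree + 1)) ≤
      (spannerAlg.run G N (4 * i + 5)).toOuterMeasure {c | spannerAlg.AllHalted c} := by
  refine le_trans ?_ (one_sub_liveProb_le N _)
  rw [ENNReal.ofReal_sub _ (by positivity), ENNReal.ofReal_one]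
  refine tsub_le_tsub_left ?_ _
  -- `2 ^ Nat.size Δ` already exceeds the maximum degree; the extra 1 ensures that the number of
  -- levels is positive even for `Δ = 0`.
  have hJ : ∀ v, starCore G G v (2 ^ (Nat.size G.maxDegree + 1)) = ∅ :=
    starCore_eq_empty_of_maxDegree_le ((Nat.lt_size_self _).le.trans
      (Nat.pow_le_pow_right (by norm_num) (Nat.le_succ _))) G
  rw [spannerAlg_initConfig]
  refine (liveProb_le_psi hN (by omega) hJ i (StartConfig.init N)).trans
    (ENNReal.ofReal_le_ofReal (mul_le_mul_of_nonneg_left ?_ (by positivity)))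
  have := psi_le G G (Nat.size G.maxDegree + 1)
  rw [Fintype.card_coe] at this
  exact_mod_cast this

end Probability

/-! ### The number of rounds, and the conclusion -/

theorem size_le_log (d : ℕ) : (Nat.size d : ℝ) ≤ 4 * Real.log (2 + d) := by
  rcases Nat.eq_zero_or_pos d with rfl | hd
  · simp; positivity
  have h1 : 2 ^ (Nat.size d - 1) ≤ d := by
    rw [← Nat.lt_size]
    have := Nat.size_pos.2 hd
    omega
  have h2 : 1 ≤ Nat.size d := Nat.size_pos.2 hd
  have h3 : 2 ^ Nat.size d ≤ (2 + d) ^ 2 := by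
    have : 2 ^ Nat.size d = 2 ^ (Nat.size d - 1) * 2 := by
      rw [← pow_succ, Nat.sub_add_cancel h2]
    nlinarith
  have h4 : Real.log (2 ^ Nat.size d) ≤ Real.log ((2 + d) ^ 2) :=
    Real.log_le_log (by positivity) (by exact_mod_cast h3)
  rw [Real.log_pow, Real.log_pow] at h4
  have h5 := Real.log_two_gt_d9
  have h6 : (Nat.size d : ℝ) * (1 / 2) ≤ Nat.size d * Real.log 2 :=
    mul_le_mul_of_nonneg_left (by linarith) (Nat.cast_nonneg _)
  push_cast at h4
  linarith

/-- The number of iterations that suffice with high probability. -/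
theorem exists_rounds_le (k n d : ℕ) (hn : 2 ≤ n) : ∃ i : ℕ,
    ((4 * i + 5 : ℕ) : ℝ) ≤ (4000 + 1000 * k) * Real.log (2 + n) * Real.log (2 + d) ∧
      (31 / 32 : ℝ) ^ i * ((n : ℝ) ^ 3 + 1) ^ (Nat.size d + 1) ≤ 1 / (n : ℝ) ^ k := by
  obtain ⟨J, hJ⟩ : ∃ J, Nat.size d + 1 = J := ⟨_, rfl⟩
  have hn' : (2 : ℝ) ≤ n := by exact_mod_cast hn
  have hl0 : 0 ≤ Real.log n := Real.log_nonneg (by linarith)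
  have hl2 := Real.log_two_gt_d9
  have hln : Real.log n ≤ Real.log (2 + n) := Real.log_le_log (by linarith) (by linarith)
  have hlN : 1 / 2 ≤ Real.log (2 + n) := by
    have : Real.log 2 ≤ Real.log (2 + n) := Real.log_le_log (by norm_num) (by linarith)
    linarith
  have hlD : 1 / 2 ≤ Real.log (2 + d) := by
    have : Real.log 2 ≤ Real.log (2 + d) := Real.log_le_log (by norm_num) (by
      have : (0 : ℝ) ≤ d := Nat.cast_nonneg d
      linarith)
    linarith
  have hJl : (J : ℝ) ≤ 6 * Real.log (2 + d) := by
    have := size_le_log d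
    rw [← hJ]; push_cast; linarith
  -- `(31 / 32) ^ i ≤ exp (-i / 32) ≤ n ^ (-(4 * J + k))`, while the initial potential is at most
  -- `(n ^ 3 + 1) ^ J ≤ n ^ (4 * J)` for `n ≥ 2`.
  refine ⟨⌈32 * ((4 * J + k : ℕ) * Real.log n)⌉₊, ?_, ?_⟩
  · have h1 := (Nat.ceil_lt_add_one (a := 32 * ((4 * J + k : ℕ) * Real.log n)) (by positivity)).le
    generalize (⌈32 * ((4 * J + k : ℕ) * Real.log n)⌉₊) = i at *
    push_cast at h1 ⊢
    have hk : (0 : ℝ) ≤ k := Nat.cast_nonneg k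
    have h2 : ((4 * J + k : ℝ)) * Real.log n ≤ (24 + 2 * k) * Real.log (2 + d) * Real.log (2 + n) :=
      mul_le_mul (by nlinarith) hln hl0 (by positivity)
    have h3 : 1 / 4 ≤ Real.log (2 + n) * Real.log (2 + d) := by nlinarith
    nlinarith
  · rw [hJ]
    have h1 := Nat.le_ceil (32 * ((4 * J + k : ℕ) * Real.log n))
    generalize (⌈32 * ((4 * J + k : ℕ) * Real.log n)⌉₊) = i at *
    have h2 : ((n : ℝ) ^ 3 + 1) ^ J ≤ (n : ℝ) ^ (4 * J) := by
      rw [pow_mul]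
      have h3 : (1 : ℝ) ≤ (n : ℝ) ^ 3 := one_le_pow₀ (by linarith)
      refine pow_le_pow_left₀ (by positivity) ?_ J
      rw [pow_succ _ 3]
      nlinarith
    have h3 : (31 / 32 : ℝ) ^ i ≤ 1 / (n : ℝ) ^ (4 * J + k) := by
      have e : (31 / 32 : ℝ) ≤ Real.exp (-(1 / 32)) := by
        have := Real.add_one_le_exp (-(1 / 32) : ℝ)
        linarith
      refine (pow_le_pow_left₀ (by norm_num) e i).trans ?_
      rw [← Real.exp_nat_mul, one_div ((n : ℝ) ^ _), ← Real.exp_log (show (0 : ℝ) < n by linarith),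
        ← Real.exp_nat_mul, ← Real.exp_neg, Real.exp_le_exp]
      linarith
    refine (mul_le_mul h3 h2 (by positivity) (by positivity)).trans (le_of_eq ?_)
    rw [pow_add]
    field_simp

theorem theorem2 :
    ∃ A : LocalAlgorithm,
      -- only polynomial local computation
      A.HasPolynomialLocalTime ∧
      -- in every execution: termination, with a 2-spanner of guaranteed approximation ratio
      (∃ C : ℝ, ∀ (V : Finset ℕ) (G : SimpleGraph V) [DecidableRel G.Adj] (N : ℕ),
        G.Connected → V.card ≤ N →
          (∃ T : ℕ, ∀ c ∈ (A.run G N T).support, A.AllHalted c) ∧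
          ∀ T : ℕ, ∀ c ∈ (A.run G N T).support, A.AllHalted c →
            A.OutputsEdges G c ∧ IsSpanner 2 G (A.outputGraph c) ∧
            ∀ H : SimpleGraph V, IsSpanner 2 G H →
              ((A.outputGraph c).edgeSet.ncard : ℝ) ≤
                C * Real.log (2 + (G.edgeSet.ncard : ℝ) / (V.card : ℝ)) *
                  (H.edgeSet.ncard : ℝ)) ∧
      -- with high probability: the number of rounds
      (∀ k : ℕ, ∃ C : ℝ, ∀ (V : Finset ℕ) (G : SimpleGraph V) [DecidableRel G.Adj] (N : ℕ),
        G.Connected → V.card ≤ N →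
          ∃ T : ℕ,
            (T : ℝ) ≤ C * Real.log (2 + (V.card : ℝ)) * Real.log (2 + (G.maxDegree : ℝ)) ∧
            ENNReal.ofReal (1 - 1 / (V.card : ℝ) ^ k) ≤
              (A.run G N T).toOuterMeasure {c | A.AllHalted c}) := by
  refine ⟨spannerAlg, spannerAlg_hasPolynomialLocalTime, ⟨320, fun V G _ N hG hN => ?_⟩,
    fun k => ⟨4000 + 1000 * k, fun V G _ N hG hN => ?_⟩⟩
  · refine ⟨exists_forall_allHalted G N, fun T c hc h => ?_⟩
    obtain ⟨O, hO⟩ := exists_progress_of_allHalted hc h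
    exact ⟨outputsEdges hO, isSpanner_outputGraph hO, fun H hH =>
      ncard_outputGraph_le_of_isSpanner hG hO hH⟩
  · have hV : V.card ≠ 0 := by
      obtain ⟨v⟩ := hG.nonempty
      exact Finset.card_ne_zero_of_mem v.2
    -- For a single vertex the required probability is 0, so zero rounds are enough; the estimate `n
    -- ^ 3 + 1 ≤ n ^ 4` fails there.
    rcases Nat.lt_or_ge V.card 2 with hn | hn
    · refine ⟨0, ?_, ?_⟩
      · have h1 : 0 ≤ Real.log (2 + (V.card : ℝ)) := Real.log_nonneg (by
          have : (0 : ℝ) ≤ V.card := Nat.cast_nonneg _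
          linarith)
        have h2 : 0 ≤ Real.log (2 + (G.maxDegree : ℝ)) := Real.log_nonneg (by
          have : (0 : ℝ) ≤ G.maxDegree := Nat.cast_nonneg _
          linarith)
        rw [Nat.cast_zero]
        positivity
      · rw [show V.card = 1 by omega]
        simp
    · obtain ⟨i, h1, h2⟩ := exists_rounds_le k V.card G.maxDegree hn
      refine ⟨4 * i + 5, h1, le_trans (ENNReal.ofReal_le_ofReal ?_)
        (le_toOuterMeasure_allHalted hN i)⟩
      exact sub_le_sub_left h2 1
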